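/- Fix an integer $d\ge 2$ and let $\log=\log_2$. **Problem and model.** An instance of MINI-WEIGHTED $d$-SAT is a pair $(\mathcal F,k)$ of a $d$-CNF formula $\mathcal F$ over variables $x_1,\dots,x_n$ ($n\ge 1$), i.e. a set of clauses with $d$ literals each, and an integer $k\ge 1$; put $K=\lfloor k\log n\rfloor$. One asks for a satisfying assignment of $\mathcal F$ of weight $K$ (exactly $K$ variables TRUE). The random formula $\mathcal F^{n,p}_{k,d}$ is generated as follows: independently for every set of $d$ of the $n$ variables, with probability $p$, include one clause chosen uniformly at random from the $2^d-1$ clauses over these $d$ variables that contain at least one negated literal. **Frozen variables and reduction.** A variable $x$ is $K$-frozen in $\mathcal F$ if there are $K$ pairwise disjoint sets $Y_1,\dots,Y_K$ of $d-1$ variables other than $x$ such that every clause $\bar x\vee\bigvee_{y\in Y_i}y$ is in $\mathcal F$. For a set $U$ of variables, $\mathrm{REDUCE}(\mathcal F,U)$ is obtained by setting the variables of $U$ to FALSE, and then, as long as possible, setting to FALSE every variable $x$ for which some clause has been shrunk to the single literal $\bar x$; satisfied clauses are removed and false literals are deleted. The residual graph of a formula has its variables as vertices, two being adjacent if they occur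 in a common clause. **Theorem.** There are a deterministic algorithm (a program for a random access machine with addition and subtraction, at unit cost) and constants $A,B$, depending only on $d$, such that the following holds. The algorithm takes as input an instance $(\mathcal F,k)$, with the clauses and their literals listed without repetition in any order, and answers with an assignment, with UNSAT, or with FAILURE. 1. On every instance it halts within $A\,(k^2n+n^B)$ steps. If it answers with an assignment, this is a satisfying assignment of weight $K$; if it answers UNSAT, there is none. It is a variant of W-SAT: on every input there is a set $U$ of $K$-frozen variables of $\mathcal F$ such that it answers FAILURE if and only if the residual graph of $\mathrm{REDUCE}(\mathcal F,U)$ has a connected component with more than $\log n$ variables. 2. For every integer $k\ge1$, every real $c>k(2^d-1)(d-1)!$ and $p=\frac{c\log n}{n^{d-1}}$, with probability tending to $1$ as $n\to\infty$ the algorithm solves the random instance $(\mathcal F^{n,p}_{k,d},k)$, however its clauses are listed: it finds a satisfying assignment of weight $K$ or correctly reports that none exists. -/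

import Mathlib

open Filter Topology

namespace MiniSat

/-! ### Clauses, formulas, assignments -/

/-- A literal over the variables `x_0, …, x_{n-1}`: the pair `(i, true)` is the positive literal
`x_i`, the pair `(i, false)` is the negated literal. -/
abbrev Literal (n : ℕ) := Fin n × Bool

/-- A clause: the disjunction of a finite set of literals. -/
abbrev Clause (n : ℕ) := Finset (Literal n)

/-- A CNF formula: the conjunction of a finite set of clauses. -/
abbrev Formula (n : ℕ) := Finset (Clause n)

/-- The variables that occur in a clause. -/
def Clause.vars {n : ℕ} (C : Clause n) : Finset (Fin n) := C.image Prod.fst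

/-- A `d`-CNF formula consists of clauses with exactly `d` literals. -/
def IsDCNF (d : ℕ) {n : ℕ} (F : Formula n) : Prop := ∀ C ∈ F, C.card = d

/-- The assignment `a` satisfies the formula `F`. -/
def Satisfies {n : ℕ} (a : Fin n → Bool) (F : Formula n) : Prop :=
  ∀ C ∈ F, ∃ l ∈ C, a l.1 = l.2

/-- The weight of an assignment: the number of variables set to TRUE. -/
def weight {n : ℕ} (a : Fin n → Bool) : ℕ := (Finset.univ.filter fun i => a i = true).card

/-- The weight `⌊k log₂ n⌋` that MINI-WEIGHTED `d`-SAT with parameter `k` asks for. -/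
noncomputable def miniWeight (k n : ℕ) : ℕ := ⌊(k : ℝ) * Real.logb 2 n⌋₊

/-! ### Frozen variables, the subroutine REDUCE and the residual graph -/

/-- The clause `¬x ∨ ⋁_{y ∈ Y} y`. -/
def freezingClause {n : ℕ} (x : Fin n) (Y : Finset (Fin n)) : Clause n :=
  insert (x, false) (Y.image fun y => (y, true))

/-- `x` is a `K`-frozen variable of the `d`-CNF formula `F`: there are `K` pairwise disjoint sets
`Y i` of `d - 1` variables other than `x`, such that all clauses `¬x ∨ ⋁_{y ∈ Y i} y` are in `F`. -/
def IsFrozen (d K : ℕ) {n : ℕ} (F : Formula n) (x : Fin n) : Prop :=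
  ∃ Y : Fin K → Finset (Fin n),
    (∀ i, (Y i).card = d - 1 ∧ x ∉ Y i ∧ freezingClause x (Y i) ∈ F) ∧
    ∀ i j, i ≠ j → Disjoint (Y i) (Y j)

/-- The variables that are FALSE after REDUCE has been run on `F`, starting with the variables in
`U` set to FALSE: those in `U`, and those `x` for which unit propagation has shrunk some clause to
the single literal `¬x`. -/
inductive Forced {n : ℕ} (F : Formula n) (U : Finset (Fin n)) : Fin n → Prop
  | base (x : Fin n) (hx : x ∈ U) : Forced F U x
  | unit (C : Clause n) (hC : C ∈ F) (x : Fin n) (hx : (x, false) ∈ C)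
      (hpos : ∀ l ∈ C, l ≠ (x, false) → l.2 = true)
      (hdel : ∀ l ∈ C, l ≠ (x, false) → Forced F U l.1) : Forced F U x

open Classical in
/-- The reduced formula `REDUCE(F, U)`: clauses satisfied by the FALSE variables are removed, and
in the other clauses the literals that became false are deleted. -/
noncomputable def reduce {n : ℕ} (F : Formula n) (U : Finset (Fin n)) : Formula n :=
  (F.filter fun C => ∀ l ∈ C, Forced F U l.1 → l.2 = true).image
    fun C => C.filter fun l => ¬ Forced F U l.1

/-- The residual graph: two variables are adjacent if they occur in a common clause. -/
def residualGraph {n : ℕ} (F : Formula n) : SimpleGraph (Fin n) where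
  Adj x y := x ≠ y ∧ ∃ C ∈ F, x ∈ C.vars ∧ y ∈ C.vars
  symm := ⟨fun _ _ h => ⟨h.1.symm, h.2.imp fun _ hC => ⟨hC.1, hC.2.2, hC.2.1⟩⟩⟩
  loopless := ⟨fun _ h => h.1 rfl⟩

/-- Some connected component of `F` (on the variables that occur in `F`) has more than `log₂ n`
variables. -/
def HasLargeComponent {n : ℕ} (F : Formula n) : Prop :=
  ∃ C ∈ F, ∃ x ∈ C.vars,
    Real.logb 2 n < (((residualGraph F).connectedComponentMk x).supp.ncard : ℝ)

/-! ### The machine model: random access machines with unit costs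

A machine has registers and a memory, both indexed by `ℕ` and holding natural numbers. Every
instruction and every test costs one time unit; the arithmetic instructions are addition and
(truncated) subtraction. -/

/-- Memory states. -/
structure State where
  reg : ℕ → ℕ
  mem : ℕ → ℕ

/-- Programs. -/
inductive Program
  /-- do nothing -/
  | skip
  /-- `reg r := v` -/
  | const (r v : ℕ)
  /-- `reg r := reg s + reg t` -/
  | add (r s t : ℕ)
  /-- `reg r := reg s - reg t`, truncated at zero -/
  | sub (r s t : ℕ)
  /-- `reg r := mem (reg s)` -/
  | load (r s : ℕ)
  /-- `mem (reg r) := reg s` -/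
  | store (r s : ℕ)
  /-- first `P`, then `Q` -/
  | seq (P Q : Program)
  /-- if `reg r ≠ 0` then `P` else `Q` -/
  | cond (r : ℕ) (P Q : Program)
  /-- while `reg r ≠ 0` do `P` -/
  | loop (r : ℕ) (P : Program)

/-- Set a register. -/
def State.setReg (s : State) (r v : ℕ) : State := { s with reg := Function.update s.reg r v }

/-- Set a memory cell. -/
def State.setMem (s : State) (a v : ℕ) : State := { s with mem := Function.update s.mem a v }

/-- `Runs P s t s'`: started in the state `s`, the program `P` halts after exactly `t` steps, in
the state `s'`. -/
inductive Runs : Program → State → ℕ → State → Prop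
  | skip (s : State) : Runs .skip s 1 s
  | const (s : State) (r v : ℕ) : Runs (.const r v) s 1 (s.setReg r v)
  | add (s : State) (r a b : ℕ) : Runs (.add r a b) s 1 (s.setReg r (s.reg a + s.reg b))
  | sub (s : State) (r a b : ℕ) : Runs (.sub r a b) s 1 (s.setReg r (s.reg a - s.reg b))
  | load (s : State) (r a : ℕ) : Runs (.load r a) s 1 (s.setReg r (s.mem (s.reg a)))
  | store (s : State) (r a : ℕ) : Runs (.store r a) s 1 (s.setMem (s.reg r) (s.reg a))
  | seq {P Q : Program} {s s' s'' : State} {t t' : ℕ} (hP : Runs P s t s')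
      (hQ : Runs Q s' t' s'') : Runs (.seq P Q) s (t + t') s''
  | condTrue {P Q : Program} {r : ℕ} {s s' : State} {t : ℕ} (hr : s.reg r ≠ 0)
      (hP : Runs P s t s') : Runs (.cond r P Q) s (t + 1) s'
  | condFalse {P Q : Program} {r : ℕ} {s s' : State} {t : ℕ} (hr : s.reg r = 0)
      (hQ : Runs Q s t s') : Runs (.cond r P Q) s (t + 1) s'
  | loopDone {P : Program} {r : ℕ} {s : State} (hr : s.reg r = 0) : Runs (.loop r P) s 1 s
  | loopStep {P : Program} {r : ℕ} {s s' s'' : State} {t t' : ℕ} (hr : s.reg r ≠ 0)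
      (hP : Runs P s t s') (hL : Runs (.loop r P) s' t' s'') :
      Runs (.loop r P) s (t + t' + 1) s''

/-- The machine is deterministic: running time and final state are determined by the start. -/
theorem Runs.deterministic {P : Program} {s s₁ : State} {t₁ : ℕ} (h₁ : Runs P s t₁ s₁) :
    ∀ {t₂ : ℕ} {s₂ : State}, Runs P s t₂ s₂ → t₁ = t₂ ∧ s₁ = s₂ := by
  induction h₁ with
  | skip | const | add | sub | load | store => intro t₂ s₂ h; cases h; exact ⟨rfl, rfl⟩
  | seq _ _ ihP ihQ =>
    intro t₂ s₂ h
    cases h with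
    | seq hP hQ =>
      obtain ⟨rfl, rfl⟩ := ihP hP
      obtain ⟨rfl, rfl⟩ := ihQ hQ
      exact ⟨rfl, rfl⟩
  | condTrue hr _ ih =>
    intro t₂ s₂ h
    cases h with
    | condTrue _ hP => obtain ⟨rfl, rfl⟩ := ih hP; exact ⟨rfl, rfl⟩
    | condFalse hr' _ => exact absurd hr' hr
  | condFalse hr _ ih =>
    intro t₂ s₂ h
    cases h with
    | condTrue hr' _ => exact absurd hr hr'
    | condFalse _ hQ => obtain ⟨rfl, rfl⟩ := ih hQ; exact ⟨rfl, rfl⟩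
  | loopDone hr =>
    intro t₂ s₂ h
    cases h with
    | loopDone _ => exact ⟨rfl, rfl⟩
    | loopStep hr' _ _ => exact absurd hr hr'
  | loopStep hr _ _ ihP ihL =>
    intro t₂ s₂ h
    cases h with
    | loopDone hr' => exact absurd hr' hr
    | loopStep _ hP hL =>
      obtain ⟨rfl, rfl⟩ := ihP hP
      obtain ⟨rfl, rfl⟩ := ihL hL
      exact ⟨rfl, rfl⟩

/-! ### Input and output -/

/-- `L` lists the clauses of `F`, each clause once, and the literals of each clause, each literal
once, in some order. -/
def Lists {n : ℕ} (L : List (List (Literal n))) (F : Formula n) : Prop :=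
  (∀ l ∈ L, l.Nodup) ∧ (L.map List.toFinset).Nodup ∧ (L.map List.toFinset).toFinset = F

/-- The code of a literal: `2 i + 1` for `x_i` and `2 i` for its negation. -/
def encodeLiteral {n : ℕ} (l : Literal n) : ℕ := 2 * l.1.val + l.2.toNat

/-- The start state for the instance `(F, k)`, where `F` is listed by `L`: registers `0`, `1`, `2`
hold `n`, `k` and the number of clauses, the memory holds the codes of the literals, clause after
clause, and everything else is zero. -/
def inputState {n : ℕ} (k : ℕ) (L : List (List (Literal n))) : State where
  reg i := if i = 0 then n else if i = 1 then k else if i = 2 then L.length else 0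
  mem a := (L.flatten.map encodeLiteral).getD a 0

/-- The possible answers of an algorithm. -/
inductive Answer (n : ℕ)
  /-- a satisfying assignment of the required weight -/
  | found (a : Fin n → Bool)
  /-- "no such assignment exists" -/
  | unsat
  /-- "FAILURE" -/
  | failure

/-- The answer given in a final state: register `0` is `0` for FAILURE, `1` for an assignment,
whose `i`-th value is then TRUE iff memory cell `i` is nonzero, and anything else for UNSAT. -/
def State.answer (s : State) (n : ℕ) : Answer n :=
  match s.reg 0 with
  | 0 => .failure
  | 1 => .found fun i => decide (s.mem i.val ≠ 0)
  | _ => .unsat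

/-- The answer is a correct solution of the problem of finding a satisfying assignment of `F` of
weight `K` or reporting that there is none. -/
def Answer.Solves {n : ℕ} (F : Formula n) (K : ℕ) : Answer n → Prop
  | .found a => Satisfies a F ∧ weight a = K
  | .unsat => ¬ ∃ a : Fin n → Bool, Satisfies a F ∧ weight a = K
  | .failure => False

/-! ### The random model -/

/-- The potential hyperedges: sets of `d` variables. -/
abbrev Hyperedge (d n : ℕ) := {S : Finset (Fin n) // S.card = d}

/-- The non-monotone clauses over the set of variables `S`: they contain exactly one literal for
each variable of `S`, and at least one negated literal. -/
def nonMonotoneClauses {n : ℕ} (S : Finset (Fin n)) : Finset (Clause n) :=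
  Finset.univ.filter fun C => C.vars = S ∧ C.card = S.card ∧ ∃ l ∈ C, l.2 = false

/-- The contribution of one set `S` of variables to the random formula: with probability `p`, one
clause chosen uniformly from the non-monotone clauses over `S`; otherwise no clause. (A real `p`
outside of `[0, 1]` is replaced by the nearest point of this interval.) -/
noncomputable def hyperedgeLaw {n : ℕ} (p : ℝ) (S : Finset (Fin n)) :
    MeasureTheory.Measure (Finset (Clause n)) :=
  ENNReal.ofReal (min p 1) •
      (ProbabilityTheory.uniformOn (nonMonotoneClauses S : Set (Clause n))).map
        (fun C => ({C} : Finset (Clause n))) +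
    (1 - ENNReal.ofReal (min p 1)) • MeasureTheory.Measure.dirac ∅

/-- The random model: the contributions of the sets of `d` variables are independent. -/
noncomputable def modelLaw (d n : ℕ) (p : ℝ) :
    MeasureTheory.Measure (Hyperedge d n → Finset (Clause n)) :=
  MeasureTheory.Measure.pi fun S => hyperedgeLaw p S.1

/-- The random formula consists of all contributed clauses. -/
def modelFormula {d n : ℕ} (ω : Hyperedge d n → Finset (Clause n)) : Formula n :=
  Finset.univ.biUnion ω

end MiniSat

/-! The algorithm. In a satisfying assignment of weight K every K-frozen variable is FALSE: were it
TRUE, each of the K disjoint sets would have to contain a further TRUE variable, and the weight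
would exceed K. Unit propagation preserves this (`Forced.eq_false`). Instead of searching for K
disjoint sets, the algorithm chooses for each x a maximal family of disjoint freezing sets greedily,
and puts x into U if this family has at least K members. So membership in U is always justified, and
a variable outside U has a maximal family with fewer than K members
(`Represents.hasSmallMaximalFamily`). If all residual components have at most log n variables, each
has at most n local assignments, and a subset-sum recursion over the components yields the
attainable weights (`Represents.iter_sums`). Fixing the variables one after another turns this
decision into an assignment (`Represents.build_spec`).

The machine. With M clauses, every loop runs N = n + M + 2 times, and a set of numbers below N is
stored as a single number with N binary digits, which unit costs permit. The functions satisfying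
`Comp` are closed under conditionals, bounded iteration, counting and set formation, so an
expression for the result already provides a program that is polynomial in N (`exists_program`). As
M ≤ (2n)^d, this is polynomial in n. The parameter k never bounds a loop, since the exponent in n^k
may be cut off at n + 1.

The random formula. FAILURE requires one of two unlikely events, up to a null set. (a)
`HasOverlaps`: two distinct hyperedges at a common vertex x each meet a further hyperedge through x
outside of x. This has probability O(log⁴ n / n). Without it, a variable outside U has at most K
freezing clauses (`freezeCount_le`). (b) `HasBadChain`: a residual component with more than log n ≥
1 + dm variables can be explored by m present hyperedges, each leading to a new vertex that is not
forced, hence outside U (`hasBadChain_of_largeComponent`). For fixed m there are at most n · (O(1) ·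
n^(d-1))^m chains, and their hyperedges are present with probability p^m, which leaves n · O(log
n)^m. Moreover each of the m new vertices must have at most K ≤ k log n freezing clauses, although
about κ log n are expected, where κ = c / ((2^d - 1) (d - 1)!) > k. Freezing hyperedges that meet
the explored set in one vertex differ from those of the chain and from one another, so independence
and an exponential moment give a factor n^(-δ) per vertex (`modelLaw_le`, `exists_rate`). With m ≥
2/δ the union bound is O(log^m n / n). -/

namespace MiniSat

/-! ### Polynomial-time computability by register programs -/

/-- The registers below `m` and the memory agree. -/
def Agree (m : ℕ) (s s' : State) : Prop := (∀ i < m, s.reg i = s'.reg i) ∧ s.mem = s'.mem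

theorem Agree.refl (m : ℕ) (s : State) : Agree m s s := ⟨fun _ _ => rfl, rfl⟩

theorem Agree.trans {m : ℕ} {s s' s'' : State} (h : Agree m s s') (h' : Agree m s' s'') :
    Agree m s s'' :=
  ⟨fun i hi => (h.1 i hi).trans (h'.1 i hi), h.2.trans h'.2⟩

theorem Agree.mono {m m' : ℕ} {s s' : State} (hm : m' ≤ m) (h : Agree m s s') : Agree m' s s' :=
  ⟨fun i hi => h.1 i (by omega), h.2⟩

@[simp] theorem State.setReg_reg (s : State) (r v i : ℕ) :
    (s.setReg r v).reg i = if i = r then v else s.reg i := by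
  simp [State.setReg, Function.update_apply]

@[simp] theorem State.setReg_mem (s : State) (r v : ℕ) : (s.setReg r v).mem = s.mem := rfl

theorem Agree.setReg {m r : ℕ} {s s' : State} (v : ℕ) (h : Agree m s s') (hr : m ≤ r) :
    Agree m s (s'.setReg r v) :=
  ⟨fun i hi => by rw [h.1 i hi, State.setReg_reg, if_neg (by omega)], h.2⟩

/-- The parameters of a computation: the memory `μ`, the bound `N` on the length of all loops
(register `0`), and the contents `k`, `M`, `n` of the registers `1`, `2`, `3`. -/
structure Inst where
  μ : ℕ → ℕ
  N : ℕ
  k : ℕ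
  M : ℕ
  n : ℕ

/-- The parameters held by a state. -/
def State.inst (s : State) : Inst := ⟨s.mem, s.reg 0, s.reg 1, s.reg 2, s.reg 3⟩

/-- Contexts: types of tuples of numbers, stored in registers. `IsGet m g` says that `g` reads off
a tuple from registers below `m`. -/
class Ctx (α : Type) where
  inst : α → Inst
  IsGet : ℕ → (State → α) → Prop
  mono : ∀ {m m' : ℕ} {g : State → α}, m ≤ m' → IsGet m g → IsGet m' g
  dep : ∀ {m : ℕ} {g : State → α} {s s' : State}, IsGet m g → Agree m s s' → g s = g s'
  inst_eq : ∀ {m : ℕ} {g : State → α} (s : State), IsGet m g → inst (g s) = s.inst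
  four_le : ∀ {m : ℕ} {g : State → α}, IsGet m g → 4 ≤ m

theorem Agree.inst_eq {m : ℕ} (hm : 4 ≤ m) {s s' : State} (h : Agree m s s') :
    s.inst = s'.inst := by
  simp [State.inst, h.1 0 (by omega), h.1 1 (by omega), h.1 2 (by omega), h.1 3 (by omega), h.2]

instance : Ctx Inst where
  inst := id
  IsGet m g := 4 ≤ m ∧ g = State.inst
  mono h h' := ⟨h'.1.trans h, h'.2⟩
  dep h h' := by rw [h.2]; exact h'.inst_eq h.1
  inst_eq s h := by rw [h.2]; rfl
  four_le h := h.1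

/-- Every variable bound by a quantifier or an iteration becomes one further component, so nested
expressions are functions on iterated products with ℕ. -/
instance {α : Type} [Ctx α] : Ctx (α × ℕ) where
  inst p := Ctx.inst p.1
  IsGet m g := ∃ (g₁ : State → α) (r : ℕ), Ctx.IsGet m g₁ ∧ r < m ∧ g = fun s => (g₁ s, s.reg r)
  mono := by
    rintro m m' _ h ⟨g₁, r, h₁, hr, rfl⟩
    exact ⟨g₁, r, Ctx.mono h h₁, hr.trans_le h, rfl⟩
  dep := by
    rintro m _ s s' ⟨g₁, r, h₁, hr, rfl⟩ h
    simp only [Ctx.dep h₁ h, h.1 r hr]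
  inst_eq := by
    rintro m _ s ⟨g₁, r, h₁, hr, rfl⟩
    exact Ctx.inst_eq s h₁
  four_le := by
    rintro m _ ⟨g₁, r, h₁, hr, rfl⟩
    exact Ctx.four_le h₁

/-- The program `P` computes the function `f` of a tuple stored in the registers below `m`, leaving
these registers and the memory unchanged and putting the result into register `m`, in time
polynomial in the number in register `0`. -/
def CompBy {α : Type} (m : ℕ) (g : State → α) (f : α → ℕ) (P : Program) : Prop :=
  ∃ c e : ℕ, ∀ s, ∃ t s', Runs P s t s' ∧ t ≤ c * (s.reg 0 + 1) ^ e ∧ Agree m s s' ∧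
    s'.reg m = f (g s)

/-- `f` can be computed in time polynomial in the number in register `0`. -/
def Comp {α : Type} [Ctx α] (f : α → ℕ) : Prop :=
  ∀ (m : ℕ) (g : State → α), Ctx.IsGet m g → ∃ P, CompBy m g f P

theorem poly_le_poly {c c' e e' N : ℕ} (hc : c ≤ c') (he : e ≤ e') :
    c * (N + 1) ^ e ≤ c' * (N + 1) ^ e' :=
  Nat.mul_le_mul hc (Nat.pow_le_pow_right (by omega) he)

/-- Iteration: start with `a` and apply `f 0`, …, `f (n - 1)`. -/
def iter (n a : ℕ) (f : ℕ → ℕ → ℕ) : ℕ := Nat.rec a f n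

@[simp] theorem iter_zero (a : ℕ) (f : ℕ → ℕ → ℕ) : iter 0 a f = a := rfl

@[simp] theorem iter_succ (n a : ℕ) (f : ℕ → ℕ → ℕ) : iter (n + 1) a f = f n (iter n a f) := rfl

/-- There is no copy instruction; adding a register to a fresh zero takes its place. -/
theorem compBy_reg {α : Type} {m r : ℕ} (hr : r < m) {g : State → α} {f : α → ℕ}
    (hf : ∀ s, f (g s) = s.reg r) : ∃ P, CompBy m g f P :=
  ⟨.seq (.const m 0) (.add m r m), 2, 0, fun s => ⟨_, _, .seq (.const s m 0) (.add _ m r m),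
    by simp, ((Agree.refl m s).setReg _ le_rfl).setReg _ le_rfl, by simp [hf, hr.ne]⟩⟩

/-! ### Basic closure rules: constants, arithmetic, memory access, conditionals, bounded iteration
-/

section rules

variable {α : Type} [Ctx α]

theorem Comp.const (v : ℕ) : Comp (fun _ : α => v) := fun m _ _ =>
  ⟨.const m v, 1, 0, fun s => ⟨_, _, .const s m v, by simp, (Agree.refl m s).setReg v le_rfl,
    by simp⟩⟩

theorem Comp.N : Comp (fun a : α => (Ctx.inst a).N) := fun _ _ hg =>
  compBy_reg (r := 0) (by have := Ctx.four_le hg; omega) fun s => by simp [Ctx.inst_eq s hg, State.inst]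

theorem Comp.k : Comp (fun a : α => (Ctx.inst a).k) := fun _ _ hg =>
  compBy_reg (r := 1) (by have := Ctx.four_le hg; omega) fun s => by simp [Ctx.inst_eq s hg, State.inst]

theorem Comp.M : Comp (fun a : α => (Ctx.inst a).M) := fun _ _ hg =>
  compBy_reg (r := 2) (by have := Ctx.four_le hg; omega) fun s => by simp [Ctx.inst_eq s hg, State.inst]

theorem Comp.n : Comp (fun a : α => (Ctx.inst a).n) := fun _ _ hg =>
  compBy_reg (r := 3) (by have := Ctx.four_le hg; omega) fun s => by simp [Ctx.inst_eq s hg, State.inst]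

theorem Comp.snd : Comp (fun p : α × ℕ => p.2) := by
  rintro m _ ⟨g₁, r, h₁, hr, rfl⟩
  exact compBy_reg hr fun s => rfl

theorem Comp.fst {f : α → ℕ} (hf : Comp f) : Comp (fun p : α × ℕ => f p.1) := by
  rintro m _ ⟨g₁, r, h₁, hr, rfl⟩
  exact hf m g₁ h₁

theorem Comp.binop {f g : α → ℕ} (op : ℕ → ℕ → ℕ) (I : ℕ → ℕ → ℕ → Program)
    (hI : ∀ s r a b, Runs (I r a b) s 1 (s.setReg r (op (s.reg a) (s.reg b))))
    (hf : Comp f) (hg : Comp g) : Comp (fun a => op (f a) (g a)) := by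
  intro m γ hγ
  obtain ⟨P, c, e, hP⟩ := hf m γ hγ
  -- The second operand is computed with register `m` counted as protected, since it holds the first
  -- operand.
  obtain ⟨Q, c', e', hQ⟩ := hg (m + 1) γ (Ctx.mono (by omega) hγ)
  refine ⟨.seq P (.seq Q (I m m (m + 1))), c + c' + 1, e + e', fun s => ?_⟩
  obtain ⟨t, s₁, h₁, ht, ha, hr⟩ := hP s
  obtain ⟨t', s₂, h₂, ht', ha', hr'⟩ := hQ s₁
  have h4 := Ctx.four_le hγ
  refine ⟨_, _, .seq h₁ (.seq h₂ (hI _ _ _ _)), ?_, ?_, ?_⟩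
  · rw [← ha.1 0 (by omega)] at ht'
    have h1 := ht.trans (poly_le_poly le_rfl (Nat.le_add_right e e'))
    have h2 := ht'.trans (poly_le_poly le_rfl (Nat.le_add_left e' e))
    have h3 : 0 < (s.reg 0 + 1) ^ (e + e') := by positivity
    nlinarith
  · exact (ha.trans (ha'.mono (by omega))).setReg _ le_rfl
  · simp [← ha'.1 m (by omega), hr, hr', Ctx.dep hγ ha]

theorem Comp.add {f g : α → ℕ} (hf : Comp f) (hg : Comp g) : Comp (fun a => f a + g a) :=
  Comp.binop (· + ·) .add (fun s r a b => .add s r a b) hf hg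

theorem Comp.sub {f g : α → ℕ} (hf : Comp f) (hg : Comp g) : Comp (fun a => f a - g a) :=
  Comp.binop (· - ·) .sub (fun s r a b => .sub s r a b) hf hg

theorem Comp.mem {f : α → ℕ} (hf : Comp f) : Comp (fun a => (Ctx.inst a).μ (f a)) := by
  intro m γ hγ
  obtain ⟨P, c, e, hP⟩ := hf m γ hγ
  refine ⟨.seq P (.load m m), c + 1, e, fun s => ?_⟩
  obtain ⟨t, s₁, h₁, ht, ha, hr⟩ := hP s
  refine ⟨_, _, .seq h₁ (.load _ _ _), ?_, ha.setReg _ le_rfl, ?_⟩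
  · have h3 : 0 < (s.reg 0 + 1) ^ e := by positivity
    nlinarith
  · simp [hr, ← ha.2, Ctx.inst_eq s hγ, State.inst]

theorem Comp.cond {f g h : α → ℕ} (hf : Comp f) (hg : Comp g) (hh : Comp h) :
    Comp (fun a => if f a = 0 then h a else g a) := by
  intro m γ hγ
  obtain ⟨P, c, e, hP⟩ := hf m γ hγ
  obtain ⟨Q, c', e', hQ⟩ := hg m γ hγ
  obtain ⟨R, c'', e'', hR⟩ := hh m γ hγ
  refine ⟨.seq P (.cond m Q R), c + c' + c'' + 1, e + e' + e'', fun s => ?_⟩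
  have h4 := Ctx.four_le hγ
  obtain ⟨t, s₁, h₁, ht, ha, hr⟩ := hP s
  have h3 : 0 < (s.reg 0 + 1) ^ (e + e' + e'') := by positivity
  have h1 := ht.trans (poly_le_poly le_rfl (show e ≤ e + e' + e'' by omega))
  by_cases h0 : f (γ s) = 0
  · obtain ⟨t', s₂, h₂, ht', ha', hr'⟩ := hR s₁
    refine ⟨_, _, .seq h₁ (.condFalse (hr.trans h0) h₂), ?_, ha.trans ha', ?_⟩
    · rw [← ha.1 0 (by omega)] at ht'
      have h2 := ht'.trans (poly_le_poly le_rfl (show e'' ≤ e + e' + e'' by omega))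
      nlinarith
    · simp only [hr', ← Ctx.dep hγ ha, h0, if_true]
  · obtain ⟨t', s₂, h₂, ht', ha', hr'⟩ := hQ s₁
    refine ⟨_, _, .seq h₁ (.condTrue (by rwa [hr]) h₂), ?_, ha.trans ha', ?_⟩
    · rw [← ha.1 0 (by omega)] at ht'
      have h2 := ht'.trans (poly_le_poly le_rfl (show e' ≤ e + e' + e'' by omega))
      nlinarith
    · simp only [hr', ← Ctx.dep hγ ha, h0, if_false]

/-- The body of the loop that computes an iteration. -/
def iterBody (m : ℕ) (P : Program) : Program :=
  .seq P (.seq (.const (m + 5) 0) (.seq (.add (m + 1) (m + 4) (m + 5))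
    (.seq (.add m m (m + 3)) (.sub (m + 2) (m + 2) (m + 3)))))

/-- Registers `m`, …, `m + 3` hold the round number, the current value, the number of remaining
rounds and the constant 1. The body leaves the new value in `m + 4`, and `m + 5` supplies the zero
for copying it. The induction is on the remaining rounds, with round number plus remaining rounds
constant. -/
theorem runs_iterLoop {m : ℕ} {γ : State → α} (hγ : Ctx.IsGet m γ) {f : α → ℕ → ℕ → ℕ}
    {P : Program} {c e : ℕ}
    (hP : ∀ s, ∃ t s', Runs P s t s' ∧ t ≤ c * (s.reg 0 + 1) ^ e ∧ Agree (m + 4) s s' ∧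
      s'.reg (m + 4) = f (γ s) (s.reg m) (s.reg (m + 1))) (a b : ℕ) :
    ∀ (r i : ℕ) (s : State), s.reg m = i → s.reg (m + 1) = iter i b (f (γ s)) →
      s.reg (m + 2) = r → s.reg (m + 3) = 1 → i + r = a →
      ∃ t s', Runs (.loop (m + 2) (iterBody m P)) s t s' ∧
        t ≤ r * (c * (s.reg 0 + 1) ^ e + 5) + 1 ∧ Agree m s s' ∧
        s'.reg (m + 1) = iter a b (f (γ s)) := by
  have h4 := Ctx.four_le hγ
  intro r
  induction r with
  | zero =>
    rintro i s hi hb hr h1 rfl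
    exact ⟨_, _, .loopDone hr, by simp, Agree.refl m s, by simpa using hb⟩
  | succ r ih =>
    rintro i s hi hb hr h1 rfl
    obtain ⟨t, s₁, h₁, ht, ha, hv⟩ := hP s
    have hd := Ctx.dep hγ (ha.mono (show m ≤ m + 4 by omega))
    set s₂ : State := (((s₁.setReg (m + 5) 0).setReg (m + 1) (s₁.reg (m + 4))).setReg m
      (s₁.reg m + s₁.reg (m + 3))).setReg (m + 2) (s₁.reg (m + 2) - s₁.reg (m + 3)) with hs₂
    have hbody : Runs (iterBody m P) s (t + (1 + (1 + (1 + 1)))) s₂ := by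
      refine .seq h₁ (.seq (.const _ _ _) (.seq (.add _ _ _ _) ?_))
      have := Runs.seq (Runs.add ((s₁.setReg (m + 5) 0).setReg (m + 1)
        ((s₁.setReg (m + 5) 0).reg (m + 4) + (s₁.setReg (m + 5) 0).reg (m + 5))) m m (m + 3))
        (.sub _ (m + 2) (m + 2) (m + 3))
      simpa [hs₂] using this
    have ha₂ : Agree m s s₂ :=
      ((((ha.mono (show m ≤ m + 4 by omega)).setReg _ (by omega)).setReg _ (by omega)).setReg _
        (by omega)).setReg _ (by omega)
    have hγ₂ : γ s₂ = γ s := (Ctx.dep hγ ha₂).symm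
    obtain ⟨t', s₃, h₃, ht', ha', hv'⟩ := ih (i + 1) s₂
      (by simp [hs₂, ← ha.1 m (by omega), ← ha.1 (m + 3) (by omega), hi, h1])
      (by rw [hγ₂]; simp [hs₂, hv, hi, hb])
      (by simp [hs₂, ← ha.1 (m + 2) (by omega), ← ha.1 (m + 3) (by omega), hr, h1])
      (by simp [hs₂, ← ha.1 (m + 3) (by omega), h1]) (by omega)
    refine ⟨_, _, .loopStep (by omega) hbody h₃, ?_, ha₂.trans ha', by rw [hv', hγ₂]⟩
    rw [← ha₂.1 0 (by omega)] at ht'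
    nlinarith

/-- Bounded recursion costs only a factor N, because the time bound of the body depends on N alone
and not on the size of the value being iterated. Intermediate values may therefore be exponentially
large. -/
theorem Comp.iter {g : α → ℕ} {f : α → ℕ → ℕ → ℕ} (hg : Comp g)
    (hf : Comp (fun p : (α × ℕ) × ℕ => f p.1.1 p.1.2 p.2)) :
    Comp (fun a => iter (Ctx.inst a).N (g a) (f a)) := by
  intro m γ hγ
  have h4 := Ctx.four_le hγ
  obtain ⟨P, c, e, hP⟩ := hg (m + 1) γ (Ctx.mono (by omega) hγ)
  obtain ⟨Q, c', e', hQ⟩ := hf (m + 4) (fun s => ((γ s, s.reg m), s.reg (m + 1)))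
    ⟨_, m + 1, ⟨γ, m, Ctx.mono (by omega) hγ, by omega, rfl⟩, by omega, rfl⟩
  refine ⟨.seq P (.seq (.const m 0) (.seq (.const (m + 2) 0) (.seq (.add (m + 2) 0 (m + 2))
    (.seq (.const (m + 3) 1) (.seq (.loop (m + 2) (iterBody m Q))
      (.seq (.const (m + 2) 0) (.add m (m + 1) (m + 2)))))))), c + c' + 12, e + e' + 1,
        fun s => ?_⟩
  obtain ⟨t, s₁, h₁, ht, ha, hv⟩ := hP s
  have hd : γ s₁ = γ s := (Ctx.dep hγ (ha.mono (show m ≤ m + 1 by omega))).symm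
  set s₂ : State := (((s₁.setReg m 0).setReg (m + 2) 0).setReg (m + 2) (s₁.reg 0)).setReg
    (m + 3) 1 with hs₂
  have ha₂ : Agree m s s₂ := ((((ha.mono (show m ≤ m + 1 by omega)).setReg _ (by omega)).setReg _
    (by omega)).setReg _ (by omega)).setReg _ (by omega)
  have hγ₂ : γ s₂ = γ s := (Ctx.dep hγ ha₂).symm
  obtain ⟨t', s₃, h₃, ht', ha', hv'⟩ := runs_iterLoop hγ hQ (s.reg 0) (g (γ s)) (s.reg 0) 0 s₂
    (by simp [hs₂]) (by simp [hs₂, hv]) (by simp [hs₂, ← ha.1 0 (by omega)]) (by simp [hs₂])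
    (by simp)
  have hrun := Runs.seq h₁ (.seq (.const s₁ m 0) (.seq (.const _ (m + 2) 0)
    (.seq (.add _ (m + 2) 0 (m + 2)) (.seq (.const _ (m + 3) 1) (.seq (s' := s₃) (s'' := _)
      (t := t') (P := .loop (m + 2) (iterBody m Q)) ?_ (.seq (.const s₃ (m + 2) 0)
        (.add _ m (m + 1) (m + 2))))))))
  refine ⟨_, _, hrun, ?_, ?_, ?_⟩
  · rw [← ha₂.1 0 (by omega)] at ht'
    have h1 := ht.trans (poly_le_poly le_rfl (show e ≤ e + e' + 1 by omega))
    have h2 : c' * (s.reg 0 + 1) ^ e' ≤ c' * (s.reg 0 + 1) ^ (e + e') :=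
      poly_le_poly le_rfl (by omega)
    have h3 : 0 < (s.reg 0 + 1) ^ (e + e') := by positivity
    rw [pow_succ] at h1 ⊢
    nlinarith [Nat.zero_le (s.reg 0), mul_le_mul_right h2 (s.reg 0),
      mul_pos h3 (Nat.succ_pos (s.reg 0)), mul_le_mul_left h2 (s.reg 0)]
  · exact ((ha₂.trans ha').setReg _ (by omega)).setReg _ le_rfl
  · simp [hv', hγ₂, Ctx.inst_eq s hγ, State.inst]
  · convert h₃ using 1
    rw [hs₂]
    simp [show (0 : ℕ) ≠ m by omega]

end rules


/-! ### Derived rules: predicates, bounded quantifiers, sets of numbers below `N` -/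

/-- `p` can be decided in polynomial time. -/
def CompP {α : Type} [Ctx α] (p : α → Prop) : Prop :=
  open Classical in Comp (fun a => if p a then 1 else 0)

open Classical in
/-- The number of `i < N` with `p i`. -/
noncomputable def cnt (N : ℕ) (p : ℕ → Prop) : ℕ := ((Finset.range N).filter p).card

/-- The power `2 ^ i`, for `i ≤ N`, computed with additions only. -/
def two (N i : ℕ) : ℕ := iter N 1 fun j a => if j < i then a + a else a

open Classical in
/-- The code of the set of all `i < N` with `p i`: the number with these binary digits. -/
noncomputable def mask (N : ℕ) (p : ℕ → Prop) : ℕ :=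
  iter N 0 fun i a => if p i then a + two N i else a

open Classical in
/-- The number `i < N` belongs to the set coded by `a < 2 ^ N`; this is tested by clearing the
higher digits of `a` one after another. -/
def tb (N a i : ℕ) : Prop :=
  i < N ∧ two N i ≤ iter N a fun t b =>
    if i < N - 1 - t ∧ two N (N - 1 - t) ≤ b then b - two N (N - 1 - t) else b

theorem cnt_succ (N : ℕ) (p : ℕ → Prop) [Decidable (p N)] :
    cnt (N + 1) p = if p N then cnt N p + 1 else cnt N p := by
  classical
  unfold cnt
  rw [Finset.range_add_one, Finset.filter_insert]
  split_ifs with h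
  · rw [Finset.card_insert_of_notMem (by simp)]
  · rfl

theorem iter_two : ∀ n i : ℕ, (iter n 1 fun j a => if j < i then a + a else a) =
    2 ^ min n i := by
  intro n i
  induction n with
  | zero => simp
  | succ n ih =>
    rw [iter_succ, ih]
    split_ifs with h
    · rw [min_eq_left h.le, min_eq_left h, pow_succ]; omega
    · rw [min_eq_right (by omega), min_eq_right (by omega)]

theorem two_eq {N i : ℕ} (h : i ≤ N) : two N i = 2 ^ i := by
  rw [two, iter_two, min_eq_right h]

theorem testBit_add_two_pow {a n : ℕ} (ha : a < 2 ^ n) (i : ℕ) :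
    (a + 2 ^ n).testBit i = (decide (i = n) || a.testBit i) := by
  rw [add_comm]
  rcases lt_trichotomy i n with h | rfl | h
  · rw [Nat.testBit_two_pow_add_gt h]; simp [h.ne]
  · rw [Nat.testBit_two_pow_add_eq, Nat.testBit_lt_two_pow ha]; simp
  · rw [Nat.testBit_lt_two_pow (x := 2 ^ n + a) (i := i), Nat.testBit_lt_two_pow (x := a)]
    · simp [h.ne']
    · exact ha.trans (Nat.pow_lt_pow_right (by norm_num) h)
    · calc 2 ^ n + a < 2 ^ (n + 1) := by rw [pow_succ]; omega
        _ ≤ 2 ^ i := Nat.pow_le_pow_right (by norm_num) h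

theorem iter_mask {N : ℕ} (p : ℕ → Prop) [DecidablePred p] (n : ℕ) (hn : n ≤ N) :
    (iter n 0 fun i a => if p i then a + two N i else a) < 2 ^ n ∧
      ∀ i, (iter n 0 fun i a => if p i then a + two N i else a).testBit i = true ↔ i < n ∧ p i := by
  induction n with
  | zero => simp
  | succ n ih =>
    obtain ⟨h₁, h₂⟩ := ih (by omega)
    rw [iter_succ]
    split_ifs with h
    · rw [two_eq (by omega)]
      refine ⟨by rw [pow_succ]; omega, fun i => ?_⟩
      rw [testBit_add_two_pow h₁, Bool.or_eq_true, h₂]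
      constructor
      · rintro (h' | h')
        · simp only [decide_eq_true_eq] at h'; exact ⟨by omega, h' ▸ h⟩
        · exact ⟨by omega, h'.2⟩
      · rintro ⟨hi, hp⟩
        by_cases h' : i = n
        · simp [h']
        · exact Or.inr ⟨by omega, hp⟩
    · refine ⟨h₁.trans (Nat.pow_lt_pow_right (by norm_num) (by omega)), fun i => ?_⟩
      rw [h₂]
      refine ⟨fun h' => ⟨by omega, h'.2⟩, fun h' => ⟨?_, h'.2⟩⟩
      rcases Nat.lt_succ_iff_lt_or_eq.mp h'.1 with h'' | rfl
      · exact h''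
      · exact absurd h'.2 h

theorem mask_lt (N : ℕ) (p : ℕ → Prop) : mask N p < 2 ^ N := by
  classical
  exact (iter_mask p N le_rfl).1

/-- Round `t` removes the binary digit at position N - 1 - t, as long as this position is above `i`.
After `n` rounds the positions below max (N - n) (i + 1) are left. -/
theorem iter_clear {N a i : ℕ} (ha : a < 2 ^ N) (hi : i < N) (n : ℕ) (hn : n ≤ N) :
    (iter n a fun t b => if i < N - 1 - t ∧ two N (N - 1 - t) ≤ b then b - two N (N - 1 - t)
      else b) = a % 2 ^ (max (N - n) (i + 1)) := by
  induction n with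
  | zero => simp [Nat.max_eq_left (Nat.succ_le_of_lt hi), Nat.mod_eq_of_lt ha]
  | succ n ih =>
    rw [iter_succ, ih (by omega), two_eq (by omega)]
    by_cases h : i < N - 1 - n
    · have h₁ : max (N - n) (i + 1) = (N - 1 - n) + 1 := by omega
      have h₂ : max (N - (n + 1)) (i + 1) = N - 1 - n := by omega
      rw [h₁, h₂]
      have h₃ : a % 2 ^ (N - 1 - n) = a % 2 ^ (N - 1 - n + 1) % 2 ^ (N - 1 - n) :=
        (Nat.mod_mod_of_dvd _ (pow_dvd_pow 2 (by omega))).symm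
      have h₄ : a % 2 ^ (N - 1 - n + 1) < 2 ^ (N - 1 - n + 1) := Nat.mod_lt _ (by positivity)
      rw [h₃]
      rw [pow_succ] at h₄ ⊢
      generalize a % (2 ^ (N - 1 - n) * 2) = b at h₄ ⊢
      split_ifs with h₅
      · rw [Nat.mod_eq_sub_mod h₅.2, Nat.mod_eq_of_lt (by omega)]
      · rw [Nat.mod_eq_of_lt (by omega)]
    · rw [if_neg (by tauto), show max (N - (n + 1)) (i + 1) = max (N - n) (i + 1) by omega]

/-- Clearing the higher digits leaves a mod 2^(i+1), which is at least 2^i exactly if digit `i` is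
1. -/
theorem tb_iff {N a i : ℕ} (ha : a < 2 ^ N) : tb N a i ↔ i < N ∧ a.testBit i = true := by
  unfold tb
  refine and_congr_right fun hi => ?_
  have := iter_clear ha hi N le_rfl
  rw [two_eq hi.le]
  rw [show max (N - N) (i + 1) = i + 1 by omega] at this
  rw [this]
  have h₂ : a % 2 ^ (i + 1) < 2 ^ (i + 1) := Nat.mod_lt _ (by positivity)
  have h₃ : (a % 2 ^ (i + 1)).testBit i = a.testBit i := by simp [Nat.testBit_mod_two_pow]
  rw [← h₃]
  constructor
  · intro h
    rw [Nat.testBit_eq_decide_div_mod_eq, decide_eq_true_eq,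
      Nat.div_eq_of_lt_le (k := 1) (by omega) (by rw [pow_succ] at h₂; omega)]
  · exact Nat.ge_two_pow_of_testBit

@[simp] theorem tb_mask (N : ℕ) (p : ℕ → Prop) (i : ℕ) : tb N (mask N p) i ↔ i < N ∧ p i := by
  classical
  rw [tb_iff (mask_lt N p)]
  have := (iter_mask p N le_rfl).2 i
  unfold mask
  constructor
  · intro h; exact this.1 (by convert h.2)
  · intro h; exact ⟨h.1, by convert this.2 h⟩

/-! ### Closure rules for predicates, quantifiers, counting and coded sets -/

section rules

variable {α : Type} [Ctx α] {f g h : α → ℕ} {p q : α → Prop}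

theorem Comp.congr (hf : Comp f) (hfg : ∀ a, f a = g a) : Comp g := (funext hfg : f = g) ▸ hf

theorem CompP.congr (hp : CompP p) (hpq : ∀ a, p a ↔ q a) : CompP q :=
  (funext fun a => propext (hpq a) : p = q) ▸ hp

theorem Comp.ite [DecidablePred p] (hp : CompP p) (hf : Comp f) (hg : Comp g) :
    Comp (fun a => if p a then f a else g a) :=
  (Comp.cond hp hf hg).congr fun a => by by_cases h : p a <;> simp [h]

theorem CompP.fst (hp : CompP p) : CompP (fun a : α × ℕ => p a.1) := Comp.fst hp

theorem CompP.not (hp : CompP p) : CompP (fun a => ¬ p a) :=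
  (Comp.cond hp (.const 0) (.const 1)).congr fun a => by by_cases h : p a <;> simp [h]

theorem CompP.and (hp : CompP p) (hq : CompP q) : CompP (fun a => p a ∧ q a) :=
  (Comp.cond hp hq (.const 0)).congr fun a => by
    by_cases h : p a <;> by_cases h' : q a <;> simp [h, h']

theorem CompP.or (hp : CompP p) (hq : CompP q) : CompP (fun a => p a ∨ q a) :=
  (hp.not.and hq.not).not.congr fun a => by tauto

theorem CompP.imp (hp : CompP p) (hq : CompP q) : CompP (fun a => p a → q a) :=
  (hp.not.or hq).congr fun a => by tauto

theorem CompP.iff (hp : CompP p) (hq : CompP q) : CompP (fun a => p a ↔ q a) :=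
  ((hp.imp hq).and (hq.imp hp)).congr fun a => by tauto

theorem CompP.false : CompP (fun _ : α => False) :=
  (Comp.const 0).congr fun a => by simp

theorem Comp.le (hf : Comp f) (hg : Comp g) : CompP (fun a => f a ≤ g a) :=
  (Comp.cond (hf.sub hg) (.const 0) (.const 1)).congr fun a => by
    by_cases h : f a ≤ g a <;> simp [h, Nat.sub_eq_zero_iff_le]

theorem Comp.lt (hf : Comp f) (hg : Comp g) : CompP (fun a => f a < g a) :=
  (hg.le hf).not.congr fun a => by simp

theorem Comp.eq (hf : Comp f) (hg : Comp g) : CompP (fun a => f a = g a) :=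
  ((hf.le hg).and (hg.le hf)).congr fun a => by omega

theorem CompP.ex {p : α → ℕ → Prop} (hp : CompP (fun b : α × ℕ => p b.1 b.2)) :
    CompP (fun a => ∃ i < (Ctx.inst a).N, p a i) := by
  classical
  refine Comp.congr (Comp.iter (f := fun a i b => if p a i then 1 else b) (.const 0)
    (.ite hp.fst (.const 1) .snd)) fun a => ?_
  have : ∀ n, iter n 0 (fun i b => if p a i then 1 else b) = if ∃ i < n, p a i then 1 else 0 := by
    intro n
    induction n with
    | zero => simp
    | succ n ih =>
      rw [iter_succ, ih]
      simp only [Nat.lt_succ_iff_lt_or_eq, or_and_right, exists_or, exists_eq_left]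
      by_cases h : p a n <;> simp [h]
  rw [this]
  congr

theorem CompP.all {p : α → ℕ → Prop} (hp : CompP (fun b : α × ℕ => p b.1 b.2)) :
    CompP (fun a => ∀ i < (Ctx.inst a).N, p a i) :=
  (CompP.ex (p := fun a i => ¬ p a i) hp.not).not.congr fun a => by simp

/-- A search of fixed length is unrolled into the program instead of being a loop of length N. This
serves for the `d` literal positions of a clause. -/
theorem CompP.exConst {p : ℕ → α → Prop} (hp : ∀ i, CompP (p i)) (D : ℕ) :
    CompP (fun a => ∃ i < D, p i a) := by
  induction D with
  | zero => exact CompP.false.congr fun a => by simp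
  | succ D ih =>
    exact (ih.or (hp D)).congr fun a => by
      simp only [Nat.lt_succ_iff_lt_or_eq, or_and_right, exists_or, exists_eq_left]

theorem Comp.constMul (hf : Comp f) (D : ℕ) : Comp (fun a => D * f a) := by
  induction D with
  | zero => exact (Comp.const 0).congr fun a => by simp
  | succ D ih => exact (ih.add hf).congr fun a => by ring

theorem Comp.cnt {p : α → ℕ → Prop} (hp : CompP (fun b : α × ℕ => p b.1 b.2)) :
    Comp (fun a => cnt (Ctx.inst a).N (p a)) := by
  classical
  refine Comp.congr (Comp.iter (f := fun a i b => if p a i then b + 1 else b) (.const 0)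
    (.ite hp.fst (Comp.snd.add (.const 1)) .snd)) fun a => ?_
  generalize (Ctx.inst a).N = n
  induction n with
  | zero => simp [MiniSat.cnt]
  | succ n ih => rw [iter_succ, ih, cnt_succ]

theorem Comp.two (hf : Comp f) : Comp (fun a => two (Ctx.inst a).N (f a)) :=
  Comp.iter (f := fun a j b => if j < f a then b + b else b) (.const 1)
    (.ite (Comp.snd.fst.lt hf.fst.fst) (Comp.snd.add .snd) .snd)

theorem Comp.mask {p : α → ℕ → Prop} (hp : CompP (fun b : α × ℕ => p b.1 b.2)) :
    Comp (fun a => mask (Ctx.inst a).N (p a)) := by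
  classical
  exact (Comp.iter (f := fun a i b => if p a i then b + MiniSat.two (Ctx.inst a).N i else b)
    (.const 0) (.ite hp.fst (Comp.snd.add (Comp.two (α := (α × ℕ) × ℕ) (f := fun b => b.1.2)
      Comp.snd.fst)) .snd)).congr fun a => by unfold MiniSat.mask; congr

theorem Comp.tb (hf : Comp f) (hg : Comp g) :
    CompP (fun a => tb (Ctx.inst a).N (f a) (g a)) := by
  classical
  have hi : Comp (fun b : (α × ℕ) × ℕ => (Ctx.inst b).N - 1 - b.1.2) :=
    (Comp.N.sub (.const 1)).sub Comp.snd.fst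
  have := Comp.iter (f := fun a t b => if g a < (Ctx.inst a).N - 1 - t ∧
    MiniSat.two (Ctx.inst a).N ((Ctx.inst a).N - 1 - t) ≤ b then
      b - MiniSat.two (Ctx.inst a).N ((Ctx.inst a).N - 1 - t) else b) hf
    (.ite ((hg.fst.fst.lt hi).and ((Comp.two hi).le .snd)) (Comp.snd.sub (Comp.two hi)) .snd)
  exact ((hg.lt .N).and ((Comp.two hg).le this)).congr fun a => by unfold MiniSat.tb; congr!

end rules


/-! ### The algorithm, as functions of the parameters

The literals of clause number `j` are stored in the memory cells `d j`, …, `d j + d - 1`. All loops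
run over the numbers below `N`, and sets are coded by numbers (`mask`, `tb`). -/

section algorithm

variable (d : ℕ) (I : Inst)

/-- Clause `j` contains the literal with variable `x` and sign `σ`. -/
def occ (j x σ : ℕ) : Prop := ∃ i < d, I.μ (d * j + i) = x + x + σ

/-- Clause `j` contains the variable `x`. -/
def has (j x : ℕ) : Prop := occ d I j x 0 ∨ occ d I j x 1

/-- Clause `j` is `¬x ∨ ⋁_{y ∈ Y} y` for some set `Y` of variables other than `x`. -/
def freezes (x j : ℕ) : Prop :=
  j < I.M ∧ occ d I j x 0 ∧ ¬ occ d I j x 1 ∧ ∀ y < I.N, y ≠ x → ¬ occ d I j y 0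

/-- The clauses `j` and `j'` have a positive literal in common. -/
def clash (j j' : ℕ) : Prop := ∃ y < I.N, occ d I j y 1 ∧ occ d I j' y 1

open Classical in
/-- A set of freezing clauses of `x`, chosen greedily such that no two of them clash. -/
noncomputable def greedy (x : ℕ) : ℕ :=
  iter I.N (mask I.N fun _ => False) fun j S =>
    if freezes d I x j ∧ ∀ j' < I.N, tb I.N S j' → ¬ clash d I j' j then
      mask I.N fun i => tb I.N S i ∨ i = j
    else S

/-- The power `n ^ min k (n + 1)`. -/
def instPow : ℕ :=
  iter I.N 1 fun i a => if i < I.k ∧ i < I.n + 1 then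
    iter I.N 0 fun l b => if l < I.n then b + a else b else a

/-- The weight `⌊k log₂ n⌋`, if this is at most `n`; otherwise some number larger than `n`. -/
noncomputable def target : ℕ := cnt I.N fun j => two I.N (j + 1) ≤ instPow I

/-- The set of the variables found to be frozen. -/
noncomputable def frozenSet : ℕ :=
  mask I.N fun x => x < I.n ∧ target I ≤ I.n ∧ target I ≤ cnt I.N fun j => tb I.N (greedy d I x) j

/-- Clause `j` shrinks to the literal `¬x` if the variables in `A` are set to FALSE. -/
def isUnit (A j x : ℕ) : Prop :=
  occ d I j x 0 ∧ ∀ y < I.N, (occ d I j y 1 → tb I.N A y) ∧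
    (occ d I j y 0 → y = x)

/-- The set of the variables that are FALSE after unit propagation. -/
noncomputable def forcedSet : ℕ :=
  iter I.N (frozenSet d I) fun _ A =>
    mask I.N fun x => tb I.N A x ∨ (x < I.n ∧ ∃ j < I.N, j < I.M ∧ isUnit d I A j x)

/-- The variable `x` is not forced to be FALSE. -/
def free (x : ℕ) : Prop := x < I.n ∧ ¬ tb I.N (forcedSet d I) x

/-- Clause `j` is not satisfied by the forced variables. -/
def alive (j : ℕ) : Prop :=
  j < I.M ∧ ∀ y < I.N, occ d I j y 0 → ¬ tb I.N (forcedSet d I) y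

/-- Adjacency in the residual graph, reflexive on the variables that occur in it. -/
def linked (x y : ℕ) : Prop :=
  free d I x ∧ free d I y ∧ ∃ j < I.N, alive d I j ∧ has d I j x ∧ has d I j y

/-- The connected component of `x` in the residual graph. -/
noncomputable def compSet (x : ℕ) : ℕ :=
  iter I.N (mask I.N fun y => y = x) fun _ A =>
    mask I.N fun y => tb I.N A y ∨ ∃ z < I.N, tb I.N A z ∧ linked d I z y

/-- The variables `x` and `y` belong to the same connected component. -/
def conn (x y : ℕ) : Prop := tb I.N (compSet d I x) y

/-- Some component of the residual formula has more than `log₂ n` variables. -/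
def tooLarge : Prop :=
  ∃ x < I.N, (free d I x ∧ ∃ j < I.N, alive d I j ∧ has d I j x) ∧
    I.n < two I.N (cnt I.N (conn d I x))

/-- The number of the variables smaller than `y` in the component of `x`. -/
noncomputable def rank (x y : ℕ) : ℕ := cnt I.N fun z => z < y ∧ conn d I x z

/-- The assignment number `b` of the component of `x` makes `y` TRUE. -/
def loc (x b y : ℕ) : Prop := conn d I x y ∧ tb I.N b (rank d I x y)

/-- The assignment number `b` of the component of `x` satisfies all clauses there, and agrees with
the assignment `A` on the variables below `t`. -/
def okLoc (A t x b : ℕ) : Prop :=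
  (∀ y < I.N, conn d I x y → (tb I.N (forcedSet d I) y → ¬ loc d I x b y) ∧
    (y < t → (loc d I x b y ↔ tb I.N A y))) ∧
  ∀ j < I.N, alive d I j → (∃ y < I.N, conn d I x y ∧ free d I y ∧ has d I j y) →
    ∃ y < I.N, conn d I x y ∧ free d I y ∧
      ((loc d I x b y ∧ occ d I j y 1) ∨ (¬ loc d I x b y ∧ occ d I j y 0))

/-- The variable `x` is the smallest one in its component. -/
def rep (x : ℕ) : Prop := x < I.n ∧ ∀ y < I.N, y < x → ¬ conn d I x y

open Classical in
/-- The set of the weights of good assignments that agree with `A` below `t`. -/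
noncomputable def sums (A t : ℕ) : ℕ :=
  iter I.N (mask I.N fun w => w = 0) fun x S =>
    if rep d I x then
      mask I.N fun w => ∃ b < I.N, okLoc d I A t x b ∧ cnt I.N (loc d I x b) ≤ w ∧
        tb I.N S (w - cnt I.N (loc d I x b))
    else S

/-- There is a satisfying assignment of the required weight that agrees with `A` below `t`. -/
def extendable (A t : ℕ) : Prop :=
  tb I.N (sums d I A t) (target I) ∧
    ∀ j < I.N, alive d I j → ∃ y < I.N, free d I y ∧ has d I j y

open Classical in
/-- The assignment constructed variable by variable. -/
noncomputable def build : ℕ :=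
  iter I.N (mask I.N fun _ => False) fun t A =>
    if t < I.n ∧ extendable d I (mask I.N fun i => tb I.N A i ∨ i = t) (t + 1) then
      mask I.N fun i => tb I.N A i ∨ i = t
    else A

open Classical in
/-- The result: `0` for FAILURE, `1` for UNSAT, and `2 + a` for the assignment with code `a`. -/
noncomputable def result : ℕ :=
  if tooLarge d I then 0
  else if extendable d I (mask I.N fun _ => False) 0 then build d I + 2 else 1

end algorithm

/-! ### Polynomial-time computability of the functions that make up the algorithm -/

section rules

variable {α : Type} [Ctx α] {d : ℕ} {f g h l : α → ℕ}

theorem CompP.occ (hf : Comp f) (hg : Comp g) (hh : Comp h) :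
    CompP (fun a => occ d (Ctx.inst a) (f a) (g a) (h a)) :=
  CompP.exConst (fun i => (((hf.constMul d).add (.const i)).mem).eq ((hg.add hg).add hh)) d

theorem CompP.has (hf : Comp f) (hg : Comp g) : CompP (fun a => has d (Ctx.inst a) (f a) (g a)) :=
  (CompP.occ hf hg (.const 0)).or (CompP.occ hf hg (.const 1))

theorem CompP.freezes (hf : Comp f) (hg : Comp g) :
    CompP (fun a => freezes d (Ctx.inst a) (f a) (g a)) :=
  (hg.lt .M).and ((CompP.occ hg hf (.const 0)).and ((CompP.occ hg hf (.const 1)).not.and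
    (CompP.all (p := fun a y => y ≠ f a → ¬ MiniSat.occ d (Ctx.inst a) (g a) y 0)
      ((Comp.snd.eq hf.fst).not.imp (CompP.occ hg.fst .snd (.const 0)).not))))

theorem CompP.clash (hf : Comp f) (hg : Comp g) :
    CompP (fun a => clash d (Ctx.inst a) (f a) (g a)) :=
  CompP.ex (p := fun a y => MiniSat.occ d (Ctx.inst a) (f a) y 1 ∧
      MiniSat.occ d (Ctx.inst a) (g a) y 1)
    ((CompP.occ hf.fst .snd (.const 1)).and (CompP.occ hg.fst .snd (.const 1)))

theorem Comp.insert (hf : Comp f) (hg : Comp g) :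
    Comp (fun a => MiniSat.mask (Ctx.inst a).N fun i => MiniSat.tb (Ctx.inst a).N (f a) i ∨ i = g a) :=
  Comp.mask (p := fun a i => MiniSat.tb (Ctx.inst a).N (f a) i ∨ i = g a)
    ((Comp.tb hf.fst .snd).or (Comp.snd.eq hg.fst))

theorem Comp.empty : Comp (fun a : α => MiniSat.mask (Ctx.inst a).N fun _ => False) :=
  Comp.mask (p := fun _ _ => False) CompP.false

theorem Comp.greedy (hf : Comp f) : Comp (fun a => greedy d (Ctx.inst a) (f a)) := by
  classical
  refine Comp.iter (f := fun a j S =>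
    if MiniSat.freezes d (Ctx.inst a) (f a) j ∧ ∀ j' < (Ctx.inst a).N,
        MiniSat.tb (Ctx.inst a).N S j' → ¬ MiniSat.clash d (Ctx.inst a) j' j then
      MiniSat.mask (Ctx.inst a).N fun i => MiniSat.tb (Ctx.inst a).N S i ∨ i = j
    else S) .empty (.ite ?_ (.insert .snd Comp.snd.fst) .snd)
  exact (CompP.freezes hf.fst.fst Comp.snd.fst).and
    (CompP.all (α := (α × ℕ) × ℕ) (p := fun a j' => MiniSat.tb (Ctx.inst a).N a.2 j' →
      ¬ MiniSat.clash d (Ctx.inst a) j' a.1.2)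
      ((Comp.tb Comp.snd.fst .snd).imp (CompP.clash .snd Comp.snd.fst.fst).not))

theorem Comp.instPow : Comp (fun a : α => instPow (Ctx.inst a)) :=
  Comp.iter (f := fun a i b => if i < (Ctx.inst a).k ∧ i < (Ctx.inst a).n + 1 then
    MiniSat.iter (Ctx.inst a).N 0 fun l c => if l < (Ctx.inst a).n then c + b else c else b)
    (.const 1) (.ite ((Comp.snd.fst.lt .k).and (Comp.snd.fst.lt (Comp.n.add (.const 1))))
      (Comp.iter (α := (α × ℕ) × ℕ)
        (f := fun a l c => if l < (Ctx.inst a).n then c + a.2 else c) (.const 0)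
        (.ite (Comp.snd.fst.lt .n) (Comp.snd.add Comp.snd.fst.fst) .snd)) .snd)

theorem Comp.target : Comp (fun a : α => target (Ctx.inst a)) :=
  Comp.cnt (p := fun a j => MiniSat.two (Ctx.inst a).N (j + 1) ≤ MiniSat.instPow (Ctx.inst a))
    ((Comp.two (α := α × ℕ) (Comp.snd.add (.const 1))).le (Comp.instPow (α := α × ℕ)))

theorem Comp.frozenSet : Comp (fun a : α => frozenSet d (Ctx.inst a)) :=
  Comp.mask (p := fun a x => x < (Ctx.inst a).n ∧ MiniSat.target (Ctx.inst a) ≤ (Ctx.inst a).n ∧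
      MiniSat.target (Ctx.inst a) ≤
        MiniSat.cnt (Ctx.inst a).N fun j => MiniSat.tb (Ctx.inst a).N (MiniSat.greedy d (Ctx.inst a) x) j)
    ((Comp.snd.lt .n).and ((Comp.target.le .n).and (Comp.target.le
      (Comp.cnt (α := α × ℕ) (p := fun a j =>
        MiniSat.tb (Ctx.inst a).N (MiniSat.greedy d (Ctx.inst a) a.2) j)
        (Comp.tb (Comp.greedy (α := (α × ℕ) × ℕ) Comp.snd.fst) .snd)))))

theorem CompP.isUnit (hf : Comp f) (hg : Comp g) (hh : Comp h) :
    CompP (fun a => isUnit d (Ctx.inst a) (f a) (g a) (h a)) :=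
  (CompP.occ hg hh (.const 0)).and
    (CompP.all (p := fun a y => (MiniSat.occ d (Ctx.inst a) (g a) y 1 →
        MiniSat.tb (Ctx.inst a).N (f a) y) ∧
      (MiniSat.occ d (Ctx.inst a) (g a) y 0 → y = h a))
      (((CompP.occ hg.fst .snd (.const 1)).imp (Comp.tb hf.fst .snd)).and
        ((CompP.occ hg.fst .snd (.const 0)).imp (Comp.snd.eq hh.fst))))

theorem Comp.forcedSet : Comp (fun a : α => forcedSet d (Ctx.inst a)) :=
  Comp.iter (f := fun a _ A => MiniSat.mask (Ctx.inst a).N fun x => MiniSat.tb (Ctx.inst a).N A x ∨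
      (x < (Ctx.inst a).n ∧ ∃ j < (Ctx.inst a).N, j < (Ctx.inst a).M ∧
        MiniSat.isUnit d (Ctx.inst a) A j x)) .frozenSet
    (Comp.mask (α := (α × ℕ) × ℕ) (p := fun a x => MiniSat.tb (Ctx.inst a).N a.2 x ∨
      (x < (Ctx.inst a).n ∧ ∃ j < (Ctx.inst a).N, j < (Ctx.inst a).M ∧
        MiniSat.isUnit d (Ctx.inst a) a.2 j x))
      ((Comp.tb Comp.snd.fst .snd).or ((Comp.snd.lt .n).and
        (CompP.ex (α := ((α × ℕ) × ℕ) × ℕ) (p := fun a j => j < (Ctx.inst a).M ∧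
          MiniSat.isUnit d (Ctx.inst a) a.1.2 j a.2)
          ((Comp.snd.lt .M).and (CompP.isUnit Comp.snd.fst.fst .snd Comp.snd.fst))))))

theorem CompP.free (hf : Comp f) : CompP (fun a => free d (Ctx.inst a) (f a)) :=
  (hf.lt .n).and (Comp.tb .forcedSet hf).not

theorem CompP.alive (hf : Comp f) : CompP (fun a => alive d (Ctx.inst a) (f a)) :=
  (hf.lt .M).and (CompP.all (p := fun a y => MiniSat.occ d (Ctx.inst a) (f a) y 0 →
      ¬ MiniSat.tb (Ctx.inst a).N (MiniSat.forcedSet d (Ctx.inst a)) y)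
    ((CompP.occ hf.fst .snd (.const 0)).imp (Comp.tb (α := α × ℕ) .forcedSet .snd).not))

theorem CompP.linked (hf : Comp f) (hg : Comp g) :
    CompP (fun a => linked d (Ctx.inst a) (f a) (g a)) :=
  (CompP.free hf).and ((CompP.free hg).and
    (CompP.ex (p := fun a j => MiniSat.alive d (Ctx.inst a) j ∧
        MiniSat.has d (Ctx.inst a) j (f a) ∧ MiniSat.has d (Ctx.inst a) j (g a))
      ((CompP.alive (α := α × ℕ) .snd).and ((CompP.has .snd hf.fst).and (CompP.has .snd hg.fst)))))

theorem Comp.compSet (hf : Comp f) : Comp (fun a => compSet d (Ctx.inst a) (f a)) :=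
  Comp.iter (f := fun a _ A => MiniSat.mask (Ctx.inst a).N fun y => MiniSat.tb (Ctx.inst a).N A y ∨
      ∃ z < (Ctx.inst a).N, MiniSat.tb (Ctx.inst a).N A z ∧ MiniSat.linked d (Ctx.inst a) z y)
    (Comp.mask (p := fun a y => y = f a) (Comp.snd.eq hf.fst))
    (Comp.mask (α := (α × ℕ) × ℕ) (p := fun a y => MiniSat.tb (Ctx.inst a).N a.2 y ∨
      ∃ z < (Ctx.inst a).N, MiniSat.tb (Ctx.inst a).N a.2 z ∧ MiniSat.linked d (Ctx.inst a) z y)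
      ((Comp.tb Comp.snd.fst .snd).or (CompP.ex (α := ((α × ℕ) × ℕ) × ℕ)
        (p := fun a z => MiniSat.tb (Ctx.inst a).N a.1.2 z ∧ MiniSat.linked d (Ctx.inst a) z a.2)
        ((Comp.tb Comp.snd.fst.fst .snd).and (CompP.linked .snd Comp.snd.fst)))))

theorem CompP.conn (hf : Comp f) (hg : Comp g) : CompP (fun a => conn d (Ctx.inst a) (f a) (g a)) :=
  Comp.tb (.compSet hf) hg

theorem CompP.tooLarge : CompP (fun a : α => tooLarge d (Ctx.inst a)) :=
  CompP.ex (p := fun a x => (MiniSat.free d (Ctx.inst a) x ∧ ∃ j < (Ctx.inst a).N,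
      MiniSat.alive d (Ctx.inst a) j ∧ MiniSat.has d (Ctx.inst a) j x) ∧
      (Ctx.inst a).n < MiniSat.two (Ctx.inst a).N
        (MiniSat.cnt (Ctx.inst a).N (MiniSat.conn d (Ctx.inst a) x)))
    (((CompP.free .snd).and (CompP.ex (α := α × ℕ)
      (p := fun a j => MiniSat.alive d (Ctx.inst a) j ∧ MiniSat.has d (Ctx.inst a) j a.2)
      ((CompP.alive .snd).and (CompP.has .snd Comp.snd.fst)))).and
      (Comp.n.lt (Comp.two (α := α × ℕ) (Comp.cnt (α := α × ℕ)
        (p := fun a y => MiniSat.conn d (Ctx.inst a) a.2 y) (CompP.conn Comp.snd.fst .snd)))))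

theorem CompP.loc (hf : Comp f) (hg : Comp g) (hh : Comp h) :
    CompP (fun a => loc d (Ctx.inst a) (f a) (g a) (h a)) :=
  (CompP.conn hf hh).and (Comp.tb hg (Comp.cnt
    (p := fun a z => z < h a ∧ MiniSat.conn d (Ctx.inst a) (f a) z)
    ((Comp.snd.lt hh.fst).and (CompP.conn hf.fst .snd))))

theorem CompP.okLoc (hf : Comp f) (hg : Comp g) (hh : Comp h) (hl : Comp l) :
    CompP (fun a => okLoc d (Ctx.inst a) (f a) (g a) (h a) (l a)) :=
  (CompP.all (p := fun a y => MiniSat.conn d (Ctx.inst a) (h a) y →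
    (MiniSat.tb (Ctx.inst a).N (MiniSat.forcedSet d (Ctx.inst a)) y →
      ¬ MiniSat.loc d (Ctx.inst a) (h a) (l a) y) ∧
    (y < g a → (MiniSat.loc d (Ctx.inst a) (h a) (l a) y ↔ MiniSat.tb (Ctx.inst a).N (f a) y)))
    ((CompP.conn hh.fst .snd).imp (((Comp.tb (α := α × ℕ) .forcedSet .snd).imp
      (CompP.loc hh.fst hl.fst .snd).not).and ((Comp.snd.lt hg.fst).imp
        ((CompP.loc hh.fst hl.fst .snd).iff (Comp.tb hf.fst .snd)))))).and
  (CompP.all (p := fun a j => MiniSat.alive d (Ctx.inst a) j → (∃ y < (Ctx.inst a).N,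
      MiniSat.conn d (Ctx.inst a) (h a) y ∧ MiniSat.free d (Ctx.inst a) y ∧
        MiniSat.has d (Ctx.inst a) j y) →
    ∃ y < (Ctx.inst a).N, MiniSat.conn d (Ctx.inst a) (h a) y ∧ MiniSat.free d (Ctx.inst a) y ∧
      ((MiniSat.loc d (Ctx.inst a) (h a) (l a) y ∧ MiniSat.occ d (Ctx.inst a) j y 1) ∨
        (¬ MiniSat.loc d (Ctx.inst a) (h a) (l a) y ∧ MiniSat.occ d (Ctx.inst a) j y 0)))
    ((CompP.alive .snd).imp ((CompP.ex (α := α × ℕ) (p := fun a y =>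
      MiniSat.conn d (Ctx.inst a) (h a.1) y ∧ MiniSat.free d (Ctx.inst a) y ∧
        MiniSat.has d (Ctx.inst a) a.2 y) ((CompP.conn hh.fst.fst .snd).and ((CompP.free .snd).and
          (CompP.has Comp.snd.fst .snd)))).imp
      (CompP.ex (α := α × ℕ) (p := fun a y =>
        MiniSat.conn d (Ctx.inst a) (h a.1) y ∧ MiniSat.free d (Ctx.inst a) y ∧
      ((MiniSat.loc d (Ctx.inst a) (h a.1) (l a.1) y ∧ MiniSat.occ d (Ctx.inst a) a.2 y 1) ∨
        (¬ MiniSat.loc d (Ctx.inst a) (h a.1) (l a.1) y ∧ MiniSat.occ d (Ctx.inst a) a.2 y 0)))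
        ((CompP.conn hh.fst.fst .snd).and ((CompP.free .snd).and
          (((CompP.loc hh.fst.fst hl.fst.fst .snd).and
            (CompP.occ Comp.snd.fst .snd (.const 1))).or
          ((CompP.loc hh.fst.fst hl.fst.fst .snd).not.and
            (CompP.occ Comp.snd.fst .snd (.const 0))))))))))

theorem CompP.rep (hf : Comp f) : CompP (fun a => rep d (Ctx.inst a) (f a)) :=
  (hf.lt .n).and (CompP.all (p := fun a y => y < f a → ¬ MiniSat.conn d (Ctx.inst a) (f a) y)
    ((Comp.snd.lt hf.fst).imp (CompP.conn hf.fst .snd).not))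

theorem Comp.sums (hf : Comp f) (hg : Comp g) :
    Comp (fun a => sums d (Ctx.inst a) (f a) (g a)) := by
  classical
  have hcnt : Comp (fun a : ((((α × ℕ) × ℕ) × ℕ) × ℕ) =>
      MiniSat.cnt (Ctx.inst a).N (MiniSat.loc d (Ctx.inst a) a.1.1.1.2 a.2)) :=
    Comp.cnt (α := ((((α × ℕ) × ℕ) × ℕ) × ℕ))
      (p := fun a y => MiniSat.loc d (Ctx.inst a) a.1.1.1.2 a.2 y)
      (CompP.loc Comp.snd.fst.fst.fst.fst Comp.snd.fst .snd)
  exact Comp.iter (f := fun a x S => if MiniSat.rep d (Ctx.inst a) x then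
      MiniSat.mask (Ctx.inst a).N fun w => ∃ b < (Ctx.inst a).N,
        MiniSat.okLoc d (Ctx.inst a) (f a) (g a) x b ∧
        MiniSat.cnt (Ctx.inst a).N (MiniSat.loc d (Ctx.inst a) x b) ≤ w ∧
        MiniSat.tb (Ctx.inst a).N S (w - MiniSat.cnt (Ctx.inst a).N (MiniSat.loc d (Ctx.inst a) x b))
    else S) (Comp.mask (p := fun _ w => w = 0) (Comp.snd.eq (.const 0)))
    (.ite (CompP.rep Comp.snd.fst) (Comp.mask (α := (α × ℕ) × ℕ)
      (p := fun a w => ∃ b < (Ctx.inst a).N,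
        MiniSat.okLoc d (Ctx.inst a) (f a.1.1) (g a.1.1) a.1.2 b ∧
        MiniSat.cnt (Ctx.inst a).N (MiniSat.loc d (Ctx.inst a) a.1.2 b) ≤ w ∧
        MiniSat.tb (Ctx.inst a).N a.2
          (w - MiniSat.cnt (Ctx.inst a).N (MiniSat.loc d (Ctx.inst a) a.1.2 b)))
      (CompP.ex (α := ((α × ℕ) × ℕ) × ℕ) (p := fun a b =>
        MiniSat.okLoc d (Ctx.inst a) (f a.1.1.1) (g a.1.1.1) a.1.1.2 b ∧
        MiniSat.cnt (Ctx.inst a).N (MiniSat.loc d (Ctx.inst a) a.1.1.2 b) ≤ a.2 ∧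
        MiniSat.tb (Ctx.inst a).N a.1.2
          (a.2 - MiniSat.cnt (Ctx.inst a).N (MiniSat.loc d (Ctx.inst a) a.1.1.2 b)))
        ((CompP.okLoc hf.fst.fst.fst.fst hg.fst.fst.fst.fst Comp.snd.fst.fst.fst .snd).and
          ((hcnt.le Comp.snd.fst).and
            (Comp.tb (α := ((((α × ℕ) × ℕ) × ℕ) × ℕ)) Comp.snd.fst.fst (Comp.snd.fst.sub hcnt)))))) .snd)

theorem CompP.extendable (hf : Comp f) (hg : Comp g) :
    CompP (fun a => extendable d (Ctx.inst a) (f a) (g a)) :=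
  (Comp.tb (.sums hf hg) .target).and (CompP.all (p := fun a j => MiniSat.alive d (Ctx.inst a) j →
      ∃ y < (Ctx.inst a).N, MiniSat.free d (Ctx.inst a) y ∧ MiniSat.has d (Ctx.inst a) j y)
    ((CompP.alive .snd).imp (CompP.ex (α := α × ℕ)
      (p := fun a y => MiniSat.free d (Ctx.inst a) y ∧ MiniSat.has d (Ctx.inst a) a.2 y)
      ((CompP.free .snd).and (CompP.has Comp.snd.fst .snd)))))

theorem Comp.build : Comp (fun a : α => build d (Ctx.inst a)) := by
  classical
  exact Comp.iter (f := fun a t A =>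
      if t < (Ctx.inst a).n ∧ MiniSat.extendable d (Ctx.inst a) (MiniSat.mask (Ctx.inst a).N fun i =>
        MiniSat.tb (Ctx.inst a).N A i ∨ i = t) (t + 1) then
      MiniSat.mask (Ctx.inst a).N fun i => MiniSat.tb (Ctx.inst a).N A i ∨ i = t else A)
    .empty (.ite ((Comp.snd.fst.lt .n).and (CompP.extendable (α := (α × ℕ) × ℕ)
      (Comp.insert .snd Comp.snd.fst) (Comp.snd.fst.add (.const 1))))
      (.insert .snd Comp.snd.fst) .snd)

theorem Comp.result : Comp (fun a : α => result d (Ctx.inst a)) := by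
  classical
  exact .ite .tooLarge (.const 0) (.ite (.extendable .empty (.const 0)) (Comp.build.add (.const 2))
    (.const 1))

end rules


/-! ### The complete program -/

@[simp] theorem State.setMem_reg (s : State) (a v : ℕ) : (s.setMem a v).reg = s.reg := rfl

@[simp] theorem State.setMem_mem (s : State) (a v i : ℕ) :
    (s.setMem a v).mem i = if i = a then v else s.mem i := by
  simp [State.setMem, Function.update_apply]

/-- The output overwrites the input in memory. This is harmless: by then the answer is coded by the
number `a` in a register, and testing its digits does not depend on the memory. -/
theorem exists_writeLoop : ∃ (P : Program) (c e : ℕ), ∀ (N a r i : ℕ) (s : State),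
    s.reg 0 = N → s.reg 7 = 1 → s.reg 8 = a → s.reg 9 = i → s.reg 10 = r → i + r = N →
    (∀ j < i, s.mem j ≠ 0 ↔ tb N a j) →
    ∃ t s', Runs P s t s' ∧ t ≤ r * (c * (N + 1) ^ e + 4) + 1 ∧
      ∀ j < N, s'.mem j ≠ 0 ↔ tb N a j := by
  classical
  obtain ⟨P, c, e, hP⟩ := Comp.tb (α := (Inst × ℕ) × ℕ) (f := fun p => p.1.2) (g := fun p => p.2)
    Comp.snd.fst .snd 11 (fun s => ((s.inst, s.reg 8), s.reg 9))
    ⟨_, 9, ⟨_, 8, ⟨by omega, rfl⟩, by omega, rfl⟩, by omega, rfl⟩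
  refine ⟨.loop 10 (.seq P (.seq (.store 9 11) (.seq (.add 9 9 7) (.sub 10 10 7)))), c, e, ?_⟩
  intro N a r
  induction r with
  | zero =>
    rintro i s h0 h7 h8 h9 h10 rfl hm
    exact ⟨_, _, .loopDone h10, by simp, hm⟩
  | succ r ih =>
    rintro i s h0 h7 h8 h9 h10 hN hm
    obtain ⟨t, s₁, h₁, ht, ha, hv⟩ := hP s
    have e0 := ha.1 0 (by omega)
    have e7 := ha.1 7 (by omega)
    have e8 := ha.1 8 (by omega)
    have e9 := ha.1 9 (by omega)
    have e10 := ha.1 10 (by omega)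
    obtain ⟨t', s₂, h₂, ht', hm'⟩ := ih (i + 1)
      (((s₁.setMem (s₁.reg 9) (s₁.reg 11)).setReg 9 (s₁.reg 9 + s₁.reg 7)).setReg 10
        (s₁.reg 10 - s₁.reg 7))
      (by simp; omega) (by simp; omega) (by simp; omega) (by simp; omega) (by simp; omega)
      (by omega) (by
        intro j hj
        simp only [State.setReg_mem, State.setMem_mem]
        split_ifs with hji
        · have hji' : j = i := by omega
          rw [hv]
          simp [Ctx.inst, State.inst, h0, h8, h9, hji']
        · rw [← ha.2]; exact hm j (by omega))
    have hstep := Runs.loopStep (by omega : s.reg 10 ≠ 0) (.seq h₁ (.seq (.store _ 9 11)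
      (.seq (.add _ 9 9 7) (.sub _ 10 10 7)))) h₂
    exact ⟨_, _, hstep, by rw [h0] at ht; nlinarith, hm'⟩

/-- The loop bound n + M + 2 covers all variables, all clause numbers and all weights up to n. Being
at least 2, it also covers both local assignments of an isolated variable. -/
theorem exists_program (d : ℕ) : ∃ (P : Program) (c e : ℕ), ∀ s : State, ∀ I : Inst,
    I = ⟨s.mem, s.reg 0 + s.reg 2 + 2, s.reg 1, s.reg 2, s.reg 0⟩ →
    ∃ t s', Runs P s t s' ∧ t ≤ c * (I.N + 1) ^ e ∧ (result d I = 0 → s'.reg 0 = 0) ∧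
      (result d I = 1 → s'.reg 0 = 2) ∧
      ∀ a, result d I = a + 2 → s'.reg 0 = 1 ∧ ∀ i < I.N, s'.mem i ≠ 0 ↔ tb I.N a i := by
  have hres : Comp (fun a : Inst => result d (Ctx.inst a)) := Comp.result
  obtain ⟨P, c, e, hP⟩ := hres 6 State.inst ⟨by omega, rfl⟩
  obtain ⟨W, c', e', hW⟩ := exists_writeLoop
  -- Register 3 receives n and register 0 receives N, while registers 1 and 2 already hold k and M.
  -- The result appears in register 6; a zero test, then subtracting 1 and testing again, separate
  -- FAILURE, UNSAT and an assignment, whose code is left after subtracting another 1.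
  refine ⟨.seq (.const 4 2) (.seq (.const 5 0) (.seq (.add 3 0 5) (.seq (.add 0 0 2)
    (.seq (.add 0 0 4) (.seq P (.cond 6
      (.seq (.const 7 1) (.seq (.sub 8 6 7) (.cond 8
        (.seq (.sub 8 8 7) (.seq (.const 9 0) (.seq (.add 10 0 9) (.seq W (.const 0 1)))))
        (.const 0 2))))
      (.const 0 0))))))), c + c' + 25, e + e' + 1, ?_⟩
  rintro s I rfl
  dsimp only
  set I : Inst := ⟨s.mem, s.reg 0 + s.reg 2 + 2, s.reg 1, s.reg 2, s.reg 0⟩ with hI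
  set N := s.reg 0 + s.reg 2 + 2 with hN
  set s₁ : State := ((((s.setReg 4 2).setReg 5 0).setReg 3 (s.reg 0)).setReg 0
    (s.reg 0 + s.reg 2)).setReg 0 N with hs₁
  obtain ⟨t, s₂, h₂, ht, ha, hv⟩ := hP s₁
  have hinst : s₁.inst = I := by simp [State.inst, hs₁, hI]
  have e0 : s₂.reg 0 = N := by rw [← ha.1 0 (by omega)]; simp [hs₁]
  have e1 : s₁.reg 0 = N := by simp [hs₁]
  rw [hinst] at hv
  change s₂.reg 6 = result d I at hv
  rw [e1] at ht
  have hpos : 0 < (N + 1) ^ (e + e') := by positivity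
  have b1 : c * (N + 1) ^ e ≤ c * (N + 1) ^ (e + e') := poly_le_poly le_rfl (by omega)
  have b2 : c' * (N + 1) ^ e' ≤ c' * (N + 1) ^ (e + e') := poly_le_poly le_rfl (by omega)
  have b3 : N * (c' * (N + 1) ^ e') ≤ N * (c' * (N + 1) ^ (e + e')) := Nat.mul_le_mul_left _ b2
  have b4 : N ≤ N * (N + 1) ^ (e + e') := Nat.le_mul_of_pos_right _ hpos
  have hpre : ∀ {Q : Program} {t' : ℕ} {s₃ : State}, Runs Q s₂ t' s₃ →
      Runs (.seq (.const 4 2) (.seq (.const 5 0) (.seq (.add 3 0 5) (.seq (.add 0 0 2)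
        (.seq (.add 0 0 4) (.seq P Q)))))) s (1 + (1 + (1 + (1 + (1 + (t + t')))))) s₃ := by
    intro Q t' s₃ h
    refine .seq (.const _ _ _) (.seq (.const _ _ _) (.seq (.add _ _ _ _) (.seq (.add _ _ _ _)
      (.seq (.add _ _ _ _) (.seq ?_ h)))))
    convert h₂ using 1
    simp [hs₁, hN]
  have htime : ∀ r : ℕ, r ≤ N * (c' * (N + 1) ^ e' + 4) + 15 →
      1 + (1 + (1 + (1 + (1 + (t + r))))) ≤ (c + c' + 25) * (N + 1) ^ (e + e' + 1) := by
    intro r hr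
    rw [pow_succ]
    nlinarith [Nat.zero_le (c * (N + 1) ^ (e + e') * N)]
  by_cases h0 : result d I = 0
  · refine ⟨_, _, hpre (.condFalse (hv.trans h0) (.const _ _ _)), htime _ (by omega),
      fun _ => by simp, fun h => by omega, fun a h => by omega⟩
  by_cases h1 : result d I = 1
  · refine ⟨_, _, hpre (.condTrue (by rw [hv]; exact h0) (.seq (.const _ _ _)
      (.seq (.sub _ _ _ _) (.condFalse (by simp [hv, h1]) (.const _ _ _))))), htime _ (by omega),
      fun h => by omega, fun _ => by simp, fun a h => by omega⟩
  obtain ⟨a, h2⟩ : ∃ a, result d I = a + 2 := ⟨result d I - 2, by omega⟩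
  obtain ⟨t', s₃, h₃, ht', hm⟩ := hW N a N 0
    (((((s₂.setReg 7 1).setReg 8 (a + 1)).setReg 8 a).setReg 9 0).setReg 10 N)
    (by simp [e0]) (by simp) (by simp) (by simp) (by simp) (by simp) (by simp)
  refine ⟨_, _, hpre (.condTrue (by rw [hv]; exact h0) (.seq (.const _ _ _)
      (.seq (.sub _ _ _ _) (.condTrue (by simp [hv, h2]) (.seq (.sub _ _ _ _)
        (.seq (.const _ _ _) (.seq (.add _ _ _ _) (.seq (t := t') (s' := s₃) ?_
          (.const _ _ _))))))))), htime _ (by omega),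
      fun h => by omega, fun h => by omega, fun a' h => ?_⟩
  · convert h₃ using 1
    simp [hv, h2, e0]
  · obtain rfl : a = a' := by omega
    exact ⟨by simp, hm⟩


/-! ### Closures, greedy choices and the target weight -/

theorem mask_congr {N : ℕ} {p q : ℕ → Prop} (h : ∀ i < N, p i ↔ q i) : mask N p = mask N q := by
  refine Nat.eq_of_testBit_eq fun i => ?_
  rcases lt_or_ge i N with hi | hi
  · have h₁ := tb_mask N p i
    have h₂ := tb_mask N q i
    rw [tb_iff (mask_lt N p)] at h₁
    rw [tb_iff (mask_lt N q)] at h₂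
    rw [Bool.eq_iff_iff]
    have := h i hi
    tauto
  · rw [Nat.testBit_lt_two_pow ((mask_lt N p).trans_le (Nat.pow_le_pow_right (by norm_num) hi)),
      Nat.testBit_lt_two_pow ((mask_lt N q).trans_le (Nat.pow_le_pow_right (by norm_num) hi))]

theorem mask_tb {N a : ℕ} (ha : a < 2 ^ N) : mask N (tb N a) = a := by
  refine Nat.eq_of_testBit_eq fun i => ?_
  rcases lt_or_ge i N with hi | hi
  · have h₁ := tb_mask N (tb N a) i
    have h₂ := tb_iff (i := i) ha
    rw [tb_iff (mask_lt N _)] at h₁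
    rw [Bool.eq_iff_iff]
    tauto
  · rw [Nat.testBit_lt_two_pow ((mask_lt N _).trans_le (Nat.pow_le_pow_right (by norm_num) hi)),
      Nat.testBit_lt_two_pow (ha.trans_le (Nat.pow_le_pow_right (by norm_num) hi))]

theorem tb_lt {N a i : ℕ} (h : tb N a i) : i < N := h.1

theorem cnt_mono {N : ℕ} {p q : ℕ → Prop} (h : ∀ i < N, p i → q i) : cnt N p ≤ cnt N q := by
  classical
  unfold cnt
  refine Finset.card_le_card fun i hi => ?_
  simp only [Finset.mem_filter, Finset.mem_range] at hi ⊢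
  exact ⟨hi.1, h i hi.1 hi.2⟩

theorem cnt_congr {N : ℕ} {p q : ℕ → Prop} (h : ∀ i < N, p i ↔ q i) : cnt N p = cnt N q :=
  (cnt_mono fun i hi => (h i hi).1).antisymm (cnt_mono fun i hi => (h i hi).2)

theorem cnt_lt {N : ℕ} {p q : ℕ → Prop} (h : ∀ i < N, p i → q i) {i : ℕ} (hi : i < N) (hq : q i)
    (hp : ¬ p i) : cnt N p < cnt N q := by
  classical
  unfold cnt
  refine Finset.card_lt_card ⟨fun i hi => ?_, fun h' => hp ?_⟩
  · simp only [Finset.mem_filter, Finset.mem_range] at hi ⊢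
    exact ⟨hi.1, h i hi.1 hi.2⟩
  · exact (Finset.mem_filter.mp (h' (Finset.mem_filter.mpr ⟨Finset.mem_range.mpr hi, hq⟩))).2

theorem cnt_le (N : ℕ) (p : ℕ → Prop) : cnt N p ≤ N := by
  classical
  unfold cnt
  exact (Finset.card_filter_le _ _).trans (by simp)

theorem cnt_or {N : ℕ} {p q : ℕ → Prop} (h : ∀ i < N, p i → ¬ q i) :
    cnt N (fun i => p i ∨ q i) = cnt N p + cnt N q := by
  classical
  unfold cnt
  rw [← Finset.card_union_of_disjoint]
  · congr 1; ext i; simp only [Finset.mem_filter, Finset.mem_union]; tauto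
  · rw [Finset.disjoint_left]
    intro i hi hi'
    simp only [Finset.mem_filter, Finset.mem_range] at hi hi'
    exact h i hi.1 hi.2 hi'.2

/-! ### Saturation of a set of numbers below N within N rounds -/

section closure

variable {N a₀ : ℕ} {Q : ℕ → ℕ → Prop}

theorem closure_lt (ha : a₀ < 2 ^ N) (t : ℕ) :
    iter t a₀ (fun _ A => mask N fun x => tb N A x ∨ Q A x) < 2 ^ N := by
  cases t with
  | zero => exact ha
  | succ t => exact mask_lt _ _

theorem closure_succ (t x : ℕ) :
    tb N (iter (t + 1) a₀ (fun _ A => mask N fun x => tb N A x ∨ Q A x)) x ↔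
      tb N (iter t a₀ (fun _ A => mask N fun x => tb N A x ∨ Q A x)) x ∨
      (x < N ∧ Q (iter t a₀ (fun _ A => mask N fun x => tb N A x ∨ Q A x)) x) := by
  rw [iter_succ, tb_mask]
  have := @tb_lt N (iter t a₀ (fun _ A => mask N fun x => tb N A x ∨ Q A x)) x
  tauto

theorem closure_sub {x : ℕ} (t : ℕ) (hx : tb N a₀ x) :
    tb N (iter t a₀ (fun _ A => mask N fun x => tb N A x ∨ Q A x)) x := by
  induction t with
  | zero => exact hx
  | succ t ih => exact (closure_succ t x).2 (Or.inl ih)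

theorem closure_ind {T : ℕ → Prop} (h₀ : ∀ x, tb N a₀ x → T x)
    (h : ∀ A, (∀ y, tb N A y → T y) → ∀ x < N, Q A x → T x) (t : ℕ) :
    ∀ x, tb N (iter t a₀ (fun _ A => mask N fun x => tb N A x ∨ Q A x)) x → T x := by
  induction t with
  | zero => exact h₀
  | succ t ih =>
    intro x hx
    rcases (closure_succ t x).1 hx with h' | h'
    · exact ih x h'
    · exact h _ ih x h'.1 h'.2

/-- After `N` rounds, the closure of a set of numbers below `N` is reached. -/
theorem closure_closed (ha : a₀ < 2 ^ N) {x : ℕ} (hx : x < N)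
    (hQ : Q (iter N a₀ (fun _ A => mask N fun x => tb N A x ∨ Q A x)) x) :
    tb N (iter N a₀ (fun _ A => mask N fun x => tb N A x ∨ Q A x)) x := by
  set a : ℕ → ℕ := fun t => iter t a₀ (fun _ A => mask N fun x => tb N A x ∨ Q A x) with hadef
  -- A round without change stops the process for good, and every round before that adds a number.
  -- Without a stop, the set has at least N members after N rounds, hence contains everything below
  -- N.
  have key : ∀ t, a (t + 1) = a t ∨ t ≤ cnt N (tb N (a t)) := by
    intro t
    induction t with
    | zero => right; omega
    | succ t ih =>
      rcases ih with ih | ih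
      · left
        change mask N (fun x => tb N (a (t + 1)) x ∨ Q (a (t + 1)) x) = a (t + 1)
        rw [ih]; exact ih
      · by_cases h : ∀ y < N, tb N (a (t + 1)) y → tb N (a t) y
        · left
          have h₁ : a (t + 1) = a t := by
            have e₁ : mask N (tb N (a (t + 1))) = a (t + 1) := mask_tb (closure_lt ha (t + 1))
            have e₂ : mask N (tb N (a t)) = a t := mask_tb (closure_lt ha t)
            rw [← e₁, ← e₂]
            exact mask_congr fun y hy => ⟨h y hy, fun h' => (closure_succ t y).2 (Or.inl h')⟩
          change mask N (fun x => tb N (a (t + 1)) x ∨ Q (a (t + 1)) x) = a (t + 1)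
          rw [h₁]; exact h₁
        · right
          push Not at h
          obtain ⟨y, hy, h₁, h₂⟩ := h
          have := cnt_lt (N := N) (p := tb N (a t)) (q := tb N (a (t + 1)))
            (fun z _ hz => (closure_succ t z).2 (Or.inl hz)) hy h₁ h₂
          omega
  rcases key N with h | h
  · change tb N (a N) x
    rw [← h]
    exact (closure_succ N x).2 (Or.inr ⟨hx, hQ⟩)
  · by_contra hc
    have := cnt_lt (N := N) (p := tb N (a N)) (q := fun _ => True) (fun _ _ _ => trivial) hx
      trivial hc
    have := cnt_le N fun _ => True
    omega

end closure

/-! ### Maximality of the greedy family, and the truncated computation of the weight -/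

section greedy

variable (d : ℕ) (I : Inst)

/-- A freezing clause is rejected in its round only because of a clash with a clause chosen before,
and chosen clauses are never dropped. So the family is maximal, though not necessarily of maximum
size. -/
theorem greedy_spec (hM : I.M ≤ I.N) (x : ℕ) :
    (∀ j, tb I.N (greedy d I x) j → freezes d I x j) ∧
    (∀ j j', tb I.N (greedy d I x) j → tb I.N (greedy d I x) j' → j < j' → ¬ clash d I j j') ∧
    (∀ j, freezes d I x j → tb I.N (greedy d I x) j ∨
      ∃ j', tb I.N (greedy d I x) j' ∧ clash d I j' j) := by
  classical
  have key : ∀ m ≤ I.N, ∀ S, S = iter m (mask I.N fun _ => False) (fun j S =>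
      if freezes d I x j ∧ ∀ j' < I.N, tb I.N S j' → ¬ clash d I j' j then
      mask I.N fun i => tb I.N S i ∨ i = j else S) →
      (∀ j, tb I.N S j → j < m ∧ freezes d I x j) ∧
      (∀ j j', tb I.N S j → tb I.N S j' → j < j' → ¬ clash d I j j') ∧
      (∀ j < m, freezes d I x j → tb I.N S j ∨ ∃ j', tb I.N S j' ∧ clash d I j' j) := by
    intro m
    induction m with
    | zero => rintro - S rfl; simp
    | succ m ih =>
      rintro hm S hS
      rw [iter_succ] at hS
      obtain ⟨h₁, h₂, h₃⟩ := ih (by omega) _ rfl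
      set S' := iter m (mask I.N fun _ => False) (fun j S =>
        if freezes d I x j ∧ ∀ j' < I.N, tb I.N S j' → ¬ clash d I j' j then
        mask I.N fun i => tb I.N S i ∨ i = j else S) with hS'
      split_ifs at hS with hc
      · have hmem : ∀ j, tb I.N S j ↔ tb I.N S' j ∨ j = m := by
          intro j
          rw [hS, tb_mask]
          constructor
          · exact fun h => h.2
          · rintro (h | rfl)
            · exact ⟨h.1, Or.inl h⟩
            · exact ⟨by omega, Or.inr rfl⟩
        simp only [hmem]
        refine ⟨?_, ?_, ?_⟩
        · rintro j (h | rfl)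
          · exact ⟨(h₁ j h).1.trans (by omega), (h₁ j h).2⟩
          · exact ⟨by omega, hc.1⟩
        · rintro j j' (h | rfl) (h' | rfl) hjj
          · exact h₂ j j' h h' hjj
          · exact hc.2 j h.1 h
          · have := (h₁ j' h').1; omega
          · omega
        · intro j hj hf
          rcases Nat.lt_succ_iff_lt_or_eq.mp hj with hj | rfl
          · rcases h₃ j hj hf with h | ⟨j', h, h'⟩
            · exact Or.inl (Or.inl h)
            · exact Or.inr ⟨j', Or.inl h, h'⟩
          · exact Or.inl (Or.inr rfl)
      · subst hS
        refine ⟨fun j h => ⟨(h₁ j h).1.trans (by omega), (h₁ j h).2⟩, h₂, ?_⟩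
        intro j hj hf
        rcases Nat.lt_succ_iff_lt_or_eq.mp hj with hj | rfl
        · exact h₃ j hj hf
        · right
          by_contra hne
          push Not at hne
          exact hc ⟨hf, fun j' _ h => hne j' h⟩
  have hdef : greedy d I x = iter I.N (mask I.N fun _ => False) (fun j S =>
      if freezes d I x j ∧ ∀ j' < I.N, tb I.N S j' → ¬ clash d I j' j then
      mask I.N fun i => tb I.N S i ∨ i = j else S) := by
    unfold greedy; congr!
  obtain ⟨h₁, h₂, h₃⟩ := key I.N le_rfl _ hdef
  exact ⟨fun j h => (h₁ j h).2, h₂, fun j h => h₃ j (h.1.trans_le hM) h⟩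

theorem instPow_eq (hN : I.n + 1 ≤ I.N) : instPow I = I.n ^ min I.k (I.n + 1) := by
  have h₁ : ∀ a m, (iter m 0 fun l b => if l < I.n then b + a else b) = min m I.n * a := by
    intro a m
    induction m with
    | zero => simp
    | succ m ih =>
      rw [iter_succ, ih]
      split_ifs with h
      · rw [min_eq_left h.le, min_eq_left (by omega)]; ring
      · rw [min_eq_right (by omega), min_eq_right (by omega)]
  have h₂ : ∀ m, (iter m 1 fun i a => if i < I.k ∧ i < I.n + 1 then
      iter I.N 0 fun l b => if l < I.n then b + a else b else a) =
        I.n ^ min m (min I.k (I.n + 1)) := by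
    intro m
    induction m with
    | zero => simp
    | succ m ih =>
      rw [iter_succ, ih, h₁, min_eq_right (by omega : I.n ≤ I.N)]
      split_ifs with h
      · rw [min_eq_left (by omega), min_eq_left (by omega), pow_succ]; ring
      · congr 1; omega
  rw [instPow, h₂, min_eq_right (by omega)]

/-- As k log₂ n = log₂ (n^k), the weight can be found by comparing powers of 2 with an integer. -/
theorem miniWeight_eq (k n : ℕ) : miniWeight k n = Nat.log 2 (n ^ k) := by
  rw [miniWeight, ← Real.natFloor_logb_natCast]
  push_cast
  rw [Real.logb_pow]

theorem cnt_lt_eq (N m : ℕ) : cnt N (fun i => i < m) = min N m := by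
  induction N with
  | zero => simp [cnt]
  | succ N ih => rw [cnt_succ, ih]; split_ifs <;> omega

/-- Cutting off the exponent at n + 1 is harmless: for n ≥ 2 one has log₂ (n^m) ≥ m, so for k > n +
1 both the true and the truncated weight exceed n; for n = 1 both are 0. Beyond n the exact value is
irrelevant, as no assignment has such a weight. -/
theorem target_spec (hn : 1 ≤ I.n) (hN : I.n + 1 ≤ I.N) :
    (miniWeight I.k I.n ≤ I.n → target I = miniWeight I.k I.n) ∧
      (I.n < miniWeight I.k I.n → I.n < target I) := by
  have h₁ : target I = min I.N (Nat.log 2 (I.n ^ min I.k (I.n + 1))) := by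
    rw [target, instPow_eq I hN, ← cnt_lt_eq I.N (Nat.log 2 _)]
    refine cnt_congr fun i hi => ?_
    rw [two_eq (by omega), ← Nat.le_log_iff_pow_le (by norm_num) (by positivity)]
    omega
  rw [miniWeight_eq, h₁]
  rcases le_or_gt I.k (I.n + 1) with hk | hk
  · rw [min_eq_left hk]; omega
  · rw [min_eq_right hk.le]
    rcases Nat.lt_or_ge 1 I.n with h2 | h2
    · have h₃ : ∀ m, m ≤ Nat.log 2 (I.n ^ m) := fun m => by
        rw [Nat.le_log_iff_pow_le (by norm_num) (by positivity)]
        exact Nat.pow_le_pow_left h2 m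
      have := h₃ I.k
      have := h₃ (I.n + 1)
      omega
    · have : I.n = 1 := by omega
      simp [this]

end greedy


/-! ### Meaning of the algorithm: frozen variables and unit propagation -/

/-- The parameters `I` represent the formula `F`, with clauses `C 0`, …, `C (M - 1)`. -/
structure Represents (d : ℕ) (I : Inst) {n : ℕ} (F : Formula n) (C : ℕ → Clause n) : Prop where
  n_eq : I.n = n
  n_pos : 1 ≤ n
  N_eq : I.N = n + I.M + 2
  card : ∀ j < I.M, (C j).card = d
  mem : ∀ j < I.M, C j ∈ F
  surj : ∀ c ∈ F, ∃ j < I.M, C j = c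
  occ_neg : ∀ j < I.M, ∀ x, occ d I j x 0 ↔ ∃ h : x < n, (⟨x, h⟩, false) ∈ C j
  occ_pos : ∀ j < I.M, ∀ x, occ d I j x 1 ↔ ∃ h : x < n, (⟨x, h⟩, true) ∈ C j

/-- The variables that occur positively in a clause. -/
def Clause.pos {n : ℕ} (c : Clause n) : Finset (Fin n) :=
  Finset.univ.filter fun y => (y, true) ∈ c

@[simp] theorem Clause.mem_pos {n : ℕ} (c : Clause n) (y : Fin n) :
    y ∈ c.pos ↔ (y, true) ∈ c := by simp [Clause.pos]

theorem card_freezingClause {n : ℕ} (x : Fin n) (Y : Finset (Fin n)) :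
    (freezingClause x Y).card = Y.card + 1 := by
  rw [freezingClause, Finset.card_insert_of_notMem (by simp),
    Finset.card_image_of_injective _ fun a b h => (Prod.mk.inj h).1]

theorem mem_freezingClause {n : ℕ} (x y : Fin n) (Y : Finset (Fin n)) (σ : Bool) :
    (y, σ) ∈ freezingClause x Y ↔ (y = x ∧ σ = false) ∨ (y ∈ Y ∧ σ = true) := by
  simp [freezingClause, eq_comm]

theorem pos_freezingClause {n : ℕ} (x : Fin n) (Y : Finset (Fin n)) :
    Clause.pos (freezingClause x Y) = Y := by
  ext y; simp [mem_freezingClause]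

/-- There is a maximal family of disjoint sets `Y` of `d - 1` variables other than `x` such that
the clause `¬x ∨ ⋁_{y ∈ Y} y` is in `F`, with fewer than `K` members. -/
def HasSmallMaximalFamily (K : ℕ) {n : ℕ} (F : Formula n) (x : Fin n) : Prop :=
  ∃ 𝓜 : Finset (Finset (Fin n)), 𝓜.card < K ∧
    (∀ Y ∈ 𝓜, x ∉ Y ∧ freezingClause x Y ∈ F) ∧
    ∀ Y : Finset (Fin n), x ∉ Y → freezingClause x Y ∈ F → Y ∈ 𝓜 ∨ ∃ Z ∈ 𝓜, ¬ Disjoint Z Y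

open Classical in
/-- The frozen variables that the algorithm finds. -/
noncomputable def frozenVars (d : ℕ) (I : Inst) (n : ℕ) : Finset (Fin n) :=
  Finset.univ.filter fun x => tb I.N (frozenSet d I) x

namespace Represents

variable {d : ℕ} {I : Inst} {n : ℕ} {F : Formula n} {C : ℕ → Clause n}

theorem lt_N (R : Represents d I F C) (x : Fin n) : (x : ℕ) < I.N := by
  have := R.N_eq; have := x.2; omega

theorem n_le (R : Represents d I F C) : I.n + 1 ≤ I.N := by
  have := R.N_eq; have := R.n_eq; omega

theorem M_le (R : Represents d I F C) : I.M ≤ I.N := by have := R.N_eq; omega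

theorem occ_neg_iff (R : Represents d I F C) {j : ℕ} (hj : j < I.M) (x : Fin n) :
    occ d I j x 0 ↔ (x, false) ∈ C j := by simp [R.occ_neg j hj]

theorem occ_pos_iff (R : Represents d I F C) {j : ℕ} (hj : j < I.M) (x : Fin n) :
    occ d I j x 1 ↔ (x, true) ∈ C j := by simp [R.occ_pos j hj]

theorem freezes_iff (R : Represents d I F C) (x : Fin n) {j : ℕ} (hj : j < I.M) :
    freezes d I x j ↔ x ∉ (C j).pos ∧ C j = freezingClause x (C j).pos := by
  unfold freezes
  rw [R.occ_neg_iff hj, R.occ_pos_iff hj, Clause.mem_pos]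
  constructor
  · rintro ⟨-, h₁, h₂, h₃⟩
    refine ⟨h₂, ?_⟩
    ext ⟨y, σ⟩
    rw [mem_freezingClause, Clause.mem_pos]
    cases σ
    · simp only [and_true, Bool.false_eq_true, and_false, or_false]
      constructor
      · intro hy
        by_contra hne
        exact h₃ y (R.lt_N y) (fun h => hne (Fin.ext h)) ((R.occ_neg_iff hj y).2 hy)
      · rintro rfl; exact h₁
    · simp
  · rintro ⟨h₁, h₂⟩
    refine ⟨hj, ?_, h₁, fun y hy hne h => ?_⟩
    · rw [h₂, mem_freezingClause]; simp
    · obtain ⟨hy', h⟩ := (R.occ_neg j hj y).1 h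
      rw [h₂, mem_freezingClause] at h
      simp only [and_true, Bool.false_eq_true, and_false, or_false] at h
      exact hne (congrArg Fin.val h)

theorem clash_iff (R : Represents d I F C) {j j' : ℕ} (hj : j < I.M) (hj' : j' < I.M) :
    clash d I j j' ↔ ¬ Disjoint (C j).pos (C j').pos := by
  rw [Finset.not_disjoint_iff]
  constructor
  · rintro ⟨y, -, h, h'⟩
    obtain ⟨hy, h⟩ := (R.occ_pos j hj y).1 h
    exact ⟨⟨y, hy⟩, by simpa using h, by simpa using (R.occ_pos_iff hj' ⟨y, hy⟩).1 h'⟩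
  · rintro ⟨y, h, h'⟩
    exact ⟨y, R.lt_N y, (R.occ_pos_iff hj y).2 (by simpa using h),
      (R.occ_pos_iff hj' y).2 (by simpa using h')⟩

theorem tb_frozenSet (R : Represents d I F C) (x : Fin n) : tb I.N (frozenSet d I) x ↔
    target I ≤ n ∧ target I ≤ cnt I.N fun j => tb I.N (greedy d I x) j := by
  rw [frozenSet, tb_mask, R.n_eq]
  have := R.lt_N x
  simp [this]

theorem target_spec (R : Represents d I F C) : (miniWeight I.k n ≤ n → target I = miniWeight I.k n) ∧
    (n < miniWeight I.k n → n < target I) := by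
  have := MiniSat.target_spec I (by rw [R.n_eq]; exact R.n_pos) R.n_le
  rwa [R.n_eq] at this

theorem isFrozen (R : Represents d I F C) {x : Fin n} (hx : x ∈ frozenVars d I n) :
    IsFrozen d (miniWeight I.k n) F x := by
  classical
  simp only [frozenVars, Finset.mem_filter, Finset.mem_univ, true_and, R.tb_frozenSet] at hx
  obtain ⟨h₁, h₂⟩ := hx
  -- The guard `target I ≤ n` in `frozenSet` excludes a truncated weight, so at least K clauses
  -- really were chosen.
  have hK : target I = miniWeight I.k n := by
    rcases le_or_gt (miniWeight I.k n) n with h | h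
    · exact R.target_spec.1 h
    · have := R.target_spec.2 h; omega
  rw [hK] at h₂
  obtain ⟨g₁, g₂, -⟩ := greedy_spec d I R.M_le x
  obtain ⟨T, hT, hcard⟩ := Finset.exists_subset_card_eq h₂
  let e := T.equivFinOfCardEq hcard
  have hmem : ∀ i, tb I.N (greedy d I x) (e.symm i) := fun i =>
    (Finset.mem_filter.mp (hT (e.symm i).2)).2
  refine ⟨fun i => (C (e.symm i)).pos, fun i => ?_, fun i j hij => ?_⟩
  · have hf := g₁ _ (hmem i)
    obtain ⟨h₃, h₄⟩ := (R.freezes_iff x hf.1).1 hf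
    refine ⟨?_, h₃, ?_⟩
    · have := card_freezingClause x (C (e.symm i)).pos
      rw [← h₄, R.card _ hf.1] at this
      exact (Nat.sub_eq_of_eq_add this).symm
    · rw [← h₄]; exact R.mem _ hf.1
  · have hne : (e.symm i : ℕ) ≠ e.symm j := fun h => hij (e.symm.injective (Subtype.ext h))
    have hi := (g₁ _ (hmem i)).1
    have hj := (g₁ _ (hmem j)).1
    rcases lt_or_gt_of_ne hne with h | h
    · have := g₂ _ _ (hmem i) (hmem j) h
      rwa [R.clash_iff hi hj, not_not] at this
    · have := g₂ _ _ (hmem j) (hmem i) h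
      rwa [R.clash_iff hj hi, not_not, disjoint_comm] at this

/-- The sets of positive variables of the greedily chosen clauses form the family. The variable may
still be frozen; the probabilistic part uses only the small maximal family. -/
theorem hasSmallMaximalFamily (R : Represents d I F C) (hK : miniWeight I.k n ≤ n) {x : Fin n}
    (hx : x ∉ frozenVars d I n) : HasSmallMaximalFamily (miniWeight I.k n) F x := by
  classical
  simp only [frozenVars, Finset.mem_filter, Finset.mem_univ, true_and, R.tb_frozenSet,
    R.target_spec.1 hK, hK, not_le] at hx
  obtain ⟨g₁, g₂, g₃⟩ := greedy_spec d I R.M_le x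
  refine ⟨((Finset.range I.N).filter fun j => tb I.N (greedy d I x) j).image fun j => (C j).pos,
    Finset.card_image_le.trans_lt (lt_of_le_of_lt (le_of_eq ?_) hx), ?_, ?_⟩
  · unfold cnt; congr
  · intro Y hY
    simp only [Finset.mem_image, Finset.mem_filter] at hY
    obtain ⟨j, ⟨-, hj⟩, rfl⟩ := hY
    have hf := g₁ _ hj
    obtain ⟨h₃, h₄⟩ := (R.freezes_iff x hf.1).1 hf
    exact ⟨h₃, h₄ ▸ R.mem _ hf.1⟩
  · intro Y hxY hY
    obtain ⟨j, hj, hC⟩ := R.surj _ hY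
    have hpos : (C j).pos = Y := by rw [hC, pos_freezingClause]
    have hf : freezes d I x j := (R.freezes_iff x hj).2 (by rw [hpos]; exact ⟨hxY, hC⟩)
    rcases g₃ j hf with h | ⟨j', h, h'⟩
    · left
      exact Finset.mem_image.2 ⟨j, Finset.mem_filter.2 ⟨Finset.mem_range.2 h.1, h⟩, hpos⟩
    · right
      refine ⟨(C j').pos, Finset.mem_image.2 ⟨j', Finset.mem_filter.2
        ⟨Finset.mem_range.2 h.1, h⟩, rfl⟩, ?_⟩
      rw [← hpos]
      exact (R.clash_iff (g₁ _ h).1 hj).1 h'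

/-- Soundness holds in each round of propagation. Completeness is an induction on `Forced`, because
the set reached after N rounds is closed under the unit rule. -/
theorem tb_forcedSet (R : Represents d I F C) (x : Fin n) :
    tb I.N (forcedSet d I) x ↔ Forced F (frozenVars d I n) x := by
  constructor
  · suffices h : ∀ y, tb I.N (forcedSet d I) y → ∃ hy : y < n, Forced F (frozenVars d I n) ⟨y, hy⟩ by
      intro hx; exact (h x hx).2
    refine closure_ind (T := fun y => ∃ hy : y < n, Forced F (frozenVars d I n) ⟨y, hy⟩) ?_ ?_ _
    · intro y hy
      have hy' : y < n := by
        have := (tb_mask _ _ _).1 hy; rw [← R.n_eq]; exact this.2.1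
      exact ⟨hy', .base _ (by simpa [frozenVars] using hy)⟩
    · rintro A hA y - ⟨hy, j, -, hj, h₁, h₂⟩
      obtain ⟨hy', h₁⟩ := (R.occ_neg j hj y).1 h₁
      refine ⟨hy', .unit (C j) (R.mem j hj) _ h₁ ?_ ?_⟩
      · rintro ⟨z, σ⟩ hz hne
        cases σ
        · have := (h₂ z (R.lt_N z)).2 ((R.occ_neg_iff hj z).2 hz)
          exact absurd (by simpa [Fin.ext_iff] using this) hne
        · rfl
      · rintro ⟨z, σ⟩ hz hne
        cases σ
        · have := (h₂ z (R.lt_N z)).2 ((R.occ_neg_iff hj z).2 hz)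
          exact absurd (by simpa [Fin.ext_iff] using this) hne
        · exact (hA z ((h₂ z (R.lt_N z)).1 ((R.occ_pos_iff hj z).2 hz))).2
  · intro hx
    induction hx with
    | base x hx => exact closure_sub _ (by simpa [frozenVars] using hx)
    | unit c hc x hx hpos hdel ih =>
      obtain ⟨j, hj, rfl⟩ := R.surj c hc
      refine closure_closed (mask_lt _ _) (R.lt_N x) ⟨by rw [R.n_eq]; exact x.2, j, ?_, hj, ?_, ?_⟩
      · have := R.N_eq; omega
      · exact (R.occ_neg_iff hj x).2 hx
      · refine fun y hy => ⟨fun h => ?_, fun h => ?_⟩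
        · obtain ⟨hy', h⟩ := (R.occ_pos j hj y).1 h
          exact ih _ h (by simp)
        · obtain ⟨hy', h⟩ := (R.occ_neg j hj y).1 h
          by_contra hne
          have := hpos _ h (by simpa [Fin.ext_iff] using hne)
          simp at this

end Represents

/-- In a satisfying assignment of weight `K`, the variables forced by `K`-frozen variables are
FALSE. -/
theorem Forced.eq_false {d n : ℕ} {F : Formula n} {U : Finset (Fin n)} {a : Fin n → Bool}
    (hU : ∀ x ∈ U, IsFrozen d (weight a) F x) (ha : Satisfies a F) {x : Fin n}
    (hx : Forced F U x) : a x = false := by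
  induction hx with
  | base x hx =>
    by_contra hne
    obtain ⟨Y, hY, hdisj⟩ := hU x hx
    -- With `x` TRUE, each freezing clause is satisfied by a TRUE variable of its set. Disjointness
    -- makes these variables distinct, and together with `x` they are one more than the weight.
    have h : ∀ i, ∃ y ∈ Y i, a y = true := by
      intro i
      obtain ⟨⟨y, σ⟩, hl, he⟩ := ha _ (hY i).2.2
      rcases (mem_freezingClause _ _ _ _).1 hl with ⟨rfl, rfl⟩ | ⟨h, rfl⟩
      · exact absurd he hne
      · exact ⟨y, h, he⟩
    choose y hy hya using h
    have hinj : Function.Injective y := by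
      intro i j hij
      by_contra h
      exact Finset.disjoint_left.1 (hdisj i j h) (hy i) (hij ▸ hy j)
    have hsub : insert x (Finset.univ.image y) ⊆ Finset.univ.filter fun i => a i = true := by
      intro z hz
      rcases Finset.mem_insert.1 hz with rfl | hz
      · simpa using hne
      · obtain ⟨i, -, rfl⟩ := Finset.mem_image.1 hz
        simpa using hya i
    have hle := Finset.card_le_card hsub
    rw [Finset.card_insert_of_notMem, Finset.card_image_of_injective _ hinj, Finset.card_univ,
      Fintype.card_fin] at hle
    · change weight a + 1 ≤ weight a at hle
      omega
    · intro h
      obtain ⟨i, -, hi⟩ := Finset.mem_image.1 h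
      exact (hY i).2.1 (hi ▸ hy i)
  | unit c hc x hx hpos hdel ih =>
    obtain ⟨l, hl, he⟩ := ha c hc
    by_cases h : l = (x, false)
    · subst h; exact he
    · have := ih l hl h
      rw [this, hpos l hl h] at he
      exact absurd he (by simp)


/-! ### Meaning of the algorithm: residual components -/

namespace Represents

variable {d : ℕ} {I : Inst} {n : ℕ} {F : Formula n} {C : ℕ → Clause n}

theorem free_iff (R : Represents d I F C) (x : Fin n) :
    free d I x ↔ ¬ Forced F (frozenVars d I n) x := by
  rw [free, R.tb_forcedSet, R.n_eq]; simp

theorem has_iff (R : Represents d I F C) {j : ℕ} (hj : j < I.M) (x : ℕ) :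
    has d I j x ↔ ∃ h : x < n, (⟨x, h⟩ : Fin n) ∈ (C j).vars := by
  rw [has, R.occ_neg j hj, R.occ_pos j hj]
  constructor
  · rintro (⟨h, h'⟩ | ⟨h, h'⟩) <;> exact ⟨h, Finset.mem_image.2 ⟨_, h', rfl⟩⟩
  · rintro ⟨h, h'⟩
    obtain ⟨⟨y, σ⟩, hl, he⟩ := Finset.mem_image.1 h'
    obtain rfl : y = ⟨x, h⟩ := he
    cases σ
    · exact Or.inl ⟨h, hl⟩
    · exact Or.inr ⟨h, hl⟩

theorem alive_iff (R : Represents d I F C) {j : ℕ} (hj : j < I.M) :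
    alive d I j ↔ ∀ l ∈ C j, Forced F (frozenVars d I n) l.1 → l.2 = true := by
  constructor
  · rintro ⟨-, h⟩ ⟨y, σ⟩ hl hf
    cases σ
    · exact absurd ((R.tb_forcedSet y).2 hf) (h y (R.lt_N y) ((R.occ_neg_iff hj y).2 hl))
    · rfl
  · refine fun h => ⟨hj, fun y hy hocc hf => ?_⟩
    obtain ⟨hy', hl⟩ := (R.occ_neg j hj y).1 hocc
    have := h _ hl ((R.tb_forcedSet ⟨y, hy'⟩).1 hf)
    simp at this

theorem mem_reduce_iff (R : Represents d I F C) (c : Clause n) :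
    c ∈ reduce F (frozenVars d I n) ↔ ∃ j < I.M, alive d I j ∧
      open Classical in c = (C j).filter fun l => ¬ Forced F (frozenVars d I n) l.1 := by
  classical
  simp only [reduce, Finset.mem_image, Finset.mem_filter]
  constructor
  · rintro ⟨c', ⟨hc, h⟩, rfl⟩
    obtain ⟨j, hj, rfl⟩ := R.surj c' hc
    exact ⟨j, hj, (R.alive_iff hj).2 h, by congr!⟩
  · rintro ⟨j, hj, h, rfl⟩
    exact ⟨C j, ⟨R.mem j hj, (R.alive_iff hj).1 h⟩, by congr!⟩

theorem exists_mem_reduce_iff (R : Represents d I F C) (x y : Fin n) :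
    (∃ c ∈ reduce F (frozenVars d I n), x ∈ c.vars ∧ y ∈ c.vars) ↔ linked d I x y := by
  classical
  simp only [linked, R.free_iff, R.mem_reduce_iff]
  constructor
  · rintro ⟨_, ⟨j, hj, ha, rfl⟩, hx, hy⟩
    simp only [Clause.vars, Finset.mem_image, Finset.mem_filter] at hx hy
    obtain ⟨l, ⟨hl, hlf⟩, rfl⟩ := hx
    obtain ⟨l', ⟨hl', hlf'⟩, rfl⟩ := hy
    exact ⟨hlf, hlf', j, hj.trans_le R.M_le, ha,
      (R.has_iff hj _).2 ⟨l.1.2, Finset.mem_image_of_mem _ hl⟩,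
      (R.has_iff hj _).2 ⟨l'.1.2, Finset.mem_image_of_mem _ hl'⟩⟩
  · rintro ⟨hx, hy, j, -, ha, hjx, hjy⟩
    have hj := ha.1
    obtain ⟨_, hvx⟩ := (R.has_iff hj _).1 hjx
    obtain ⟨_, hvy⟩ := (R.has_iff hj _).1 hjy
    obtain ⟨l, hl, hlx⟩ := Finset.mem_image.1 hvx
    obtain ⟨l', hl', hly⟩ := Finset.mem_image.1 hvy
    refine ⟨_, ⟨j, hj, ha, rfl⟩, Finset.mem_image.2 ⟨l, Finset.mem_filter.2 ⟨hl, ?_⟩, hlx⟩,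
      Finset.mem_image.2 ⟨l', Finset.mem_filter.2 ⟨hl', ?_⟩, hly⟩⟩
    · rw [hlx]; exact hx
    · rw [hly]; exact hy

theorem linked_lt (R : Represents d I F C) {x y : ℕ} (h : linked d I x y) : x < n ∧ y < n :=
  ⟨R.n_eq ▸ h.1.1, R.n_eq ▸ h.2.1.1⟩

theorem conn_lt (R : Represents d I F C) {x y : ℕ} (hx : x < n) (h : conn d I x y) : y < n := by
  refine closure_ind (T := fun y => y < n) ?_ ?_ _ y h
  · intro z hz
    rw [((tb_mask _ _ _).1 hz).2]; exact hx
  · rintro A - z - ⟨w, -, -, hl⟩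
    exact (R.linked_lt hl).2

theorem conn_iff (R : Represents d I F C) (x y : Fin n) :
    conn d I x y ↔ (residualGraph (reduce F (frozenVars d I n))).Reachable x y := by
  set G := residualGraph (reduce F (frozenVars d I n)) with hG
  constructor
  · suffices h : ∀ y : ℕ, conn d I x y → ∃ hy : y < n, G.Reachable x ⟨y, hy⟩ from
      fun hxy => (h y hxy).2
    refine closure_ind (T := fun y => ∃ hy : y < n, G.Reachable x ⟨y, hy⟩) ?_ ?_ _
    · intro z hz
      obtain rfl := ((tb_mask _ _ _).1 hz).2
      exact ⟨x.2, .refl _⟩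
    · rintro A hA z - ⟨w, -, hw, hl⟩
      obtain ⟨hw', hr⟩ := hA w hw
      have hz := (R.linked_lt hl).2
      refine ⟨hz, ?_⟩
      by_cases hwz : w = z
      · subst hwz; exact hr
      · refine hr.trans (SimpleGraph.Adj.reachable ⟨by simpa [Fin.ext_iff] using hwz, ?_⟩)
        exact (R.exists_mem_reduce_iff ⟨w, hw'⟩ ⟨z, hz⟩).2 hl
  · rintro ⟨p⟩
    have hrefl : ∀ x : Fin n, conn d I x x := fun x =>
      closure_sub _ ((tb_mask _ _ _).2 ⟨R.lt_N x, rfl⟩)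
    have key : ∀ u v : Fin n, ∀ p : G.Walk u v, conn d I x u → conn d I x v := by
      intro u v p
      induction p with
      | nil => exact id
      | cons h p ih =>
        intro hu
        refine ih (closure_closed (mask_lt _ _) (R.lt_N _) ⟨_, R.lt_N _, hu, ?_⟩)
        exact (R.exists_mem_reduce_iff _ _).1 h.2
    exact key x y p (hrefl x)

theorem conn_refl (R : Represents d I F C) {x : ℕ} (hx : x < n) : conn d I x x :=
  (R.conn_iff ⟨x, hx⟩ ⟨x, hx⟩).2 (.refl _)

theorem conn_symm (R : Represents d I F C) {x y : ℕ} (hx : x < n) (h : conn d I x y) :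
    conn d I y x :=
  (R.conn_iff ⟨y, R.conn_lt hx h⟩ ⟨x, hx⟩).2 ((R.conn_iff ⟨x, hx⟩ ⟨y, R.conn_lt hx h⟩).1 h).symm

theorem conn_trans (R : Represents d I F C) {x y z : ℕ} (hx : x < n) (h : conn d I x y)
    (h' : conn d I y z) : conn d I x z := by
  have hy := R.conn_lt hx h
  have hz := R.conn_lt hy h'
  exact (R.conn_iff ⟨x, hx⟩ ⟨z, hz⟩).2 (((R.conn_iff ⟨x, hx⟩ ⟨y, hy⟩).1 h).trans
    ((R.conn_iff ⟨y, hy⟩ ⟨z, hz⟩).1 h'))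

theorem conn_of_linked (R : Represents d I F C) {x y : ℕ} (h : linked d I x y) : conn d I x y := by
  obtain ⟨hx, hy⟩ := R.linked_lt h
  rw [R.conn_iff ⟨x, hx⟩ ⟨y, hy⟩]
  by_cases hxy : x = y
  · subst hxy; exact .refl _
  · exact SimpleGraph.Adj.reachable ⟨by simpa [Fin.ext_iff] using hxy,
      (R.exists_mem_reduce_iff ⟨x, hx⟩ ⟨y, hy⟩).2 h⟩

theorem ncard_eq_cnt {n N : ℕ} (h : n ≤ N) (S : Set (Fin n)) (p : ℕ → Prop)
    (hp : ∀ i, p i ↔ ∃ hi : i < n, (⟨i, hi⟩ : Fin n) ∈ S) : S.ncard = cnt N p := by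
  classical
  rw [cnt, ← Set.ncard_coe_finset]
  rw [← Set.ncard_image_of_injective S Fin.val_injective]
  congr 1
  ext i
  simp only [Set.mem_image, Finset.coe_filter, Finset.mem_range, Set.mem_ofPred_eq, hp]
  constructor
  · rintro ⟨x, hx, rfl⟩
    exact ⟨x.2.trans_le h, x.2, hx⟩
  · rintro ⟨-, hi, hx⟩
    exact ⟨_, hx, rfl⟩

theorem ncard_supp (R : Represents d I F C) (x : Fin n) :
    ((residualGraph (reduce F (frozenVars d I n))).connectedComponentMk x).supp.ncard =
      cnt I.N (conn d I x) := by
  refine ncard_eq_cnt (by have := R.N_eq; omega) _ _ fun i => ?_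
  constructor
  · intro h
    have hi := R.conn_lt x.2 h
    refine ⟨hi, ?_⟩
    rw [SimpleGraph.ConnectedComponent.mem_supp_iff, SimpleGraph.ConnectedComponent.eq]
    exact ((R.conn_iff x ⟨i, hi⟩).1 h).symm
  · rintro ⟨hi, h⟩
    rw [SimpleGraph.ConnectedComponent.mem_supp_iff, SimpleGraph.ConnectedComponent.eq] at h
    exact (R.conn_iff x ⟨i, hi⟩).2 h.symm

theorem logb_lt_iff {n m : ℕ} (hn : 1 ≤ n) : Real.logb 2 n < m ↔ n < 2 ^ m := by
  rw [Real.logb_lt_iff_lt_rpow (by norm_num) (by positivity), Real.rpow_natCast]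
  exact_mod_cast Iff.rfl

theorem tooLarge_iff (R : Represents d I F C) :
    tooLarge d I ↔ HasLargeComponent (reduce F (frozenVars d I n)) := by
  have hvar : ∀ x : Fin n, (∃ c ∈ reduce F (frozenVars d I n), x ∈ c.vars) ↔
      (free d I x ∧ ∃ j < I.N, alive d I j ∧ has d I j x) := by
    intro x
    have := R.exists_mem_reduce_iff x x
    simp only [linked, and_self] at this
    rw [this]; tauto
  have hlog : ∀ x : Fin n, I.n < two I.N (cnt I.N (conn d I x)) ↔ Real.logb 2 n <
      (((residualGraph (reduce F (frozenVars d I n))).connectedComponentMk x).supp.ncard : ℝ) := by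
    intro x
    rw [logb_lt_iff R.n_pos, R.ncard_supp, two_eq (cnt_le _ _), R.n_eq]
  constructor
  · rintro ⟨x, -, hx, h⟩
    have hxn : x < n := R.n_eq ▸ hx.1.1
    obtain ⟨c, hc, hxc⟩ := (hvar ⟨x, hxn⟩).2 hx
    exact ⟨c, hc, _, hxc, (hlog ⟨x, hxn⟩).1 h⟩
  · rintro ⟨c, hc, x, hxc, h⟩
    exact ⟨x, R.lt_N x, (hvar x).1 ⟨c, hc, hxc⟩, (hlog x).2 h⟩

end Represents


/-! ### Meaning of the algorithm: combining the components -/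

/-- The assignment `a` satisfies all clauses in the component of `x`, and agrees there with `A` on
the variables below `t`. -/
def GoodAt (d : ℕ) (I : Inst) (A t x : ℕ) (a : ℕ → Prop) : Prop :=
  (∀ y < I.N, conn d I x y → (tb I.N (forcedSet d I) y → ¬ a y) ∧ (y < t → (a y ↔ tb I.N A y))) ∧
  ∀ j < I.N, alive d I j → (∃ y < I.N, conn d I x y ∧ free d I y ∧ has d I j y) →
    ∃ y < I.N, conn d I x y ∧ free d I y ∧ ((a y ∧ occ d I j y 1) ∨ (¬ a y ∧ occ d I j y 0))

theorem GoodAt.congr {d : ℕ} {I : Inst} {A t x : ℕ} {a a' : ℕ → Prop} (h : GoodAt d I A t x a)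
    (ha : ∀ y, conn d I x y → (a y ↔ a' y)) : GoodAt d I A t x a' := by
  refine ⟨fun y hy hc => ?_, fun j hj hal hex => ?_⟩
  · rw [← ha y hc]; exact h.1 y hy hc
  · obtain ⟨y, hy, hc, hf, hs⟩ := h.2 j hj hal hex
    exact ⟨y, hy, hc, hf, by rwa [← ha y hc]⟩

theorem testBit_mask (s : ℕ) (p : ℕ → Prop) (i : ℕ) :
    (mask s p).testBit i = true ↔ i < s ∧ p i := by
  rcases lt_or_ge i s with hi | hi
  · rw [← tb_mask, tb_iff (mask_lt s p)]; simp [hi]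
  · rw [Nat.testBit_lt_two_pow ((mask_lt s p).trans_le (Nat.pow_le_pow_right (by norm_num) hi))]
    simp; omega

namespace Represents

variable {d : ℕ} {I : Inst} {n : ℕ} {F : Formula n} {C : ℕ → Clause n}

/-- The size test covers the components of variables that occur in the residual formula. Any other
variable is alone in its component, where 2 ≤ N suffices. -/
theorem two_pow_card_le (R : Represents d I F C) (h : ¬ tooLarge d I) {x : ℕ} (hx : x < n) :
    2 ^ cnt I.N (conn d I x) ≤ I.N := by
  have hN := R.N_eq
  by_cases hocc : free d I x ∧ ∃ j < I.N, alive d I j ∧ has d I j x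
  · have : ¬ I.n < two I.N (cnt I.N (conn d I x)) := fun h' =>
      h ⟨x, by omega, hocc, h'⟩
    rw [two_eq (cnt_le _ _), R.n_eq] at this
    omega
  · have hone : cnt I.N (conn d I x) ≤ 1 := by
      classical
      unfold cnt
      rw [Finset.card_le_one]
      have : ∀ y, conn d I x y → y = x := by
        refine closure_ind (T := fun y => y = x) (fun z hz => ((tb_mask _ _ _).1 hz).2) ?_ _
        rintro A hA z - ⟨w, -, hw, hl⟩
        obtain rfl := hA w hw
        obtain ⟨h₁, -, j, hj, h₂, h₃, -⟩ := hl
        exact absurd ⟨h₁, j, hj, h₂, h₃⟩ hocc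
      intro y hy z hz
      simp only [Finset.mem_filter] at hy hz
      rw [this y hy.2, this z hz.2]
    calc 2 ^ cnt I.N (conn d I x) ≤ 2 ^ 1 := Nat.pow_le_pow_right (by norm_num) hone
      _ ≤ I.N := by omega

theorem rank_lt (R : Represents d I F C) {x y z : ℕ} (hx : x < n) (hy : conn d I x y)
    (hyz : y < z) : rank d I x y < rank d I x z := by
  have := R.conn_lt hx hy
  have := R.N_eq
  exact cnt_lt (fun i _ h => ⟨h.1.trans hyz, h.2⟩) (by omega : y < I.N) ⟨hyz, hy⟩ (by simp)

/-- Numbering the variables of a component by their rank uses only as many digits as the component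
has members. So a loop of length N over `b` meets every local assignment. -/
theorem exists_loc (R : Represents d I F C) (h : ¬ tooLarge d I) {x : ℕ} (hx : x < n)
    (a : ℕ → Prop) : ∃ b < I.N, ∀ y, conn d I x y → (loc d I x b y ↔ a y) := by
  have hN := R.N_eq
  set s := cnt I.N (conn d I x) with hs
  set p : ℕ → Prop := fun i => ∃ y, conn d I x y ∧ rank d I x y = i ∧ a y with hp
  have hlt : mask s p < I.N := (mask_lt s p).trans_le (R.two_pow_card_le h hx)
  refine ⟨mask s p, hlt, fun y hy => ?_⟩
  have hyn := R.conn_lt hx hy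
  have hrank : rank d I x y < s :=
    cnt_lt (fun i _ h => h.2) (by omega : y < I.N) hy (by simp)
  have hsN : s ≤ I.N := cnt_le _ _
  rw [loc, tb_iff (hlt.trans Nat.lt_two_pow_self), testBit_mask]
  constructor
  · rintro ⟨-, -, -, z, hz, hr, ha⟩
    rcases lt_trichotomy y z with hyz | rfl | hyz
    · have := R.rank_lt hx hy hyz; omega
    · exact ha
    · have := R.rank_lt hx hz hyz; omega
  · exact fun ha => ⟨hy, by omega, hrank, y, hy, rfl, ha⟩

theorem exists_rep (R : Represents d I F C) {y : ℕ} (hy : y < n) :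
    ∃ x ≤ y, rep d I x ∧ conn d I x y := by
  classical
  have hex : ∃ x, conn d I y x := ⟨y, R.conn_refl hy⟩
  have hc := Nat.find_spec hex
  have hlt := R.conn_lt hy hc
  refine ⟨Nat.find hex, Nat.find_le (R.conn_refl hy), ⟨by rw [R.n_eq]; exact hlt, ?_⟩,
    R.conn_symm hy hc⟩
  intro z _ hz hcz
  exact Nat.find_min hex hz (R.conn_trans hy hc hcz)

theorem rep_unique (R : Represents d I F C) {x z y : ℕ} (hx : rep d I x) (hz : rep d I z)
    (hxy : conn d I x y) (hzy : conn d I z y) : x = z := by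
  have hxn : x < n := R.n_eq ▸ hx.1
  have hzn : z < n := R.n_eq ▸ hz.1
  have hN := R.N_eq
  have hxz : conn d I x z := R.conn_trans hxn hxy (R.conn_symm hzn hzy)
  rcases lt_trichotomy x z with h | h | h
  · exact absurd (R.conn_symm hxn hxz) (hz.2 x (by omega) h)
  · exact h
  · exact absurd hxz (hx.2 z (by omega) h)

/-- Invariant of the subset-sum recursion: after round `m`, exactly the weights of partial
assignments supported on the components with representative below `m`, and good on each of them,
have been collected. Each component is treated once, at its smallest variable. -/
theorem iter_sums (R : Represents d I F C) (h : ¬ tooLarge d I) (A t : ℕ) (m : ℕ) (S : ℕ)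
    (hS : S = iter m (mask I.N fun w => w = 0) (open Classical in fun x S =>
      if rep d I x then
        mask I.N fun w => ∃ b < I.N, okLoc d I A t x b ∧ cnt I.N (loc d I x b) ≤ w ∧
          tb I.N S (w - cnt I.N (loc d I x b))
      else S)) (w : ℕ) :
    tb I.N S w ↔ w < I.N ∧ ∃ a : ℕ → Prop, (∀ y, a y → ∃ x < m, rep d I x ∧ conn d I x y) ∧
      (∀ x < m, rep d I x → GoodAt d I A t x a) ∧ cnt I.N a = w := by
  classical
  induction m generalizing S w with
  | zero =>
    rw [hS, iter_zero, tb_mask]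
    refine and_congr_right fun hw => ?_
    constructor
    · rintro rfl
      exact ⟨fun _ => False, by simp, by simp, by simp [cnt]⟩
    · rintro ⟨a, ha, -, rfl⟩
      have : ∀ y, ¬ a y := fun y hy => by obtain ⟨x, hx, -⟩ := ha y hy; omega
      simp [cnt, this]
  | succ m ih =>
    have ih := ih _ rfl
    rw [iter_succ] at hS
    split_ifs at hS with hrep
    · have hm : m < n := R.n_eq ▸ hrep.1
      rw [hS, tb_mask]
      refine and_congr_right fun hw => ?_
      constructor
      · rintro ⟨b, -, hok, hle, hb⟩
        obtain ⟨hlt, a, ha₁, ha₂, ha₃⟩ := (ih _).1 hb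
        have hdisj : ∀ y, a y → ¬ conn d I m y := by
          intro y hy hc
          obtain ⟨x, hx, hr, hcx⟩ := ha₁ y hy
          have := R.rep_unique hr hrep hcx hc
          omega
        -- The supports are disjoint because a component has only one representative, so the weights
        -- add up.
        refine ⟨fun y => a y ∨ loc d I m b y, ?_, ?_, ?_⟩
        · rintro y (hy | hy)
          · obtain ⟨x, hx, hr⟩ := ha₁ y hy
            exact ⟨x, by omega, hr⟩
          · exact ⟨m, by omega, hrep, hy.1⟩
        · intro x hx hr
          rcases Nat.lt_succ_iff_lt_or_eq.mp hx with hx | rfl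
          · refine (ha₂ x hx hr).congr fun y hy => ?_
            constructor
            · exact Or.inl
            · rintro (h' | h')
              · exact h'
              · have := R.rep_unique hr hrep hy h'.1; omega
          · refine GoodAt.congr (a := loc d I x b) hok fun y hy => ?_
            exact ⟨Or.inr, fun h' => h'.resolve_left fun ha => hdisj y ha hy⟩
        · rw [cnt_or fun y _ hy hl => hdisj y hy hl.1, ha₃]
          omega
      · rintro ⟨a, ha₁, ha₂, rfl⟩
        obtain ⟨b, hbN, hb⟩ := R.exists_loc h hm a
        have hloc : ∀ y, loc d I m b y ↔ a y ∧ conn d I m y := fun y =>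
          ⟨fun hl => ⟨(hb y hl.1).1 hl, hl.1⟩, fun h' => (hb y h'.2).2 h'.1⟩
        have hcard : cnt I.N a = cnt I.N (fun y => a y ∧ ¬ conn d I m y) +
            cnt I.N (loc d I m b) := by
          rw [← cnt_or]
          · refine cnt_congr fun y _ => ?_
            rw [hloc]; tauto
          · intro y _ hy hl; exact hy.2 hl.1
        refine ⟨b, hbN, (ha₂ m (by omega) hrep).congr fun y hy => (hb y hy).symm, by omega, ?_⟩
        -- Conversely, removing the component of `m` leaves a partial assignment to which the
        -- induction hypothesis applies.
        refine (ih _).2 ⟨by omega, fun y => a y ∧ ¬ conn d I m y, ?_, ?_, by omega⟩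
        · rintro y ⟨hy, hc⟩
          obtain ⟨x, hx, hr, hcx⟩ := ha₁ y hy
          rcases Nat.lt_succ_iff_lt_or_eq.mp hx with hx | rfl
          · exact ⟨x, hx, hr, hcx⟩
          · exact absurd hcx hc
        · intro x hx hr
          refine (ha₂ x (by omega) hr).congr fun y hy => ?_
          refine ⟨fun hy' => ⟨hy', fun hc => ?_⟩, And.left⟩
          have := R.rep_unique hr hrep hy hc
          omega
    · rw [hS, ih]
      refine and_congr_right fun hw => exists_congr fun a => and_congr ?_ (and_congr_left fun _ => ?_)
      · refine forall_congr' fun y => imp_congr_right fun _ => ?_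
        constructor
        · rintro ⟨x, hx, hr⟩; exact ⟨x, by omega, hr⟩
        · rintro ⟨x, hx, hr, hc⟩
          rcases Nat.lt_succ_iff_lt_or_eq.mp hx with hx | rfl
          · exact ⟨x, hx, hr, hc⟩
          · exact absurd hr hrep
      · constructor
        · intro h' x hx hr
          rcases Nat.lt_succ_iff_lt_or_eq.mp hx with hx | rfl
          · exact h' x hx hr
          · exact absurd hr hrep
        · intro h' x hx hr; exact h' x (by omega) hr

theorem tb_sums (R : Represents d I F C) (h : ¬ tooLarge d I) (A t w : ℕ) :
    tb I.N (sums d I A t) w ↔ w < I.N ∧ ∃ a : ℕ → Prop, (∀ y, a y → y < n) ∧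
      (∀ x, rep d I x → GoodAt d I A t x a) ∧ cnt I.N a = w := by
  rw [R.iter_sums h A t I.N (sums d I A t) rfl]
  have hN := R.N_eq
  refine and_congr_right fun hw => exists_congr fun a => and_congr ?_ (and_congr_left fun _ => ?_)
  · refine forall_congr' fun y => imp_congr_right fun _ => ?_
    constructor
    · rintro ⟨x, hx, hr, hc⟩
      exact R.conn_lt (R.n_eq ▸ hr.1) hc
    · intro hy
      obtain ⟨x, hx, hr, hc⟩ := R.exists_rep hy
      exact ⟨x, by omega, hr, hc⟩
  · exact ⟨fun h' x hr => h' x (by have := hr.1; have := R.n_eq; omega) hr,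
      fun h' x _ hr => h' x hr⟩

theorem weight_eq_cnt (R : Represents d I F C) (a : Fin n → Bool) :
    weight a = cnt I.N fun i => ∃ h : i < n, a ⟨i, h⟩ = true := by
  rw [← ncard_eq_cnt (by have := R.N_eq; omega) {x : Fin n | a x = true}
    (fun i => ∃ h : i < n, a ⟨i, h⟩ = true) fun i => Iff.rfl, weight, ← Set.ncard_coe_finset]
  simp

/-- Nothing is lost by setting the forced variables to FALSE, since every satisfying assignment of
the required weight does so. The remaining clauses split among the components, except for clauses
that have become empty; these are excluded by the second condition in `extendable`. -/
theorem extendable_iff (R : Represents d I F C) (h : ¬ tooLarge d I) (A t : ℕ) :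
    extendable d I A t ↔ ∃ a : Fin n → Bool, Satisfies a F ∧ weight a = miniWeight I.k n ∧
      ∀ i : Fin n, (i : ℕ) < t → (a i = true ↔ tb I.N A i) := by
  classical
  have hN := R.N_eq
  rw [extendable, R.tb_sums h]
  constructor
  · rintro ⟨⟨-, a, ha₁, ha₂, ha₃⟩, hne⟩
    have hcnt : cnt I.N (fun i => ∃ h : i < n, (fun x : Fin n => decide (a x)) ⟨i, h⟩ = true) =
        cnt I.N a :=
      cnt_congr fun i _ => by simpa using ha₁ i
    have hcn : cnt I.N a ≤ n := by
      rw [← hcnt, ← R.weight_eq_cnt fun x : Fin n => decide (a x)]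
      exact (Finset.card_filter_le _ _).trans (by simp)
    refine ⟨fun x => decide (a x), ?_, ?_, ?_⟩
    · intro c hc
      obtain ⟨j, hj, rfl⟩ := R.surj c hc
      by_cases hal : alive d I j
      · obtain ⟨y, hy, hf, hhas⟩ := hne j (hj.trans_le R.M_le) hal
        have hyn : y < n := R.n_eq ▸ hf.1
        obtain ⟨x, hx, hr, hcx⟩ := R.exists_rep hyn
        obtain ⟨z, hz, -, -, hs⟩ := (ha₂ x hr).2 j (hj.trans_le R.M_le) hal ⟨y, hy, hcx, hf, hhas⟩
        rcases hs with ⟨haz, hocc⟩ | ⟨haz, hocc⟩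
        · obtain ⟨hzn, hl⟩ := (R.occ_pos j hj z).1 hocc
          exact ⟨_, hl, by simpa using haz⟩
        · obtain ⟨hzn, hl⟩ := (R.occ_neg j hj z).1 hocc
          exact ⟨_, hl, by simpa using haz⟩
      -- A removed clause contains the negation of a forced variable, which is FALSE here.
      · rw [R.alive_iff hj] at hal
        push Not at hal
        obtain ⟨⟨y, σ⟩, hl, hf, hσ⟩ := hal
        obtain ⟨x, hx, hr, hcx⟩ := R.exists_rep y.2
        have := ((ha₂ x hr).1 y (R.lt_N y) hcx).1 ((R.tb_forcedSet y).2 hf)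
        refine ⟨_, hl, ?_⟩
        cases σ
        · simpa using this
        · exact absurd rfl hσ
    · rw [R.weight_eq_cnt, hcnt, ha₃]
      -- A weight above n would make the target exceed n, but the assignment found has at most n
      -- TRUE variables.
      refine R.target_spec.1 (not_lt.1 fun hlt => ?_)
      have := R.target_spec.2 hlt
      omega
    · intro i hi
      obtain ⟨x, hx, hr, hcx⟩ := R.exists_rep i.2
      simpa using ((ha₂ x hr).1 i (R.lt_N i) hcx).2 hi
  · rintro ⟨a, ha, hw, hagree⟩
    have hwn : weight a ≤ n := (Finset.card_filter_le _ _).trans (by simp)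
    have hforced : ∀ x, Forced F (frozenVars d I n) x → a x = false := fun x hx =>
      hx.eq_false (fun y hy => hw ▸ R.isFrozen hy) ha
    have hT := R.target_spec.1 (by omega)
    have hsat : ∀ j < I.M, alive d I j → ∃ y < I.N, free d I y ∧ has d I j y ∧
        (((∃ h : y < n, a ⟨y, h⟩ = true) ∧ occ d I j y 1) ∨
        ((¬ ∃ h : y < n, a ⟨y, h⟩ = true) ∧ occ d I j y 0)) := by
      intro j hj hal
      obtain ⟨⟨y, σ⟩, hl, he⟩ := ha _ (R.mem j hj)
      refine ⟨y, R.lt_N y, ?_, (R.has_iff hj y).2 ⟨y.2, Finset.mem_image.2 ⟨_, hl, rfl⟩⟩, ?_⟩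
      · rw [R.free_iff]
        intro hf
        have h₁ := hforced y hf
        have h₂ := (R.alive_iff hj).1 hal _ hl hf
        simp only at he h₂
        rw [h₁, h₂] at he
        exact absurd he (by simp)
      · cases σ
        · exact Or.inr ⟨by simpa using he, (R.occ_neg_iff hj y).2 hl⟩
        · exact Or.inl ⟨by simpa using he, (R.occ_pos_iff hj y).2 hl⟩
    refine ⟨⟨by omega, fun i => ∃ h : i < n, a ⟨i, h⟩ = true, fun y hy => hy.1, ?_, ?_⟩, ?_⟩
    · intro x hr
      have hxn : x < n := R.n_eq ▸ hr.1
      refine ⟨fun y _ hc => ?_, fun j _ hal => ?_⟩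
      · have hyn := R.conn_lt hxn hc
        refine ⟨fun hf => ?_, fun hyt => ?_⟩
        · rintro ⟨h', hay⟩
          rw [hforced _ ((R.tb_forcedSet ⟨y, h'⟩).1 hf)] at hay
          exact absurd hay (by simp)
        · rw [← hagree ⟨y, hyn⟩ hyt]
          exact ⟨fun h => h.2, fun h => ⟨hyn, h⟩⟩
      · rintro ⟨y, -, hc, hf, hhas⟩
        -- The satisfied literal shares its clause with `y`, so its variable lies in the same
        -- component.
        obtain ⟨z, hz, hzf, hzh, hs⟩ := hsat j hal.1 hal
        exact ⟨z, hz, R.conn_trans hxn hc (R.conn_of_linked ⟨hf, hzf, j,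
          hal.1.trans_le R.M_le, hal, hhas, hzh⟩), hzf, hs⟩
    · rw [hT, ← hw, R.weight_eq_cnt]
    · intro j hj hal
      obtain ⟨z, hz, hzf, hzh, -⟩ := hsat j hal.1 hal
      exact ⟨z, hz, hzf, hzh⟩

/-- Self-reduction: some solution always agrees with the choices made so far. After N rounds all n
variables are fixed, and the choices themselves are that solution. -/
theorem build_spec (R : Represents d I F C) (h : ¬ tooLarge d I)
    (h₀ : extendable d I (mask I.N fun _ => False) 0) (a : Fin n → Bool)
    (ha : ∀ i : Fin n, a i = true ↔ tb I.N (build d I) i) :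
    Satisfies a F ∧ weight a = miniWeight I.k n := by
  classical
  have hN := R.N_eq
  have key : ∀ m A, A = iter m (mask I.N fun _ => False) (fun t A =>
      if t < I.n ∧ extendable d I (mask I.N fun i => tb I.N A i ∨ i = t) (t + 1) then
        mask I.N fun i => tb I.N A i ∨ i = t else A) →
      extendable d I A (min m n) ∧ ∀ i, tb I.N A i → i < m := by
    intro m
    induction m with
    | zero => rintro A rfl; simpa using h₀
    | succ m ih =>
      intro A hA
      obtain ⟨h₁, h₂⟩ := ih _ rfl
      rw [iter_succ] at hA
      split_ifs at hA with hc
      · subst hA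
        have hm : m < n := R.n_eq ▸ hc.1
        refine ⟨by rw [min_eq_left (by omega)]; exact hc.2, fun i hi => ?_⟩
        rcases ((tb_mask _ _ _).1 hi).2 with hi | rfl
        · have := h₂ i hi; omega
        · omega
      · subst hA
        refine ⟨?_, fun i hi => (h₂ i hi).trans (by omega)⟩
        rcases Nat.lt_or_ge m n with hm | hm
        · rw [min_eq_left hm.le] at h₁
          rw [min_eq_left (by omega)]
          rw [R.extendable_iff h] at h₁ hc ⊢
          obtain ⟨b, hb, hw, hag⟩ := h₁
          refine ⟨b, hb, hw, fun i hi => ?_⟩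
          rcases Nat.lt_succ_iff_lt_or_eq.mp hi with hi | hi
          · exact hag i hi
          · constructor
            · intro hbi
              -- If variable `m` were TRUE in `b`, then `b` would show that setting it to TRUE is
              -- extendable, contrary to the failed test.
              refine absurd ⟨by rw [R.n_eq]; exact hm, b, hb, hw, fun i' hi' => ?_⟩ hc
              rw [tb_mask]
              have hl := R.lt_N i'
              rcases Nat.lt_succ_iff_lt_or_eq.mp hi' with hi' | hi'
              · rw [hag i' hi']
                exact ⟨fun h => ⟨hl, Or.inl h⟩, fun h => h.2.resolve_right (by omega)⟩
              · obtain rfl : i' = i := Fin.ext (by omega)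
                exact ⟨fun _ => ⟨hl, Or.inr hi'⟩, fun _ => hbi⟩
            · intro hi'
              have := h₂ i hi'; omega
        · rw [min_eq_right hm] at h₁
          rwa [min_eq_right (by omega)]
  have h₁ := (key I.N (build d I) (by unfold build; congr!)).1
  rw [min_eq_right (by omega), R.extendable_iff h] at h₁
  obtain ⟨b, hb, hw, hag⟩ := h₁
  obtain rfl : a = b := funext fun i => by
    rw [Bool.eq_iff_iff, ha i, hag i i.2]
  exact ⟨hb, hw⟩

end Represents


/-! ### The algorithm on all instances -/

theorem getD_flatten_map {β : Type} (f : β → ℕ) (d : ℕ) : ∀ (L : List (List β)),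
    (∀ l ∈ L, l.length = d) → ∀ j < L.length, ∀ i < d,
      (L.flatten.map f).getD (d * j + i) 0 = ((L.getD j []).map f).getD i 0 := by
  intro L
  induction L with
  | nil => intro _ j hj; simp at hj
  | cons l L ih =>
    intro hL j hj i hi
    have hl : l.length = d := hL l (by simp)
    rw [List.flatten_cons, List.map_append]
    cases j with
    | zero => rw [List.getD_append _ _ _ _ (by simp [hl, hi])]; simp
    | succ j =>
      rw [List.getD_append_right _ _ _ _ (by simp [hl]; nlinarith)]
      rw [List.length_map, hl, show d * (j + 1) + i - d = d * j + i by
        rw [mul_add, mul_one]; omega]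
      rw [ih (fun l hl => hL l (by simp [hl])) j (by simpa using hj) i hi]
      simp

theorem encodeLiteral_eq {n : ℕ} (l : Literal n) (x : ℕ) (σ : Bool) :
    encodeLiteral l = x + x + σ.toNat ↔ ∃ h : x < n, l = (⟨x, h⟩, σ) := by
  obtain ⟨⟨y, hy⟩, τ⟩ := l
  simp only [encodeLiteral]
  constructor
  · intro h
    have h₁ : y = x ∧ τ = σ := by cases σ <;> cases τ <;> simp at h ⊢ <;> omega
    obtain ⟨rfl, rfl⟩ := h₁
    exact ⟨hy, rfl⟩
  · rintro ⟨h, he⟩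
    simp only [Prod.mk.injEq, Fin.mk.injEq] at he
    obtain ⟨rfl, rfl⟩ := he
    ring

theorem Lists.length_eq {d n : ℕ} {F : Formula n} {L : List (List (Literal n))} (hL : Lists L F)
    (hF : IsDCNF d F) : ∀ l ∈ L, l.length = d := by
  intro l hl
  rw [← List.toFinset_card_of_nodup (hL.1 l hl)]
  refine hF _ ?_
  rw [← hL.2.2, List.mem_toFinset]
  exact List.mem_map_of_mem hl

theorem Lists.represents {d n k : ℕ} {F : Formula n} {L : List (List (Literal n))} (hn : 1 ≤ n)
    (hL : Lists L F) (hF : IsDCNF d F) :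
    Represents d ⟨(inputState k L).mem, n + L.length + 2, k, L.length, n⟩ F
      (fun j => (L.getD j []).toFinset) := by
  have hlen := hL.length_eq hF
  have hmemL : ∀ j < L.length, L.getD j [] ∈ L := fun j hj => by
    rw [List.getD_eq_getElem _ _ hj]; exact List.getElem_mem hj
  have hmem : ∀ j < L.length, (L.getD j []).toFinset ∈ F := fun j hj => by
    rw [← hL.2.2, List.mem_toFinset]
    exact List.mem_map_of_mem (hmemL j hj)
  have hocc : ∀ j < L.length, ∀ x, ∀ σ : Bool,
      occ d ⟨(inputState k L).mem, n + L.length + 2, k, L.length, n⟩ j x σ.toNat ↔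
        ∃ h : x < n, (⟨x, h⟩, σ) ∈ (L.getD j []).toFinset := by
    intro j hj x σ
    have hl := hlen _ (hmemL j hj)
    have hval : ∀ i < d, ∀ hi : i < (L.getD j []).length,
        (inputState k L).mem (d * j + i) = encodeLiteral (L.getD j [])[i] := by
      intro i hi hi'
      change (L.flatten.map encodeLiteral).getD (d * j + i) 0 = _
      rw [getD_flatten_map encodeLiteral d L hlen j hj i hi,
        List.getD_eq_getElem _ _ (by simpa using hi')]
      simp
    simp only [occ, List.mem_toFinset, List.mem_iff_getElem]
    constructor
    · rintro ⟨i, hi, he⟩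
      rw [hval i hi (hl ▸ hi), encodeLiteral_eq] at he
      obtain ⟨h, he⟩ := he
      exact ⟨h, i, hl ▸ hi, he⟩
    · rintro ⟨h, i, hi, he⟩
      refine ⟨i, hl ▸ hi, ?_⟩
      rw [hval i (hl ▸ hi) hi, encodeLiteral_eq]
      exact ⟨h, he⟩
  refine ⟨rfl, hn, rfl, fun j hj => hF _ (hmem j hj), hmem, fun c hc => ?_,
    fun j hj x => hocc j hj x false, fun j hj x => hocc j hj x true⟩
  rw [← hL.2.2, List.mem_toFinset, List.mem_map] at hc
  obtain ⟨l, hl, rfl⟩ := hc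
  obtain ⟨j, hj, rfl⟩ := List.mem_iff_getElem.1 hl
  exact ⟨j, hj, by rw [List.getD_eq_getElem _ _ hj]⟩

/-- Distinct clauses are distinct d-element sets of the 2n literals. This makes a bound polynomial
in N polynomial in n. -/
theorem Lists.length_le {d n : ℕ} {F : Formula n} {L : List (List (Literal n))}
    (hL : Lists L F) (hF : IsDCNF d F) : L.length ≤ (2 * n) ^ d := by
  have h₁ : L.length = F.card := by
    rw [← hL.2.2, List.toFinset_card_of_nodup hL.2.1, List.length_map]
  have h₂ : F ⊆ Finset.powersetCard d Finset.univ := fun c hc =>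
    Finset.mem_powersetCard.2 ⟨Finset.subset_univ _, hF c hc⟩
  have h₃ := Finset.card_le_card h₂
  rw [Finset.card_powersetCard, Finset.card_univ, Fintype.card_prod, Fintype.card_fin,
    Fintype.card_bool, mul_comm n 2] at h₃
  exact h₁ ▸ h₃.trans (Nat.choose_le_pow _ _)

/-- The algorithm: it is fast, never wrong, and fails only if a component is too large after unit
propagation from a set of frozen variables. Outside of this set, the greedy choice shows that there
are small maximal families of freezing clauses. -/
theorem exists_algorithm (d : ℕ) (hd : 1 ≤ d) :
    ∃ (P : Program) (A B : ℕ), ∀ n k : ℕ, 1 ≤ n → ∀ F : Formula n, IsDCNF d F →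
      ∀ L : List (List (Literal n)), Lists L F → ∃ (t : ℕ) (s : State),
        Runs P (inputState k L) t s ∧ t ≤ A * n ^ B ∧
        (s.answer n ≠ Answer.failure → (s.answer n).Solves F (miniWeight k n)) ∧
        ∃ U : Finset (Fin n), (∀ x ∈ U, IsFrozen d (miniWeight k n) F x) ∧
          (s.answer n = Answer.failure ↔ HasLargeComponent (reduce F U)) ∧
          (miniWeight k n ≤ n → ∀ x ∉ U, HasSmallMaximalFamily (miniWeight k n) F x) := by
  obtain ⟨P, c, e, hP⟩ := exists_program d
  refine ⟨P, c * (2 ^ d + 4) ^ e, d * e, fun n k hn F hF L hL => ?_⟩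
  obtain ⟨t, s, hrun, ht, h0, h1, h2⟩ := hP (inputState k L)
    ⟨(inputState k L).mem, n + L.length + 2, k, L.length, n⟩ rfl
  have R := hL.represents (k := k) hn hF
  set I : Inst := ⟨(inputState k L).mem, n + L.length + 2, k, L.length, n⟩ with hI
  have hans : (s.answer n = Answer.failure ↔ tooLarge d I) ∧
      (s.answer n ≠ Answer.failure → (s.answer n).Solves F (miniWeight k n)) := by
    by_cases hlarge : tooLarge d I
    · have : s.answer n = .failure := by
        simp [State.answer, h0 (by simp [result, hlarge])]
      simp [this, hlarge]
    · by_cases hext : extendable d I (mask I.N fun _ => False) 0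
      · obtain ⟨hr, hm⟩ := h2 (build d I) (by simp [result, hlarge, hext])
        have : s.answer n = .found fun i => decide (s.mem i.val ≠ 0) := by
          simp [State.answer, hr]
        rw [this]
        refine ⟨by simp [hlarge], fun _ => ?_⟩
        refine R.build_spec hlarge hext _ fun i => ?_
        rw [← hm i (R.lt_N i)]
        simp
      · have : s.answer n = .unsat := by
          simp [State.answer, h1 (by simp [result, hlarge, hext])]
        rw [this]
        refine ⟨by simp [hlarge], fun _ => ?_⟩
        rw [R.extendable_iff hlarge] at hext
        rintro ⟨a, ha, hw⟩
        exact hext ⟨a, ha, hw, fun i hi => absurd hi (by omega)⟩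
  refine ⟨t, s, hrun, ht.trans ?_, hans.2, frozenVars d I n, fun x hx => R.isFrozen hx,
    hans.1.trans R.tooLarge_iff, fun hK x hx => R.hasSmallMaximalFamily hK hx⟩
  have hle : n + L.length + 2 + 1 ≤ (2 ^ d + 4) * n ^ d := by
    have h₁ := hL.length_le hF
    rw [mul_pow] at h₁
    have h₂ : n ≤ n ^ d := Nat.le_self_pow (by omega) n
    have h₃ : 1 ≤ n ^ d := Nat.one_le_pow _ _ hn
    linarith
  calc c * (n + L.length + 2 + 1) ^ e ≤ c * ((2 ^ d + 4) * n ^ d) ^ e :=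
        Nat.mul_le_mul_left _ (Nat.pow_le_pow_left hle e)
    _ = c * (2 ^ d + 4) ^ e * n ^ (d * e) := by rw [mul_pow, pow_mul]; ring


/-! ### The law of one hyperedge -/

open MeasureTheory ProbabilityTheory

/-- A clause over `S` is determined by its set of positive variables, which is not all of `S`. The
upper bound suffices, since only a lower bound on the probability of a given clause is needed. -/
theorem card_nonMonotoneClauses_le {n : ℕ} (S : Finset (Fin n)) :
    (nonMonotoneClauses S).card ≤ 2 ^ S.card - 1 := by
  classical
  have hsub : nonMonotoneClauses S ⊆ (S.powerset.erase S).image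
      fun T => S.image fun y => (y, decide (y ∈ T)) := by
    intro C hC
    simp only [nonMonotoneClauses, Finset.mem_filter, Finset.mem_univ, true_and] at hC
    obtain ⟨hvars, hcard, ⟨z, τ⟩, hz, rfl⟩ := hC
    have hinj : Set.InjOn Prod.fst (C : Set (Literal n)) := by
      rw [← Finset.card_image_iff]
      change (Clause.vars C).card = C.card
      rw [hvars, hcard]
    refine Finset.mem_image.2 ⟨S.filter fun y => (y, true) ∈ C, ?_, ?_⟩
    · refine Finset.mem_erase.2 ⟨fun h => ?_, Finset.mem_powerset.2 (Finset.filter_subset _ _)⟩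
      have hzS : z ∈ S := hvars ▸ Finset.mem_image_of_mem Prod.fst hz
      rw [← h] at hzS
      have := hinj hz (Finset.mem_filter.1 hzS).2 rfl
      simp at this
    · refine Finset.eq_of_subset_of_card_le ?_ ?_
      · intro l hl
        obtain ⟨y, hy, rfl⟩ := Finset.mem_image.1 hl
        rw [← hvars] at hy
        obtain ⟨⟨y', σ⟩, hm, rfl⟩ := Finset.mem_image.1 hy
        have hyS : y' ∈ S := by rw [← hvars]; exact hy
        cases σ
        · have : (y', true) ∉ C := fun h => by simpa using hinj h hm rfl
          simpa [this] using hm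
        · simp [hm, hyS]
      · rw [hcard, Finset.card_image_of_injective _ fun a b h => (Prod.mk.inj h).1]
  refine (Finset.card_le_card hsub).trans (Finset.card_image_le.trans ?_)
  rw [Finset.card_erase_of_mem (by simp), Finset.card_powerset]

theorem freezingClause_mem {n : ℕ} {S : Finset (Fin n)} {v : Fin n} (hv : v ∈ S) :
    freezingClause v (S.erase v) ∈ nonMonotoneClauses S := by
  simp only [nonMonotoneClauses, Finset.mem_filter, Finset.mem_univ, true_and]
  refine ⟨?_, ?_, (v, false), by simp [freezingClause], rfl⟩
  · ext y
    simp only [Clause.vars, Finset.mem_image, Prod.exists, mem_freezingClause, Finset.mem_erase]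
    constructor
    · rintro ⟨y', σ, ⟨rfl, -⟩ | ⟨h, -⟩, rfl⟩
      · exact hv
      · exact h.2
    · intro hy
      by_cases h : y = v
      · exact ⟨y, false, Or.inl ⟨h, rfl⟩, rfl⟩
      · exact ⟨y, true, Or.inr ⟨⟨h, hy⟩, rfl⟩, rfl⟩
  · rw [card_freezingClause, Finset.card_erase_of_mem hv]
    have := Finset.card_pos.2 ⟨v, hv⟩
    omega

section law

variable {n : ℕ} {S : Finset (Fin n)} {p : ℝ}

theorem uniformOn_apply_eq_sum (A : Set (Clause n)) [DecidablePred (· ∈ A)] :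
    uniformOn (nonMonotoneClauses S : Set (Clause n)) A =
      ((nonMonotoneClauses S).card : ENNReal)⁻¹ *
        (((nonMonotoneClauses S).filter (· ∈ A)).card : ENNReal) := by
  classical
  rw [uniformOn, cond_apply (Set.toFinite _).measurableSet, Measure.count_apply_finset]
  congr 1
  rw [show (nonMonotoneClauses S : Set (Clause n)) ∩ A =
    (((nonMonotoneClauses S).filter (· ∈ A) : Finset (Clause n)) : Set (Clause n)) by ext; simp,
    Measure.count_apply_finset]

theorem hyperedgeLaw_apply (hp : p ≤ 1) (A : Set (Finset (Clause n))) :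
    hyperedgeLaw p S A = ENNReal.ofReal p *
      uniformOn (nonMonotoneClauses S : Set (Clause n)) {C | {C} ∈ A} +
      (1 - ENNReal.ofReal p) * (open Classical in if ∅ ∈ A then 1 else 0) := by
  classical
  rw [hyperedgeLaw, min_eq_left hp, Measure.add_apply, Measure.smul_apply, Measure.smul_apply,
    Measure.map_apply (measurable_of_finite _) (Set.toFinite A).measurableSet,
    Measure.dirac_apply' _ (Set.toFinite A).measurableSet]
  simp only [smul_eq_mul, Set.indicator_apply, Pi.one_apply]
  congr!

theorem isProbabilityMeasure_hyperedgeLaw (hS : S.Nonempty) (hp : p ≤ 1) :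
    IsProbabilityMeasure (hyperedgeLaw p S) := by
  classical
  obtain ⟨v, hv⟩ := hS
  have hne : (nonMonotoneClauses S : Set (Clause n)).Nonempty := ⟨_, freezingClause_mem hv⟩
  have := isProbabilityMeasure_uniformOn (Set.toFinite _) hne
  constructor
  rw [hyperedgeLaw_apply hp]
  have h1 : ENNReal.ofReal p ≤ 1 := by simpa using ENNReal.ofReal_le_ofReal hp
  simp [add_tsub_cancel_of_le h1]

theorem hyperedgeLaw_nonempty (hS : S.Nonempty) (h0 : 0 ≤ p) (hp : p ≤ 1) :
    (hyperedgeLaw p S).real {w | w ≠ ∅} = p := by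
  classical
  obtain ⟨v, hv⟩ := hS
  have hne : (nonMonotoneClauses S : Set (Clause n)).Nonempty := ⟨_, freezingClause_mem hv⟩
  have := isProbabilityMeasure_uniformOn (Set.toFinite _) hne
  rw [measureReal_def, hyperedgeLaw_apply hp]
  simp [ENNReal.toReal_ofReal h0]

theorem hyperedgeLaw_singleton (h0 : 0 ≤ p) (hp : p ≤ 1) {C : Clause n}
    (hC : C ∈ nonMonotoneClauses S) :
    (hyperedgeLaw p S).real {w | w = {C}} = p / (nonMonotoneClauses S).card := by
  classical
  rw [measureReal_def, hyperedgeLaw_apply hp, uniformOn_apply_eq_sum]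
  have : (nonMonotoneClauses S).filter (· ∈ ({C' | {C'} ∈ {w : Finset (Clause n) | w = {C}}} :
      Set (Clause n))) = {C} := by
    ext C'
    simp only [Set.mem_ofPred_eq, Finset.singleton_inj, Finset.mem_filter, Finset.mem_singleton]
    constructor
    · exact fun h => h.2
    · rintro rfl; exact ⟨hC, rfl⟩
  rw [this, if_neg (by simp)]
  simp [ENNReal.toReal_mul, ENNReal.toReal_ofReal h0, div_eq_mul_inv]

/-- The possible contributions of the set `S`. -/
def ValidAt (S : Finset (Fin n)) (w : Finset (Clause n)) : Prop :=
  w = ∅ ∨ ∃ C ∈ nonMonotoneClauses S, w = {C}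

theorem hyperedgeLaw_not_validAt (hp : p ≤ 1) : hyperedgeLaw p S {w | ¬ ValidAt S w} = 0 := by
  classical
  rw [hyperedgeLaw_apply hp, uniformOn_apply_eq_sum]
  have : (nonMonotoneClauses S).filter (· ∈ ({C' | {C'} ∈ {w : Finset (Clause n) | ¬ ValidAt S w}} :
      Set (Clause n))) = ∅ := by
    rw [Finset.filter_eq_empty_iff]
    intro C hC h
    exact h (Or.inr ⟨C, hC, rfl⟩)
  rw [this, if_neg (by simp [ValidAt])]
  simp

end law

/-! ### Joint probabilities -/

section joint

variable {d n : ℕ}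

/-- The hyperedge `S` meets `V` in `v` only, and it contributes the clause that helps to freeze
`v`. -/
def Freezes (V : Finset (Fin n)) (v : Fin n) (S : Hyperedge d n) (w : Finset (Clause n)) : Prop :=
  S.1 ∩ V = {v} ∧ w = {freezingClause v (S.1.erase v)}

open Classical in
/-- The number of hyperedges that help to freeze `v` and do not meet the rest of `V`. -/
noncomputable def freezeCount (V : Finset (Fin n)) (v : Fin n)
    (ω : Hyperedge d n → Finset (Clause n)) : ℕ :=
  (Finset.univ.filter fun S => Freezes V v S (ω S)).card

open Classical in
/-- The weight of the contribution `w` of `S` in the exponential moment. -/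
noncomputable def momentFactor (T : Finset (Hyperedge d n)) (W V : Finset (Fin n)) (l : ℝ)
    (S : Hyperedge d n) (w : Finset (Clause n)) : ℝ :=
  (if S ∈ T ∧ w = ∅ then 0 else 1) * ∏ v ∈ W, if Freezes V v S w then Real.exp (-l) else 1

theorem momentFactor_nonneg (T : Finset (Hyperedge d n)) (W V : Finset (Fin n)) (l : ℝ)
    (S : Hyperedge d n) (w : Finset (Clause n)) : 0 ≤ momentFactor T W V l S w := by
  refine mul_nonneg (by split_ifs <;> norm_num) (Finset.prod_nonneg fun v _ => ?_)
  split_ifs <;> positivity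

/-- The pointwise Chernoff inequality: on the event, each v ∈ W contributes exp (l (K - count)) ≥ 1.
The counts are written as products over hyperedges so that independence applies. -/
theorem indicator_le_prod_momentFactor (T : Finset (Hyperedge d n)) (W V : Finset (Fin n)) {l : ℝ}
    (hl : 0 ≤ l) (K : ℕ) (ω : Hyperedge d n → Finset (Clause n)) (hT : ∀ S ∈ T, ω S ≠ ∅)
    (hW : ∀ v ∈ W, freezeCount V v ω ≤ K) :
    1 ≤ Real.exp (l * K) ^ W.card * ∏ S, momentFactor T W V l S (ω S) := by
  classical
  simp only [momentFactor]
  rw [Finset.prod_mul_distrib, Finset.prod_eq_one (fun S _ => by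
    rw [if_neg fun h => hT S h.1 h.2]), one_mul, Finset.prod_comm, ← Finset.prod_const,
    ← Finset.prod_mul_distrib]
  refine le_of_eq_of_le Finset.prod_const_one.symm
    (Finset.prod_le_prod (s := W) (f := fun _ => (1 : ℝ)) (fun _ _ => zero_le_one) fun v hv => ?_)
  rw [Finset.prod_ite, Finset.prod_const, Finset.prod_const_one, mul_one, ← Real.exp_nat_mul,
    ← Real.exp_add, Real.one_le_exp_iff]
  have h1 : ((Finset.univ.filter fun S => Freezes V v S (ω S)).card : ℝ) ≤ K := by
    have := hW v hv
    unfold freezeCount at this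
    exact_mod_cast (le_of_eq (by congr!)).trans this
  nlinarith

end joint


section joint

variable {d n : ℕ}

theorem momentFactor_of_mem {T : Finset (Hyperedge d n)} {W V : Finset (Fin n)} (l : ℝ)
    {S : Hyperedge d n} (hT : S ∈ T) (hv : ∀ v, S.1 ∩ V ≠ {v}) (w : Finset (Clause n)) :
    momentFactor T W V l S w = Set.indicator {w | w ≠ ∅} 1 w := by
  classical
  rw [momentFactor, Finset.prod_eq_one fun v _ => if_neg fun h => hv v h.1, mul_one]
  by_cases h : w = ∅ <;> simp [h, hT]

theorem momentFactor_of_notMem {T : Finset (Hyperedge d n)} {W V : Finset (Fin n)} (l : ℝ)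
    {S : Hyperedge d n} (hT : S ∉ T) {v : Fin n} (hv : v ∈ W) (hS : S.1 ∩ V = {v})
    (w : Finset (Clause n)) :
    momentFactor T W V l S w =
      1 - (1 - Real.exp (-l)) * Set.indicator {w | w = {freezingClause v (S.1.erase v)}} 1 w := by
  classical
  rw [momentFactor, if_neg fun h => hT h.1, one_mul, Finset.prod_eq_single v]
  · by_cases h : w = {freezingClause v (S.1.erase v)} <;> simp [h, Freezes, hS]
  · intro v' _ hne
    refine if_neg fun h => hne ?_
    have := h.1.symm.trans hS
    simpa using this
  · exact fun h => absurd hv h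

open Classical in
-- A hyperedge in `T` lies inside `V` and has d ≥ 2 vertices, so it never meets `V` in a single
-- vertex; and a hyperedge meeting `V` in a single vertex determines that vertex. Hence at most one
-- of the requirements concerns each hyperedge, and no conditioning arises.
theorem integral_momentFactor_le (hd : 2 ≤ d) {p : ℝ} (h0 : 0 ≤ p) (hp : p ≤ 1)
    {T : Finset (Hyperedge d n)} {W V : Finset (Fin n)} {l : ℝ} (hl : 0 ≤ l)
    (hTV : ∀ S ∈ T, S.1 ⊆ V) (S : Hyperedge d n) :
    ∫ w, momentFactor T W V l S w ∂(hyperedgeLaw p S.1) ≤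
      (if S ∈ T then p else 1) * (if ∃ v ∈ W, S.1 ∩ V = {v} then
        1 - p / (2 ^ d - 1) * (1 - Real.exp (-l)) else 1) := by
  have hSne : S.1.Nonempty := Finset.card_pos.1 (by rw [S.2]; omega)
  have := isProbabilityMeasure_hyperedgeLaw hSne hp
  by_cases hT : S ∈ T
  · have hv : ∀ v, S.1 ∩ V ≠ {v} := by
      intro v h
      rw [Finset.inter_eq_left.2 (hTV S hT)] at h
      have := S.2
      rw [h, Finset.card_singleton] at this
      omega
    simp only [momentFactor_of_mem l hT hv, if_pos hT]
    rw [if_neg (by rintro ⟨v, -, h⟩; exact hv v h), mul_one,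
      integral_indicator_one (Set.toFinite _).measurableSet, hyperedgeLaw_nonempty hSne h0 hp]
  · by_cases hex : ∃ v ∈ W, S.1 ∩ V = {v}
    · obtain ⟨v, hv, hS⟩ := hex
      have hvS : v ∈ S.1 := by
        have : v ∈ S.1 ∩ V := by rw [hS]; simp
        exact (Finset.mem_inter.1 this).1
      have hm := freezingClause_mem hvS
      simp only [momentFactor_of_notMem l hT hv hS, if_neg hT]
      rw [if_pos ⟨v, hv, hS⟩, one_mul, integral_sub (integrable_const _) Integrable.of_finite,
        integral_const_mul, integral_indicator_one (Set.toFinite _).measurableSet,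
        hyperedgeLaw_singleton h0 hp hm]
      simp only [integral_const, probReal_univ, smul_eq_mul, mul_one]
      have h1 : 0 ≤ 1 - Real.exp (-l) := by
        have : Real.exp (-l) ≤ 1 := Real.exp_le_one_iff.2 (by linarith)
        linarith
      have h2 : ((nonMonotoneClauses S.1).card : ℝ) ≤ 2 ^ d - 1 := by
        have h3 := card_nonMonotoneClauses_le S.1
        rw [S.2] at h3
        have h4 : 1 ≤ 2 ^ d := Nat.one_le_two_pow
        have h5 : ((nonMonotoneClauses S.1).card : ℝ) ≤ ((2 ^ d - 1 : ℕ) : ℝ) := by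
          exact_mod_cast h3
        rwa [Nat.cast_sub h4, Nat.cast_pow, Nat.cast_one, Nat.cast_ofNat] at h5
      have h3 : (0 : ℝ) < (nonMonotoneClauses S.1).card := by
        exact_mod_cast Finset.card_pos.2 ⟨_, hm⟩
      have h4 : p / (2 ^ d - 1) ≤ p / (nonMonotoneClauses S.1).card :=
        div_le_div_of_nonneg_left h0 h3 h2
      nlinarith
    · rw [if_neg hT, if_neg hex, one_mul]
      have : ∀ w, momentFactor T W V l S w = 1 := by
        intro w
        rw [momentFactor, if_neg fun h => hT h.1, one_mul]
        exact Finset.prod_eq_one fun v hv => if_neg fun h => hex ⟨v, hv, h.1⟩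
      simp [this]

/-- A vertex of `W` and d - 1 vertices outside `V` form such a hyperedge, and both can be recovered
by intersecting with `V` and by removing `V`. -/
theorem card_meeting_ge (hd : 1 ≤ d) {W V : Finset (Fin n)} (hWV : W ⊆ V) :
    W.card * (n - V.card).choose (d - 1) ≤
      (open Classical in Finset.univ.filter fun S : Hyperedge d n =>
        ∃ v ∈ W, S.1 ∩ V = {v}).card := by
  classical
  have h1 : (n - V.card).choose (d - 1) = (Finset.powersetCard (d - 1) Vᶜ).card := by
    rw [Finset.card_powersetCard, Finset.card_compl, Fintype.card_fin]
  rw [h1, ← Finset.card_product]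
  have hY : ∀ q ∈ W ×ˢ Finset.powersetCard (d - 1) Vᶜ, q.1 ∈ W ∧ Disjoint q.2 V ∧
      q.2.card = d - 1 := by
    rintro ⟨v, Y⟩ h
    simp only [Finset.mem_product, Finset.mem_powersetCard] at h
    exact ⟨h.1, Finset.subset_compl_iff_disjoint_right.1 h.2.1, h.2.2⟩
  have hval : ∀ q ∈ W ×ˢ Finset.powersetCard (d - 1) Vᶜ, (insert q.1 q.2).card = d := by
    intro q hq
    obtain ⟨h2, h3, h4⟩ := hY q hq
    rw [Finset.card_insert_of_notMem fun h => Finset.disjoint_left.1 h3 h (hWV h2), h4]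
    omega
  have hmeet : ∀ q ∈ W ×ˢ Finset.powersetCard (d - 1) Vᶜ, insert q.1 q.2 ∩ V = {q.1} := by
    intro q hq
    obtain ⟨h2, h3, -⟩ := hY q hq
    rw [Finset.insert_inter_of_mem (hWV h2), Finset.disjoint_iff_inter_eq_empty.1 h3]
    rfl
  rw [← Finset.card_image_of_injective _ Subtype.val_injective]
  refine Finset.card_le_card_of_injOn (fun q => insert q.1 q.2) (fun q hq => ?_)
    fun q hq q' hq' he => ?_
  · have hq := Finset.mem_coe.1 hq
    exact Finset.mem_coe.2 (Finset.mem_image.2 ⟨⟨_, hval q hq⟩,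
      by simpa using ⟨q.1, (hY q hq).1, hmeet q hq⟩, rfl⟩)
  · have hq := Finset.mem_coe.1 hq
    have hq' := Finset.mem_coe.1 hq'
    have e1 : ({q.1} : Finset (Fin n)) = {q'.1} := by
      rw [← hmeet q hq, ← hmeet q' hq']; exact congrArg (· ∩ V) he
    have hsd : ∀ q ∈ W ×ˢ Finset.powersetCard (d - 1) Vᶜ, insert q.1 q.2 \ V = q.2 := by
      intro q hq
      obtain ⟨h2, h3, -⟩ := hY q hq
      rw [Finset.insert_sdiff_of_mem _ (hWV h2), Finset.sdiff_eq_self_of_disjoint h3]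
    refine Prod.ext (Finset.singleton_inj.1 e1) ?_
    rw [← hsd q hq, ← hsd q' hq']
    exact congrArg (· \ V) he

/-- The probability that all hyperedges in `T` contribute a clause, while all variables in `W` have
at most `K` freezing clauses that do not meet the rest of `V`. -/
theorem modelLaw_le (hd : 2 ≤ d) {p : ℝ} (h0 : 0 ≤ p) (hp : p ≤ 1)
    {T : Finset (Hyperedge d n)} {W V : Finset (Fin n)} {l : ℝ} (hl : 0 ≤ l) (K : ℕ)
    (hTV : ∀ S ∈ T, S.1 ⊆ V) (hWV : W ⊆ V) :
    (modelLaw d n p).real {ω | (∀ S ∈ T, ω S ≠ ∅) ∧ ∀ v ∈ W, freezeCount V v ω ≤ K} ≤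
      p ^ T.card * (Real.exp (l * K) *
        (1 - p / (2 ^ d - 1) * (1 - Real.exp (-l))) ^ (n - V.card).choose (d - 1)) ^ W.card := by
  classical
  have hprob : ∀ S : Hyperedge d n, IsProbabilityMeasure (hyperedgeLaw p S.1) := fun S =>
    isProbabilityMeasure_hyperedgeLaw (Finset.card_pos.1 (by rw [S.2]; omega)) hp
  have hmodel : IsProbabilityMeasure (modelLaw d n p) := by unfold modelLaw; infer_instance
  set x : ℝ := 1 - p / (2 ^ d - 1) * (1 - Real.exp (-l)) with hx
  have h2d : (1 : ℝ) ≤ 2 ^ d - 1 := by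
    have : (2 : ℝ) ^ 1 ≤ 2 ^ d := pow_le_pow_right₀ (by norm_num) (by omega)
    linarith
  have hq0 : 0 ≤ p / (2 ^ d - 1 : ℝ) := by positivity
  have hq1 : p / (2 ^ d - 1 : ℝ) ≤ 1 := by rw [div_le_one (by linarith)]; linarith
  have he1 : Real.exp (-l) ≤ 1 := Real.exp_le_one_iff.2 (by linarith)
  have he0 := Real.exp_pos (-l)
  have hx0 : 0 ≤ x := by rw [hx]; nlinarith
  have hx1 : x ≤ 1 := by rw [hx]; nlinarith
  set E := {ω : Hyperedge d n → Finset (Clause n) |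
    (∀ S ∈ T, ω S ≠ ∅) ∧ ∀ v ∈ W, freezeCount V v ω ≤ K} with hE
  -- The indicator is bounded by the exponential moment, whose integral factorizes over the
  -- hyperedges. Since 0 ≤ x ≤ 1, a lower bound on the number of factors `x` is enough.
  calc (modelLaw d n p).real E = ∫ ω, Set.indicator E 1 ω ∂(modelLaw d n p) :=
        (integral_indicator_one (Set.toFinite _).measurableSet).symm
    _ ≤ ∫ ω, Real.exp (l * K) ^ W.card * ∏ S, momentFactor T W V l S (ω S) ∂(modelLaw d n p) := by
        refine integral_mono Integrable.of_finite Integrable.of_finite fun ω => ?_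
        by_cases h : ω ∈ E
        · rw [Set.indicator_of_mem h]
          exact indicator_le_prod_momentFactor T W V hl K ω h.1 h.2
        · rw [Set.indicator_of_notMem h]
          exact mul_nonneg (by positivity)
            (Finset.prod_nonneg fun S _ => momentFactor_nonneg _ _ _ _ _ _)
    _ = Real.exp (l * K) ^ W.card *
        ∏ S : Hyperedge d n, ∫ w, momentFactor T W V l S w ∂(hyperedgeLaw p S.1) := by
        rw [integral_const_mul, modelLaw, integral_fintype_prod_eq_prod]
    _ ≤ Real.exp (l * K) ^ W.card * ∏ S : Hyperedge d n,
        ((if S ∈ T then p else 1) * (if ∃ v ∈ W, S.1 ∩ V = {v} then x else 1)) := by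
        refine mul_le_mul_of_nonneg_left (Finset.prod_le_prod (fun S _ => integral_nonneg fun w =>
          momentFactor_nonneg _ _ _ _ _ _) fun S _ => ?_) (by positivity)
        exact (integral_momentFactor_le hd h0 hp hl hTV S).trans_eq (by congr!)
    _ = Real.exp (l * K) ^ W.card * (p ^ T.card * x ^ (Finset.univ.filter fun S : Hyperedge d n =>
        ∃ v ∈ W, S.1 ∩ V = {v}).card) := by
        rw [Finset.prod_mul_distrib, Finset.prod_ite, Finset.prod_ite]
        simp
    _ ≤ Real.exp (l * K) ^ W.card * (p ^ T.card * x ^ (W.card * (n - V.card).choose (d - 1))) := by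
        have := card_meeting_ge (d := d) (by omega) hWV
        gcongr ?_ * (?_ * ?_)
        exact pow_le_pow_of_le_one hx0 hx1 (this.trans (le_of_eq (by congr!)))
    _ = _ := by rw [mul_pow, ← pow_mul, mul_comm W.card]; ring

end joint


/-! ### Chains of hyperedges -/

section chains

variable {d n : ℕ}

/-- The vertices reached by a chain of hyperedges starting from `x`. -/
def explored (x : Fin n) : List (Hyperedge d n × Fin n) → Finset (Fin n)
  | [] => {x}
  | e :: ℓ => e.1.1 ∪ explored x ℓ

open Classical in
/-- The steps that extend a chain: a hyperedge that meets the vertices already reached, and a new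
vertex in it. -/
noncomputable def steps (x : Fin n) (ℓ : List (Hyperedge d n × Fin n)) :
    Finset (Hyperedge d n × Fin n) :=
  Finset.univ.filter fun e => e.2 ∈ e.1.1 ∧ e.2 ∉ explored x ℓ ∧ (e.1.1 ∩ explored x ℓ).Nonempty

open Classical in
/-- The chains of `m` hyperedges starting from `x`. -/
noncomputable def chains (x : Fin n) : ℕ → Finset (List (Hyperedge d n × Fin n))
  | 0 => {[]}
  | m + 1 => (chains x m).biUnion fun ℓ => (steps x ℓ).image fun e => e :: ℓ

/-- The hyperedges of a chain. -/
def chainEdges (ℓ : List (Hyperedge d n × Fin n)) : Finset (Hyperedge d n) :=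
  (ℓ.map Prod.fst).toFinset

/-- The distinguished vertices of a chain. -/
def chainVertices (ℓ : List (Hyperedge d n × Fin n)) : Finset (Fin n) :=
  (ℓ.map Prod.snd).toFinset

theorem mem_chains_succ {x : Fin n} {m : ℕ} {ℓ : List (Hyperedge d n × Fin n)} :
    ℓ ∈ chains x (m + 1) ↔ ∃ ℓ' ∈ chains x m, ∃ e ∈ steps x ℓ', ℓ = e :: ℓ' := by
  simp [chains, eq_comm]

/-- Each added hyperedge contains a vertex not reached before, so both it and this vertex differ
from all earlier ones. The exact counts are the exponents in the probability bound. -/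
theorem chains_spec {x : Fin n} {m : ℕ} {ℓ : List (Hyperedge d n × Fin n)} (h : ℓ ∈ chains x m) :
    x ∈ explored x ℓ ∧ (explored x ℓ).card ≤ 1 + d * m ∧ (chainEdges ℓ).card = m ∧
      (chainVertices ℓ).card = m ∧ (∀ S ∈ chainEdges ℓ, S.1 ⊆ explored x ℓ) ∧
      chainVertices ℓ ⊆ explored x ℓ := by
  induction m generalizing ℓ with
  | zero =>
    obtain rfl : ℓ = [] := by simpa [chains] using h
    simp [explored, chainEdges, chainVertices]
  | succ m ih =>
    obtain ⟨ℓ', hℓ', ⟨S, v⟩, he, rfl⟩ := mem_chains_succ.1 h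
    obtain ⟨h1, h2, h3, h4, h5, h6⟩ := ih hℓ'
    simp only [steps, Finset.mem_filter, Finset.mem_univ, true_and] at he
    obtain ⟨hv, hnew, -⟩ := he
    have hE : chainEdges ((S, v) :: ℓ') = insert S (chainEdges ℓ') := by simp [chainEdges]
    have hV : chainVertices ((S, v) :: ℓ') = insert v (chainVertices ℓ') := by
      simp [chainVertices]
    have hX : explored x ((S, v) :: ℓ') = S.1 ∪ explored x ℓ' := rfl
    rw [hE, hV, hX]
    refine ⟨Finset.mem_union_right _ h1, ?_, ?_, ?_, ?_, ?_⟩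
    · have := Finset.card_union_le S.1 (explored x ℓ')
      rw [S.2] at this
      rw [mul_add, mul_one]
      omega
    · rw [Finset.card_insert_of_notMem fun hS => hnew (h5 S hS hv), h3]
    · rw [Finset.card_insert_of_notMem fun hv' => hnew (h6 hv'), h4]
    · intro S' hS'
      rcases Finset.mem_insert.1 hS' with rfl | hS'
      · exact Finset.subset_union_left
      · exact (h5 S' hS').trans Finset.subset_union_right
    · intro u hu
      rcases Finset.mem_insert.1 hu with rfl | hu
      · exact Finset.mem_union_left _ hv
      · exact Finset.mem_union_right _ (h6 hu)

open Classical in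
theorem card_hyperedges_le (A : Finset (Fin n)) :
    (Finset.univ.filter fun S : Hyperedge d n => A ⊆ S.1).card ≤ n ^ (d - A.card) := by
  have h : (Finset.univ.filter fun S : Hyperedge d n => A ⊆ S.1).card ≤
      (Finset.powersetCard (d - A.card) (Finset.univ : Finset (Fin n))).card := by
    refine Finset.card_le_card_of_injOn (fun S => S.1 \ A) (fun S hS => ?_) fun S hS S' hS' he => ?_
    · have hS := (Finset.mem_filter.1 (Finset.mem_coe.1 hS)).2
      refine Finset.mem_coe.2 (Finset.mem_powersetCard.2 ⟨Finset.subset_univ _, ?_⟩)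
      rw [Finset.card_sdiff_of_subset hS, S.2]
    · have hS := (Finset.mem_filter.1 (Finset.mem_coe.1 hS)).2
      have hS' := (Finset.mem_filter.1 (Finset.mem_coe.1 hS')).2
      refine Subtype.ext ?_
      rw [← Finset.sdiff_union_of_subset hS, ← Finset.sdiff_union_of_subset hS']
      exact congrArg (· ∪ A) he
  refine h.trans ?_
  rw [Finset.card_powersetCard, Finset.card_univ, Fintype.card_fin]
  exact Nat.choose_le_pow _ _

theorem card_steps_le (x : Fin n) (ℓ : List (Hyperedge d n × Fin n)) :
    (steps x ℓ).card ≤ (explored x ℓ).card * (n ^ (d - 1) * d) := by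
  classical
  have hsub : steps x ℓ ⊆ (explored x ℓ).biUnion fun u =>
      (Finset.univ.filter fun S : Hyperedge d n => {u} ⊆ S.1).biUnion fun S =>
        S.1.image fun v => (S, v) := by
    rintro ⟨S, v⟩ he
    simp only [steps, Finset.mem_filter, Finset.mem_univ, true_and] at he
    obtain ⟨hv, -, u, hu⟩ := he
    have hu := Finset.mem_inter.1 hu
    exact Finset.mem_biUnion.2 ⟨u, hu.2, Finset.mem_biUnion.2 ⟨S, by simpa using hu.1,
      Finset.mem_image_of_mem _ hv⟩⟩
  refine (Finset.card_le_card hsub).trans (Finset.card_biUnion_le_card_mul _ _ _ fun u _ => ?_)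
  refine (Finset.card_biUnion_le_card_mul _ _ d fun S _ =>
    Finset.card_image_le.trans S.2.le).trans (Nat.mul_le_mul_right _ ?_)
  simpa using card_hyperedges_le (d := d) {u}

theorem card_chains_le (x : Fin n) (m : ℕ) :
    (chains (d := d) x m).card ≤ ((1 + d * m) * (n ^ (d - 1) * d)) ^ m := by
  classical
  -- The base is kept at its final value 1 + d m, so that it does not change in the induction.
  have key : ∀ i ≤ m, (chains (d := d) x i).card ≤ ((1 + d * m) * (n ^ (d - 1) * d)) ^ i := by
    intro i
    induction i with
    | zero => simp [chains]
    | succ i ih =>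
      intro hi
      rw [chains, pow_succ]
      refine (Finset.card_biUnion_le_card_mul _ _ ((1 + d * m) * (n ^ (d - 1) * d))
        fun ℓ hℓ => ?_).trans (Nat.mul_le_mul_right _ (ih (by omega)))
      refine Finset.card_image_le.trans ((card_steps_le x ℓ).trans (Nat.mul_le_mul_right _ ?_))
      refine (chains_spec hℓ).2.1.trans ?_
      have := Nat.mul_le_mul_left d (show i ≤ m by omega)
      omega
  exact key m le_rfl

/-- Some chain of `m` hyperedges that contribute clauses has only distinguished vertices with at
most `K` freezing clauses that meet the chain in this vertex only. -/
def HasBadChain (m K : ℕ) (ω : Hyperedge d n → Finset (Clause n)) : Prop :=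
  ∃ x : Fin n, ∃ ℓ ∈ chains x m, (∀ S ∈ chainEdges ℓ, ω S ≠ ∅) ∧
    ∀ v ∈ chainVertices ℓ, freezeCount (explored x ℓ) v ω ≤ K

theorem prob_hasBadChain_le (hd : 2 ≤ d) {p : ℝ} (h0 : 0 ≤ p) (hp : p ≤ 1) {l : ℝ} (hl : 0 ≤ l)
    (m K : ℕ) :
    (modelLaw d n p).real {ω | HasBadChain m K ω} ≤
      n * (((1 + d * m) * (n ^ (d - 1) * d)) ^ m * (p ^ m * (Real.exp (l * K) *
        (1 - p / (2 ^ d - 1) * (1 - Real.exp (-l))) ^ (n - (1 + d * m)).choose (d - 1)) ^ m)) := by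
  classical
  have hprob : ∀ S : Hyperedge d n, IsProbabilityMeasure (hyperedgeLaw p S.1) := fun S =>
    isProbabilityMeasure_hyperedgeLaw (Finset.card_pos.1 (by rw [S.2]; omega)) hp
  have hmodel : IsProbabilityMeasure (modelLaw d n p) := by unfold modelLaw; infer_instance
  set x : ℝ := 1 - p / (2 ^ d - 1) * (1 - Real.exp (-l)) with hx
  have h2d : (1 : ℝ) ≤ 2 ^ d - 1 := by
    have : (2 : ℝ) ^ 1 ≤ 2 ^ d := pow_le_pow_right₀ (by norm_num) (by omega)
    linarith
  have hq0 : 0 ≤ p / (2 ^ d - 1 : ℝ) := by positivity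
  have hq1 : p / (2 ^ d - 1 : ℝ) ≤ 1 := by rw [div_le_one (by linarith)]; linarith
  have he1 : Real.exp (-l) ≤ 1 := Real.exp_le_one_iff.2 (by linarith)
  have he0 := Real.exp_pos (-l)
  have hx0 : 0 ≤ x := by rw [hx]; nlinarith
  have hx1 : x ≤ 1 := by rw [hx]; nlinarith
  set B : ℝ := p ^ m * (Real.exp (l * K) * x ^ (n - (1 + d * m)).choose (d - 1)) ^ m with hB
  have hB0 : 0 ≤ B := by positivity
  have hchain : ∀ y : Fin n, ∀ ℓ ∈ chains (d := d) y m, (modelLaw d n p).real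
      {ω | (∀ S ∈ chainEdges ℓ, ω S ≠ ∅) ∧
        ∀ v ∈ chainVertices ℓ, freezeCount (explored y ℓ) v ω ≤ K} ≤ B := by
    intro y ℓ hℓ
    obtain ⟨-, h2, h3, h4, h5, h6⟩ := chains_spec hℓ
    refine (modelLaw_le hd h0 hp hl K h5 h6).trans ?_
    rw [h3, h4, hB]
    gcongr ?_ * (?_ * ?_) ^ m
    exact pow_le_pow_of_le_one hx0 hx1 (Nat.choose_le_choose _ (by omega))
  have hsub : {ω : Hyperedge d n → Finset (Clause n) | HasBadChain m K ω} =
      ⋃ y ∈ (Finset.univ : Finset (Fin n)), ⋃ ℓ ∈ chains (d := d) y m,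
        {ω | (∀ S ∈ chainEdges ℓ, ω S ≠ ∅) ∧
          ∀ v ∈ chainVertices ℓ, freezeCount (explored y ℓ) v ω ≤ K} := by
    ext ω
    simp only [HasBadChain, Set.mem_iUnion, Set.mem_ofPred_eq, Finset.mem_univ, exists_prop,
      true_and]
  rw [hsub]
  refine (measureReal_biUnion_finset_le _ _).trans ?_
  refine (Finset.sum_le_card_nsmul _ _ (((1 + d * m) * (n ^ (d - 1) * d)) ^ m * B)
    fun y _ => ?_).trans (by simp)
  refine (measureReal_biUnion_finset_le _ _).trans ?_
  refine (Finset.sum_le_card_nsmul _ _ B (hchain y)).trans ?_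
  rw [nsmul_eq_mul]
  refine mul_le_mul_of_nonneg_right ?_ hB0
  exact_mod_cast card_chains_le y m

/-- There are a vertex `x` and two pairs of overlapping hyperedges through `x`, all four of which
contribute clauses; the second members of the pairs may coincide. -/
def HasOverlaps (ω : Hyperedge d n → Finset (Clause n)) : Prop :=
  ∃ (x : Fin n) (Y₁ Y₂ Z₁ Z₂ : Hyperedge d n), (∀ S ∈ ({Y₁, Y₂, Z₁, Z₂} : Finset _), ω S ≠ ∅) ∧
    Y₁ ≠ Y₂ ∧ Z₁ ≠ Y₁ ∧ Z₁ ≠ Y₂ ∧ Z₂ ≠ Y₁ ∧ Z₂ ≠ Y₂ ∧ x ∈ Z₁.1 ∧ x ∈ Z₂.1 ∧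
    (∃ a ∈ Z₁.1, a ≠ x ∧ {x, a} ⊆ Y₁.1) ∧ (∃ a ∈ Z₂.1, a ≠ x ∧ {x, a} ⊆ Y₂.1)

open Classical in
/-- The hyperedges through `x` that meet `Z` outside of `x`. -/
noncomputable def overlapping (x : Fin n) (Z : Hyperedge d n) : Finset (Hyperedge d n) :=
  Finset.univ.filter fun Y => ∃ a ∈ Z.1, a ≠ x ∧ {x, a} ⊆ Y.1

theorem card_overlapping_le (x : Fin n) (Z : Hyperedge d n) :
    (overlapping x Z).card ≤ d * n ^ (d - 2) := by
  classical
  have hsub : overlapping x Z ⊆ (Z.1.erase x).biUnion fun a =>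
      Finset.univ.filter fun Y : Hyperedge d n => {x, a} ⊆ Y.1 := by
    intro Y hY
    obtain ⟨a, ha, hne, h⟩ := (Finset.mem_filter.1 hY).2
    exact Finset.mem_biUnion.2 ⟨a, Finset.mem_erase.2 ⟨hne, ha⟩, by simpa using h⟩
  refine (Finset.card_le_card hsub).trans ((Finset.card_biUnion_le_card_mul _ _ (n ^ (d - 2))
    fun a ha => ?_).trans (Nat.mul_le_mul_right _ ((Finset.card_erase_le).trans Z.2.le)))
  have := card_hyperedges_le (d := d) {x, a}
  rwa [Finset.card_pair (Finset.ne_of_mem_erase ha).symm] at this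

/-- The two terms are union bounds for coinciding and for distinct second members, with three or
four distinct hyperedges. Two pairs are needed: the analogous bound for one pair is of order log² n
and does not tend to 0. -/
theorem prob_hasOverlaps_le (hd : 2 ≤ d) {p : ℝ} (h0 : 0 ≤ p) (hp : p ≤ 1) :
    (modelLaw d n p).real {ω | HasOverlaps ω} ≤
      n * (n ^ (d - 1) * ((d * n ^ (d - 2)) * ((d * n ^ (d - 2)) * p ^ 3))) +
      n * (n ^ (d - 1) * (n ^ (d - 1) * ((d * n ^ (d - 2)) * ((d * n ^ (d - 2)) * p ^ 4)))) := by
  classical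
  have hprob : ∀ S : Hyperedge d n, IsProbabilityMeasure (hyperedgeLaw p S.1) := fun S =>
    isProbabilityMeasure_hyperedgeLaw (Finset.card_pos.1 (by rw [S.2]; omega)) hp
  have hmodel : IsProbabilityMeasure (modelLaw d n p) := by unfold modelLaw; infer_instance
  have hocc : ∀ T : Finset (Hyperedge d n),
      (modelLaw d n p).real {ω | ∀ S ∈ T, ω S ≠ ∅} ≤ p ^ T.card := by
    intro T
    -- With no vertex to be watched, the joint bound reduces to the probability that the hyperedges
    -- of `T` are present.
    have := modelLaw_le hd h0 hp (T := T) (W := ∅) (V := Finset.univ) le_rfl 0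
      (fun S _ => Finset.subset_univ _) (Finset.empty_subset _)
    simpa using this
  set N : Fin n → Finset (Hyperedge d n) := fun x =>
    Finset.univ.filter fun S => {x} ⊆ S.1 with hN
  have hNcard : ∀ x, ((N x).card : ℝ) ≤ (n : ℝ) ^ (d - 1) := fun x => by
    have := card_hyperedges_le (d := d) {x}
    rw [Finset.card_singleton] at this
    exact_mod_cast this
  have hOcard : ∀ x (Z : Hyperedge d n), ((overlapping x Z).card : ℝ) ≤ d * (n : ℝ) ^ (d - 2) :=
    fun x Z => by exact_mod_cast card_overlapping_le x Z
  have union : ∀ {β : Type} (s : Finset β) (f : β → Set (Hyperedge d n → Finset (Clause n)))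
      (c b : ℝ), 0 ≤ b → (s.card : ℝ) ≤ c → (∀ i ∈ s, (modelLaw d n p).real (f i) ≤ b) →
      (modelLaw d n p).real (⋃ i ∈ s, f i) ≤ c * b := by
    intro β s f c b hb hc hf
    refine (measureReal_biUnion_finset_le _ _).trans ((Finset.sum_le_card_nsmul _ _ b hf).trans ?_)
    rw [nsmul_eq_mul]
    exact mul_le_mul_of_nonneg_right hc hb
  set E₁ : Set (Hyperedge d n → Finset (Clause n)) :=
    ⋃ x ∈ (Finset.univ : Finset (Fin n)), ⋃ Z ∈ N x, ⋃ Y₁ ∈ overlapping x Z,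
      ⋃ Y₂ ∈ overlapping x Z,
        {ω | Y₁ ≠ Y₂ ∧ Z ≠ Y₁ ∧ Z ≠ Y₂ ∧ ∀ S ∈ ({Y₁, Y₂, Z} : Finset _), ω S ≠ ∅} with hE₁
  set E₂ : Set (Hyperedge d n → Finset (Clause n)) :=
    ⋃ x ∈ (Finset.univ : Finset (Fin n)), ⋃ Z₁ ∈ N x, ⋃ Z₂ ∈ N x, ⋃ Y₁ ∈ overlapping x Z₁,
      ⋃ Y₂ ∈ overlapping x Z₂,
        {ω | (Y₁ ≠ Y₂ ∧ Z₁ ≠ Y₁ ∧ Z₁ ≠ Y₂ ∧ Z₂ ≠ Y₁ ∧ Z₂ ≠ Y₂ ∧ Z₁ ≠ Z₂) ∧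
          ∀ S ∈ ({Y₁, Y₂, Z₁, Z₂} : Finset _), ω S ≠ ∅} with hE₂
  have hsub : {ω | HasOverlaps ω} ⊆ E₁ ∪ E₂ := by
    rintro ω ⟨x, Y₁, Y₂, Z₁, Z₂, hω, h1, h2, h3, h4, h5, hx1, hx2, ho1, ho2⟩
    by_cases hZ : Z₁ = Z₂
    · subst hZ
      left
      simp only [hE₁, Set.mem_iUnion]
      refine ⟨x, Finset.mem_univ _, Z₁, by simpa [hN] using hx1, Y₁, by simpa [overlapping] using ho1,
        Y₂, by simpa [overlapping] using ho2, h1, h2, h3, fun S hS => hω S ?_⟩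
      simpa using hS
    · right
      simp only [hE₂, Set.mem_iUnion]
      exact ⟨x, Finset.mem_univ _, Z₁, by simpa [hN] using hx1, Z₂, by simpa [hN] using hx2, Y₁,
        by simpa [overlapping] using ho1, Y₂, by simpa [overlapping] using ho2,
        ⟨h1, h2, h3, h4, h5, hZ⟩, hω⟩
  refine (measureReal_mono hsub).trans ((measureReal_union_le _ _).trans (add_le_add ?_ ?_))
  · refine union _ _ _ _ (by positivity) (by simp) fun x _ => ?_
    refine union _ _ _ _ (by positivity) (hNcard x) fun Z _ => ?_
    refine union _ _ _ _ (by positivity) (hOcard x Z) fun Y₁ _ => ?_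
    refine union _ _ _ _ (by positivity) (hOcard x Z) fun Y₂ _ => ?_
    by_cases h : Y₁ ≠ Y₂ ∧ Z ≠ Y₁ ∧ Z ≠ Y₂
    · refine (measureReal_mono (fun ω hω => hω.2.2.2)).trans ((hocc {Y₁, Y₂, Z}).trans_eq ?_)
      rw [Finset.card_eq_three.2 ⟨Y₁, Y₂, Z, h.1, h.2.1.symm, h.2.2.symm, rfl⟩]
    · have : {ω : Hyperedge d n → Finset (Clause n) | Y₁ ≠ Y₂ ∧ Z ≠ Y₁ ∧ Z ≠ Y₂ ∧
          ∀ S ∈ ({Y₁, Y₂, Z} : Finset _), ω S ≠ ∅} = ∅ := by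
        ext ω; simp only [Set.mem_ofPred_eq, Set.mem_empty_iff_false, iff_false]; tauto
      rw [this, measureReal_empty]; positivity
  · refine union _ _ _ _ (by positivity) (by simp) fun x _ => ?_
    refine union _ _ _ _ (by positivity) (hNcard x) fun Z₁ _ => ?_
    refine union _ _ _ _ (by positivity) (hNcard x) fun Z₂ _ => ?_
    refine union _ _ _ _ (by positivity) (hOcard x Z₁) fun Y₁ _ => ?_
    refine union _ _ _ _ (by positivity) (hOcard x Z₂) fun Y₂ _ => ?_
    by_cases h : Y₁ ≠ Y₂ ∧ Z₁ ≠ Y₁ ∧ Z₁ ≠ Y₂ ∧ Z₂ ≠ Y₁ ∧ Z₂ ≠ Y₂ ∧ Z₁ ≠ Z₂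
    · refine (measureReal_mono (fun ω hω => hω.2)).trans ((hocc {Y₁, Y₂, Z₁, Z₂}).trans_eq ?_)
      obtain ⟨h1, h2, h3, h4, h5, h6⟩ := h
      rw [Finset.card_insert_of_notMem (by simp [h1, h2.symm, h4.symm]),
        Finset.card_eq_three.2 ⟨Y₂, Z₁, Z₂, h3.symm, h5.symm, h6, rfl⟩]
    · have : {ω : Hyperedge d n → Finset (Clause n) | (Y₁ ≠ Y₂ ∧ Z₁ ≠ Y₁ ∧ Z₁ ≠ Y₂ ∧ Z₂ ≠ Y₁ ∧
          Z₂ ≠ Y₂ ∧ Z₁ ≠ Z₂) ∧ ∀ S ∈ ({Y₁, Y₂, Z₁, Z₂} : Finset _), ω S ≠ ∅} = ∅ := by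
        ext ω; simp only [Set.mem_ofPred_eq, Set.mem_empty_iff_false, iff_false]; tauto
      rw [this, measureReal_empty]; positivity

end chains


/-! ### Large components contain chains -/

section components

variable {d n : ℕ} {ω : Hyperedge d n → Finset (Clause n)}

/-- All hyperedges make possible contributions. -/
def IsValid (ω : Hyperedge d n → Finset (Clause n)) : Prop := ∀ S, ValidAt S.1 (ω S)

theorem mem_modelFormula {C : Clause n} : C ∈ modelFormula ω ↔ ∃ S, C ∈ ω S := by
  simp [modelFormula]

theorem IsValid.eq_singleton (hω : IsValid ω) {S : Hyperedge d n} {C : Clause n} (h : C ∈ ω S) :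
    ω S = {C} ∧ C ∈ nonMonotoneClauses S.1 := by
  rcases hω S with h0 | ⟨C', hC', h1⟩
  · rw [h0] at h; simp at h
  · rw [h1] at h
    obtain rfl := Finset.mem_singleton.1 h
    exact ⟨h1, hC'⟩

theorem IsValid.vars_eq (hω : IsValid ω) {S : Hyperedge d n} {C : Clause n} (h : C ∈ ω S) :
    C.vars = S.1 := (Finset.mem_filter.1 (hω.eq_singleton h).2).2.1

theorem IsValid.isDCNF (hω : IsValid ω) : IsDCNF d (modelFormula ω) := by
  intro C hC
  obtain ⟨S, hS⟩ := mem_modelFormula.1 hC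
  rw [(Finset.mem_filter.1 (hω.eq_singleton hS).2).2.2.1, S.2]

theorem vars_freezingClause (x : Fin n) (Y : Finset (Fin n)) :
    (freezingClause x Y).vars = insert x Y := by
  ext y
  simp only [Clause.vars, Finset.mem_image, Prod.exists, mem_freezingClause, Finset.mem_insert]
  constructor
  · rintro ⟨y', σ, ⟨rfl, -⟩ | ⟨h, -⟩, rfl⟩
    · exact Or.inl rfl
    · exact Or.inr h
  · rintro (rfl | h)
    · exact ⟨y, false, Or.inl ⟨rfl, rfl⟩, rfl⟩
    · exact ⟨y, true, Or.inr ⟨h, rfl⟩, rfl⟩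

/-- If there are no overlaps, then small maximal families of freezing clauses exist only for
variables that have few freezing clauses. -/
theorem freezeCount_le (hω : IsValid ω) (hB : ¬ HasOverlaps ω) {K : ℕ} {v : Fin n}
    (hv : HasSmallMaximalFamily K (modelFormula ω) v) (V : Finset (Fin n)) :
    freezeCount V v ω ≤ K := by
  classical
  by_contra hlt
  push Not at hlt
  obtain ⟨𝓜, hcard, hM, hmax⟩ := hv
  set 𝓕 : Finset (Hyperedge d n) := Finset.univ.filter fun S => Freezes V v S (ω S) with hF
  have hF' : K < 𝓕.card := by
    refine hlt.trans_le (le_of_eq ?_)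
    unfold freezeCount; congr!
  have hmem : ∀ S ∈ 𝓕, v ∈ S.1 ∧ ω S = {freezingClause v (S.1.erase v)} := by
    intro S hS
    have h := (Finset.mem_filter.1 hS).2
    have : v ∈ S.1 ∩ V := by rw [h.1]; simp
    exact ⟨(Finset.mem_inter.1 this).1, h.2⟩
  set 𝓨 := 𝓕.image fun S => S.1.erase v with hY
  have hYcard : 𝓨.card = 𝓕.card := by
    refine Finset.card_image_of_injOn fun S hS S' hS' he => Subtype.ext ?_
    rw [← Finset.insert_erase (hmem S hS).1, ← Finset.insert_erase (hmem S' hS').1]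
    exact congrArg (insert v) he
  -- More than K freezing sets against fewer than K members of the maximal family leave at least two
  -- sets outside; by maximality, each of them overlaps a member.
  have h2 : 1 < (𝓨 \ 𝓜).card := by
    have := Finset.le_card_sdiff 𝓜 𝓨
    omega
  have hexM : ∀ Z ∈ 𝓜, ∃ S : Hyperedge d n, S.1 = insert v Z ∧ v ∉ Z ∧ ω S ≠ ∅ := by
    intro Z hZ
    obtain ⟨h3, h4⟩ := hM Z hZ
    obtain ⟨S, hS⟩ := mem_modelFormula.1 h4
    refine ⟨S, ?_, h3, fun h => by rw [h] at hS; simp at hS⟩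
    rw [← hω.vars_eq hS, vars_freezingClause]
  have hexY : ∀ Y ∈ 𝓨 \ 𝓜, ∃ S Z : Hyperedge d n, S.1 = insert v Y ∧ v ∉ Y ∧ ω S ≠ ∅ ∧ ω Z ≠ ∅ ∧
      v ∈ Z.1 ∧ Z.1.erase v ∈ 𝓜 ∧ ∃ a ∈ Z.1, a ≠ v ∧ {v, a} ⊆ S.1 := by
    intro Y hYm
    obtain ⟨hY1, hY2⟩ := Finset.mem_sdiff.1 hYm
    obtain ⟨S, hS, rfl⟩ := Finset.mem_image.1 hY1
    obtain ⟨h3, h4⟩ := hmem S hS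
    have h5 : v ∉ S.1.erase v := Finset.notMem_erase v S.1
    have h6 : freezingClause v (S.1.erase v) ∈ modelFormula ω :=
      mem_modelFormula.2 ⟨S, by rw [h4]; simp⟩
    rcases hmax _ h5 h6 with h7 | ⟨Z, hZ, h7⟩
    · exact absurd h7 hY2
    · obtain ⟨S', hS', hvZ, hne⟩ := hexM Z hZ
      obtain ⟨a, ha, ha'⟩ := Finset.not_disjoint_iff.1 h7
      refine ⟨S, S', (Finset.insert_erase h3).symm, h5, by rw [h4]; simp, hne, by simp [hS'],
        by rw [hS', Finset.erase_insert hvZ]; exact hZ, a, by simp [hS', ha],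
        Finset.ne_of_mem_erase ha', ?_⟩
      intro z hz
      rcases Finset.mem_insert.1 hz with rfl | hz
      · exact h3
      · rw [Finset.mem_singleton.1 hz]; exact Finset.mem_of_mem_erase ha'
  obtain ⟨Y₁, hY₁, Y₂, hY₂, hne⟩ := Finset.one_lt_card.1 h2
  obtain ⟨S₁, Z₁, a1, a2, a3, a4, a5, a6, a7⟩ := hexY Y₁ hY₁
  obtain ⟨S₂, Z₂, b1, b2, b3, b4, b5, b6, b7⟩ := hexY Y₂ hY₂
  have e₁ : S₁.1.erase v = Y₁ := by rw [a1, Finset.erase_insert a2]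
  have e₂ : S₂.1.erase v = Y₂ := by rw [b1, Finset.erase_insert b2]
  have n₁ := (Finset.mem_sdiff.1 hY₁).2
  have n₂ := (Finset.mem_sdiff.1 hY₂).2
  refine hB ⟨v, S₁, S₂, Z₁, Z₂, ?_, ?_, ?_, ?_, ?_, ?_, a5, b5, a7, b7⟩
  · intro S hS
    simp only [Finset.mem_insert, Finset.mem_singleton] at hS
    rcases hS with rfl | rfl | rfl | rfl <;> assumption
  · rintro rfl; exact hne (e₁.symm.trans e₂)
  · rintro rfl; exact n₁ (e₁ ▸ a6)
  · rintro rfl; exact n₂ (e₂ ▸ a6)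
  · rintro rfl; exact n₁ (e₁ ▸ b6)
  · rintro rfl; exact n₂ (e₂ ▸ b6)

theorem not_forced_of_mem_reduce {F : Formula n} {U : Finset (Fin n)} {C : Clause n}
    (hC : C ∈ reduce F U) : ∃ C' ∈ F, C.vars ⊆ C'.vars ∧ ∀ x ∈ C.vars, ¬ Forced F U x := by
  classical
  simp only [reduce, Finset.mem_image, Finset.mem_filter] at hC
  obtain ⟨C', ⟨hC', -⟩, rfl⟩ := hC
  refine ⟨C', hC', Finset.image_subset_image (Finset.filter_subset _ _), fun x hx => ?_⟩
  obtain ⟨l, hl, rfl⟩ := Finset.mem_image.1 hx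
  exact (Finset.mem_filter.1 hl).2

/-- A chain of fewer than m steps reaches at most 1 + d m vertices, fewer than the component has, so
it can be extended inside the component. The new vertices survive unit propagation, hence lie
outside `U` and have few freezing clauses. -/
theorem hasBadChain_of_largeComponent (hω : IsValid ω) (hB : ¬ HasOverlaps ω) {K m : ℕ}
    {U : Finset (Fin n)} (hU : ∀ x ∉ U, HasSmallMaximalFamily K (modelFormula ω) x)
    (hm : (1 + d * m : ℝ) ≤ Real.logb 2 n)
    (hlarge : HasLargeComponent (reduce (modelFormula ω) U)) : HasBadChain m K ω := by
  classical
  obtain ⟨-, -, x, -, hx⟩ := hlarge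
  set G := residualGraph (reduce (modelFormula ω) U) with hG
  have hcard : 1 + d * m < (G.connectedComponentMk x).supp.ncard := by
    have := hm.trans_lt hx
    exact_mod_cast this
  have key : ∀ i ≤ m, ∃ ℓ ∈ chains (d := d) x i, (∀ S ∈ chainEdges ℓ, ω S ≠ ∅) ∧
      ∀ v ∈ chainVertices ℓ, v ∉ U := by
    intro i
    induction i with
    | zero => intro _; exact ⟨[], by simp [chains], by simp [chainEdges], by simp [chainVertices]⟩
    | succ i ih =>
      intro hi
      obtain ⟨ℓ, hℓ, h1, h2⟩ := ih (by omega)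
      obtain ⟨hx0, hle, -⟩ := chains_spec hℓ
      have hlt : (explored x ℓ : Set (Fin n)).ncard < (G.connectedComponentMk x).supp.ncard := by
        rw [Set.ncard_coe_finset]
        have := Nat.mul_le_mul_left d (show i ≤ m by omega)
        omega
      obtain ⟨z, hz, hz'⟩ := Set.exists_mem_notMem_of_ncard_lt_ncard hlt (Set.toFinite _)
      rw [SimpleGraph.ConnectedComponent.mem_supp_iff, SimpleGraph.ConnectedComponent.eq] at hz
      obtain ⟨p⟩ := hz.symm
      -- A walk from `x` to an unreached vertex of the component leaves the explored set along some
      -- edge, and the clause behind this edge gives the next hyperedge.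
      obtain ⟨e, -, he1, he2⟩ := p.exists_boundary_dart _ (Finset.mem_coe.2 hx0) hz'
      obtain ⟨-, C, hC, hC1, hC2⟩ := e.adj
      obtain ⟨C', hC', hsub, hforced⟩ := not_forced_of_mem_reduce hC
      obtain ⟨S, hS⟩ := mem_modelFormula.1 hC'
      have hvars := hω.vars_eq hS
      refine ⟨(S, e.snd) :: ℓ, mem_chains_succ.2 ⟨ℓ, hℓ, (S, e.snd), ?_, rfl⟩, ?_, ?_⟩
      · exact Finset.mem_filter.2 ⟨Finset.mem_univ _, hvars ▸ hsub hC2, he2, e.fst,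
          Finset.mem_inter.2 ⟨hvars ▸ hsub hC1, he1⟩⟩
      · intro S' hS'
        simp only [chainEdges, List.map_cons, List.toFinset_cons, Finset.mem_insert] at hS'
        rcases hS' with rfl | hS'
        · intro h; rw [h] at hS; simp at hS
        · exact h1 S' hS'
      · intro v hv
        simp only [chainVertices, List.map_cons, List.toFinset_cons, Finset.mem_insert] at hv
        rcases hv with rfl | hv
        · exact fun h => hforced _ hC2 (.base _ h)
        · exact h2 v hv
  obtain ⟨ℓ, hℓ, h1, h2⟩ := key m le_rfl
  exact ⟨x, ℓ, hℓ, h1, fun v hv => freezeCount_le hω hB (hU v (h2 v hv)) _⟩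

end components


/-! ### The random formula is solved with high probability -/

section asymptotics

theorem modelLaw_not_isValid {d n : ℕ} (hd : 1 ≤ d) {p : ℝ} (hp : p ≤ 1) :
    modelLaw d n p {ω | ¬ IsValid ω} = 0 := by
  have hprob : ∀ S : Hyperedge d n, IsProbabilityMeasure (hyperedgeLaw p S.1) := fun S =>
    isProbabilityMeasure_hyperedgeLaw (Finset.card_pos.1 (by rw [S.2]; omega)) hp
  have : ∀ᵐ ω ∂modelLaw d n p, ∀ S, ValidAt S.1 (ω S) := by
    refine ae_all_iff.2 fun S => ?_
    have h : ∀ᵐ w ∂hyperedgeLaw p S.1, ValidAt S.1 w := hyperedgeLaw_not_validAt hp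
    exact (Measure.tendsto_eval_ae_ae (μ := fun S : Hyperedge d n => hyperedgeLaw p S.1)
      (i := S)).eventually h
  exact this

theorem tendsto_choose_sub_div_pow (a r : ℕ) :
    Tendsto (fun n : ℕ => ((n - a).choose r : ℝ) / (n : ℝ) ^ r) atTop (𝓝 (1 / r.factorial)) := by
  have h1 : Tendsto (fun n : ℕ => ((n.choose r : ℕ) : ℝ) / (n : ℝ) ^ r) atTop
      (𝓝 (1 / r.factorial)) := by
    have h := (isEquivalent_choose r).div (Asymptotics.IsEquivalent.refl
      (u := fun n : ℕ => (n : ℝ) ^ r) (l := atTop))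
    refine h.tendsto_nhds_iff.2 (tendsto_const_nhds.congr' ?_)
    filter_upwards [eventually_ge_atTop 1] with n hn
    have : (n : ℝ) ≠ 0 := by norm_cast; omega
    simp only [Pi.div_apply]
    field_simp
  have h2 : Tendsto (fun n : ℕ => ((n - a : ℕ) : ℝ) / n) atTop (𝓝 1) := by
    have h3 : Tendsto (fun n : ℕ => 1 - (a : ℝ) / n) atTop (𝓝 (1 - 0)) :=
      tendsto_const_nhds.sub (tendsto_const_div_atTop_nhds_zero_nat _)
    rw [sub_zero] at h3
    refine h3.congr' ?_
    filter_upwards [eventually_ge_atTop (a + 1)] with n hn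
    have : (n : ℝ) ≠ 0 := by norm_cast; omega
    rw [Nat.cast_sub (by omega)]
    field_simp
  have h3 := (h1.comp (tendsto_sub_atTop_nat a)).mul (h2.pow r)
  rw [one_pow, mul_one] at h3
  refine h3.congr' ?_
  filter_upwards [eventually_ge_atTop (a + 1)] with n hn
  have h4 : ((n - a : ℕ) : ℝ) ≠ 0 := by norm_cast; omega
  have h5 : (n : ℝ) ≠ 0 := by norm_cast; omega
  simp only [Function.comp_apply, div_pow]
  field_simp

theorem tendsto_logb_natCast : Tendsto (fun n : ℕ => Real.logb 2 n) atTop atTop :=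
  (Real.tendsto_logb_atTop one_lt_two).comp tendsto_natCast_atTop_atTop

theorem tendsto_logb_pow_div (C : ℝ) (m : ℕ) :
    Tendsto (fun n : ℕ => C * Real.logb 2 n ^ m / n) atTop (𝓝 0) := by
  have h := (Real.isLittleO_pow_log_id_atTop (n := m)).tendsto_div_nhds_zero.comp
    (tendsto_natCast_atTop_atTop (R := ℝ))
  have h2 := h.const_mul (C / Real.log 2 ^ m)
  rw [mul_zero] at h2
  refine h2.congr fun n => ?_
  simp only [Function.comp_apply, Real.logb, div_pow, id]
  ring

/-- The exponential rate at which a vertex of a chain becomes frozen. -/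
theorem exists_rate {d k : ℕ} (hd : 2 ≤ d) (hk : 1 ≤ k) {c : ℝ}
    (hc : (k : ℝ) * (2 ^ d - 1) * ((d - 1).factorial : ℝ) < c) :
    ∃ l δ : ℝ, 0 ≤ l ∧ 0 < δ ∧
      l * k + δ < c / (2 ^ d - 1) * (1 - Real.exp (-l)) * (1 / (d - 1).factorial) := by
  have h2d : (0 : ℝ) < 2 ^ d - 1 := by
    have : (2 : ℝ) ^ 1 ≤ 2 ^ d := pow_le_pow_right₀ (by norm_num) (by omega)
    linarith
  have hf : (0 : ℝ) < (d - 1).factorial := by positivity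
  have hk0 : (0 : ℝ) < k := by positivity
  set κ : ℝ := c / (2 ^ d - 1) * (1 / (d - 1).factorial) with hκ
  have hκk : (k : ℝ) < κ := by
    rw [hκ, div_mul_div_comm, mul_one, lt_div_iff₀ (by positivity)]
    linarith
  -- With this choice κ = k (1 + 2l). As 1 - exp (-l) ≥ l / (1 + l), the gain κ (1 - exp (-l)) is at
  -- least k l (1 + 2l) / (1 + l), which exceeds k l.
  obtain ⟨l, hl⟩ : ∃ l : ℝ, l = (κ / k - 1) / 2 := ⟨_, rfl⟩
  have hl0 : 0 < l := by
    have : 1 < κ / k := (one_lt_div hk0).2 hκk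
    linarith
  have hlk : κ = k * (1 + 2 * l) := by rw [hl]; field_simp; ring
  have hexp : Real.exp (-l) ≤ 1 / (1 + l) := by
    rw [Real.exp_neg, inv_eq_one_div]
    exact one_div_le_one_div_of_le (by positivity) (by linarith [Real.add_one_le_exp l])
  have hkey : l * k < κ * (1 - Real.exp (-l)) := by
    have h1 : l / (1 + l) ≤ 1 - Real.exp (-l) := by
      have : l / (1 + l) = 1 - 1 / (1 + l) := by field_simp; ring
      linarith
    refine lt_of_lt_of_le ?_ (mul_le_mul_of_nonneg_left h1 (hk0.trans hκk).le)
    rw [hlk, mul_div_assoc', lt_div_iff₀ (by positivity)]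
    nlinarith [mul_pos (mul_pos hl0 hl0) hk0]
  refine ⟨l, (κ * (1 - Real.exp (-l)) - l * k) / 2, hl0.le, by linarith, ?_⟩
  have : c / (2 ^ d - 1) * (1 - Real.exp (-l)) * (1 / (d - 1).factorial) =
      κ * (1 - Real.exp (-l)) := by rw [hκ]; ring
  linarith

/-- The edge probability of the random model. -/
noncomputable def edgeProb (d : ℕ) (c : ℝ) (n : ℕ) : ℝ :=
  c * Real.logb 2 n / (n : ℝ) ^ (d - 1)

theorem edgeProb_nonneg (d : ℕ) {c : ℝ} (hc : 0 ≤ c) {n : ℕ} (hn : 1 ≤ n) :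
    0 ≤ edgeProb d c n :=
  div_nonneg (mul_nonneg hc (Real.logb_nonneg one_lt_two (by exact_mod_cast hn))) (by positivity)

theorem eventually_edgeProb_le_one {d : ℕ} (hd : 2 ≤ d) {c : ℝ} (hc : 0 ≤ c) :
    ∀ᶠ n in atTop, edgeProb d c n ≤ 1 := by
  filter_upwards [(tendsto_logb_pow_div c 1).eventually_le_const one_pos, eventually_ge_atTop 1]
    with n h hn
  refine le_trans ?_ h
  rw [pow_one]
  have hn' : (1 : ℝ) ≤ n := by exact_mod_cast hn
  exact div_le_div_of_nonneg_left (mul_nonneg hc (Real.logb_nonneg one_lt_two hn')) (by positivity)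
    (le_self_pow₀ hn' (by omega))

theorem miniWeight_le_mul_logb (k : ℕ) {n : ℕ} (hn : 1 ≤ n) :
    (miniWeight k n : ℝ) ≤ k * Real.logb 2 n :=
  Nat.floor_le (mul_nonneg k.cast_nonneg (Real.logb_nonneg one_lt_two (by exact_mod_cast hn)))

/-- In both terms of the union bound the powers of n cancel to 1/n, leaving log³ n / n and log⁴ n /
n up to constants. -/
theorem tendsto_prob_hasOverlaps {d : ℕ} (hd : 2 ≤ d) {c : ℝ} (hc : 0 ≤ c) :
    Tendsto (fun n => (modelLaw d n (edgeProb d c n)).real {ω | HasOverlaps ω}) atTop (𝓝 0) := by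
  have h := (tendsto_logb_pow_div (d ^ 2 * c ^ 3) 3).add (tendsto_logb_pow_div (d ^ 2 * c ^ 4) 4)
  rw [add_zero] at h
  refine tendsto_of_tendsto_of_tendsto_of_le_of_le' tendsto_const_nhds h
    (Eventually.of_forall fun n => measureReal_nonneg) ?_
  filter_upwards [eventually_edgeProb_le_one hd hc, eventually_ge_atTop 1] with n hp hn
  refine (prob_hasOverlaps_le hd (edgeProb_nonneg d hc hn) hp).trans_eq ?_
  obtain ⟨e, rfl⟩ : ∃ e, d = e + 2 := ⟨d - 2, by omega⟩
  have hn0 : (n : ℝ) ≠ 0 := by norm_cast; omega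
  simp only [edgeProb, Nat.add_sub_cancel, show e + 2 - 1 = e + 1 by omega, pow_succ]
  field_simp

/-- Counting and presence of the chains cost n times a power of log n, while each of the m new
vertices gains exp (-δ log₂ n). A constant length m therefore outweighs the choice of the starting
vertex. -/
theorem exists_tendsto_prob_hasBadChain {d k : ℕ} (hd : 2 ≤ d) (hk : 1 ≤ k) {c : ℝ}
    (hc : (k : ℝ) * (2 ^ d - 1) * ((d - 1).factorial : ℝ) < c) :
    ∃ m : ℕ, Tendsto (fun n => (modelLaw d n (edgeProb d c n)).real
      {ω | HasBadChain m (miniWeight k n) ω}) atTop (𝓝 0) := by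
  obtain ⟨l, δ, hl, hδ, hrate⟩ := exists_rate hd hk hc
  have h2d : (1 : ℝ) ≤ 2 ^ d - 1 := by
    have : (2 : ℝ) ^ 1 ≤ 2 ^ d := pow_le_pow_right₀ (by norm_num) (by omega)
    linarith
  have hc0 : 0 ≤ c := le_trans (by positivity) hc.le
  -- This makes the gain of all m vertices together at least n², one factor n more than the number
  -- of starting vertices.
  obtain ⟨m, hm⟩ := exists_nat_ge (2 / δ)
  rw [div_le_iff₀ hδ] at hm
  have hθ : 0 ≤ 1 - Real.exp (-l) := by
    have : Real.exp (-l) ≤ 1 := Real.exp_le_one_iff.2 (by linarith)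
    linarith
  refine ⟨m, tendsto_of_tendsto_of_tendsto_of_le_of_le' tendsto_const_nhds
    (tendsto_logb_pow_div (((1 + d * m) * d * c) ^ m) m)
    (Eventually.of_forall fun n => measureReal_nonneg) ?_⟩
  have hchoose := ((tendsto_choose_sub_div_pow (1 + d * m) (d - 1)).const_mul
    (c / (2 ^ d - 1) * (1 - Real.exp (-l)))).eventually_const_lt hrate
  filter_upwards [eventually_edgeProb_le_one hd hc0, eventually_ge_atTop 1, hchoose] with n hp hn hN
  have hn1 : (1 : ℝ) ≤ n := by exact_mod_cast hn
  have hn0 : (0 : ℝ) < n := by linarith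
  have h0 := edgeProb_nonneg d hc0 hn
  refine (prob_hasBadChain_le hd h0 hp hl m (miniWeight k n)).trans ?_
  set Λ : ℝ := Real.logb 2 n with hΛ
  have hΛ0 : 0 ≤ Λ := Real.logb_nonneg one_lt_two hn1
  set N := (n - (1 + d * m)).choose (d - 1) with hNdef
  set p := edgeProb d c n with hpdef
  have hx0 : 0 ≤ 1 - p / (2 ^ d - 1) * (1 - Real.exp (-l)) := by
    have h1 : p / (2 ^ d - 1) ≤ 1 := (div_le_one (by linarith)).2 (hp.trans h2d)
    have h2 : p / (2 ^ d - 1) * (1 - Real.exp (-l)) ≤ 1 :=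
      mul_le_one₀ h1 hθ (by linarith [Real.exp_pos (-l)])
    linarith
  have hE : Real.exp (l * miniWeight k n) *
      (1 - p / (2 ^ d - 1) * (1 - Real.exp (-l))) ^ N ≤ Real.exp (-(δ * Λ)) := by
    calc _ ≤ Real.exp (l * miniWeight k n) *
          Real.exp (-(p / (2 ^ d - 1) * (1 - Real.exp (-l)))) ^ N := by
            gcongr
            exact Real.one_sub_le_exp_neg _
      _ = Real.exp (l * miniWeight k n -
            Λ * (c / (2 ^ d - 1) * (1 - Real.exp (-l)) * (N / (n : ℝ) ^ (d - 1)))) := by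
          rw [← Real.exp_nat_mul, ← Real.exp_add, hpdef, edgeProb]
          congr 1
          ring
      _ ≤ _ := by
          rw [Real.exp_le_exp]
          have h1 := mul_le_mul_of_nonneg_left (miniWeight_le_mul_logb k hn) hl
          have h2 := mul_le_mul_of_nonneg_left hN.le hΛ0
          rw [← hΛ] at h1
          linarith
  have hE0 : 0 ≤ Real.exp (l * miniWeight k n) *
      (1 - p / (2 ^ d - 1) * (1 - Real.exp (-l))) ^ N := by positivity
  have hEm : (Real.exp (l * miniWeight k n) *
      (1 - p / (2 ^ d - 1) * (1 - Real.exp (-l))) ^ N) ^ m ≤ 1 / (n : ℝ) ^ 2 := by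
    refine (pow_le_pow_left₀ hE0 hE m).trans ?_
    -- Since ln 2 < 1, passing from the binary to the natural logarithm only weakens the bound.
    have hlog : Real.log n ≤ Λ := by
      rw [hΛ, Real.logb, le_div_iff₀ (Real.log_pos one_lt_two)]
      have := Real.log_nonneg hn1
      nlinarith [Real.log_two_lt_d9]
    rw [one_div, ← Real.exp_log hn0, ← Real.exp_nat_mul, ← Real.exp_nat_mul, ← Real.exp_neg,
      Real.exp_le_exp]
    push_cast
    nlinarith [Real.log_nonneg hn1]
  calc _ ≤ (n : ℝ) * (((1 + d * m) * (n ^ (d - 1) * d)) ^ m * (p ^ m * (1 / (n : ℝ) ^ 2))) := by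
        gcongr
    _ = n * (((1 + d * m) * d) * (n ^ (d - 1) * p)) ^ m * (1 / (n : ℝ) ^ 2) := by
        rw [← mul_assoc (_ ^ m) (p ^ m), ← mul_pow]
        ring
    _ = _ := by
        have : (n : ℝ) ^ (d - 1) * p = c * Λ := by
          rw [hpdef, edgeProb, hΛ]
          field_simp
        rw [this, ← mul_assoc, mul_pow]
        field_simp

end asymptotics

end MiniSat

open MiniSat in
theorem mainTheorem3 (d : ℕ) (hd : 2 ≤ d) :
    ∃ (P : MiniSat.Program) (A B : ℕ),
      -- on every instance: the time bound, no wrong answers, and the W-SAT failure rule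
      (∀ n k : ℕ, 1 ≤ n → 1 ≤ k → ∀ F : MiniSat.Formula n, MiniSat.IsDCNF d F →
        ∀ L : List (List (MiniSat.Literal n)), MiniSat.Lists L F →
          ∃ (t : ℕ) (s : MiniSat.State),
            MiniSat.Runs P (MiniSat.inputState k L) t s ∧
            t ≤ A * (k ^ 2 * n + n ^ B) ∧
            (s.answer n ≠ MiniSat.Answer.failure →
              (s.answer n).Solves F (MiniSat.miniWeight k n)) ∧
            ∃ U : Finset (Fin n),
              (∀ x ∈ U, MiniSat.IsFrozen d (MiniSat.miniWeight k n) F x) ∧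
              (s.answer n = MiniSat.Answer.failure ↔
                MiniSat.HasLargeComponent (MiniSat.reduce F U))) ∧
      -- on random instances: success with high probability
      (∀ k : ℕ, 1 ≤ k → ∀ c : ℝ, (k : ℝ) * (2 ^ d - 1) * ((d - 1).factorial : ℝ) < c →
        Tendsto
          (fun n : ℕ =>
            MiniSat.modelLaw d n (c * Real.logb 2 n / (n : ℝ) ^ (d - 1))
              {ω | ∀ L : List (List (MiniSat.Literal n)),
                MiniSat.Lists L (MiniSat.modelFormula ω) →
                  ∃ (t : ℕ) (s : MiniSat.State),
                    MiniSat.Runs P (MiniSat.inputState k L) t s ∧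
                    (s.answer n).Solves (MiniSat.modelFormula ω) (MiniSat.miniWeight k n)})
          atTop (𝓝 1)) := by
  obtain ⟨P, A, B, hP⟩ := exists_algorithm d (by omega)
  refine ⟨P, A, B, fun n k hn _ F hF L hL => ?_, fun k hk c hc => ?_⟩
  · obtain ⟨t, s, hrun, ht, hsol, U, hU, hfail, -⟩ := hP n k hn F hF L hL
    -- The running time is already at most A n^B, uniformly in k, so the term k² n is simply added.
    exact ⟨t, s, hrun, ht.trans (Nat.mul_le_mul_left _ (Nat.le_add_left _ _)), hsol, U, hU, hfail⟩
  have hc0 : 0 ≤ c := by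
    have : (2 : ℝ) ^ 1 ≤ 2 ^ d := pow_le_pow_right₀ (by norm_num) (by omega)
    have : (0 : ℝ) ≤ 2 ^ d - 1 := by linarith
    exact le_trans (by positivity) hc.le
  obtain ⟨m, hm⟩ := exists_tendsto_prob_hasBadChain hd hk hc
  have hbad := ENNReal.tendsto_ofReal ((tendsto_prob_hasOverlaps hd hc0).add hm)
  rw [add_zero, ENNReal.ofReal_zero] at hbad
  have hone := ENNReal.Tendsto.sub (tendsto_const_nhds (x := (1 : ENNReal))) hbad (by simp)
  rw [tsub_zero] at hone
  have hweight : ∀ᶠ n : ℕ in atTop, miniWeight k n ≤ n := by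
    filter_upwards [(tendsto_logb_pow_div k 1).eventually_le_const one_pos, eventually_ge_atTop 1]
      with n h hn
    rw [pow_one, div_le_one (by positivity)] at h
    exact_mod_cast (miniWeight_le_mul_logb k hn).trans h
  have hev := (eventually_edgeProb_le_one hd hc0).and (hweight.and
    ((tendsto_logb_natCast.eventually_ge_atTop (1 + d * m : ℝ)).and (eventually_ge_atTop 1)))
  refine tendsto_of_tendsto_of_tendsto_of_le_of_le' hone tendsto_const_nhds ?_ ?_
  · filter_upwards [hev] with n ⟨hp, hK, hlog, hn⟩
    have hprob : ∀ S : Hyperedge d n,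
        MeasureTheory.IsProbabilityMeasure (hyperedgeLaw (edgeProb d c n) S.1) := fun S =>
      isProbabilityMeasure_hyperedgeLaw (Finset.card_pos.1 (by rw [S.2]; omega)) hp
    have hmodel : MeasureTheory.IsProbabilityMeasure (modelLaw d n (edgeProb d c n)) := by
      unfold modelLaw; infer_instance
    change _ ≤ modelLaw d n (edgeProb d c n) _
    set μ := modelLaw d n (edgeProb d c n)
    -- The whole space is covered by the good event, the two unlikely events and the null set of
    -- impossible contributions, whose measure is inserted as a summand 0. Subadditivity requires no
    -- measurability of the good event.
    rw [ENNReal.ofReal_add MeasureTheory.measureReal_nonneg MeasureTheory.measureReal_nonneg,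
      MeasureTheory.ofReal_measureReal, MeasureTheory.ofReal_measureReal, tsub_le_iff_right,
      ← MeasureTheory.measure_univ (μ := μ), ← add_zero (_ + (_ + _)),
      ← modelLaw_not_isValid (n := n) (by omega : 1 ≤ d) hp, add_assoc]
    refine le_trans ?_ ((MeasureTheory.measure_union_le _ _).trans (add_le_add_right
      ((MeasureTheory.measure_union_le _ _).trans (add_le_add_left
        (MeasureTheory.measure_union_le _ _) _)) _))
    refine MeasureTheory.measure_mono fun ω _ => ?_
    by_contra hω
    simp only [Set.mem_union, Set.mem_ofPred_eq, not_or, not_not] at hω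
    obtain ⟨hgood, ⟨hB, hC⟩, hV⟩ := hω
    refine hgood fun L hL => ?_
    obtain ⟨t, s, hrun, -, hsol, U, -, hfail, hU⟩ := hP n k hn _ hV.isDCNF L hL
    exact ⟨t, s, hrun, hsol fun h =>
      hC (hasBadChain_of_largeComponent hV hB (hU hK) hlog (hfail.1 h))⟩
  · filter_upwards [eventually_edgeProb_le_one hd hc0] with n hp
    have hprob : ∀ S : Hyperedge d n,
        MeasureTheory.IsProbabilityMeasure (hyperedgeLaw (edgeProb d c n) S.1) := fun S =>
      isProbabilityMeasure_hyperedgeLaw (Finset.card_pos.1 (by rw [S.2]; omega)) hp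
    have hmodel : MeasureTheory.IsProbabilityMeasure (modelLaw d n (edgeProb d c n)) := by
      unfold modelLaw; infer_instance
    exact MeasureTheory.prob_le_one (μ := modelLaw d n (edgeProb d c n))
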